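/- Let $k$ be a commutative ring and let $M$ be a (Hausdorff, second countable, finite-dimensional) real $C^\infty$ manifold. Let $D^b(k_{M\times\mathbb R})$ be the bounded derived category of sheaves of $k$-modules on $M\times\mathbb R$. For $F$ in it let $SS(F)\subset T^*(M\times\mathbb R)$ be its microsupport: $p\notin SS(F)$ iff $p$ has an open neighbourhood $U$ such that $(R\Gamma_{\{\varphi\ge 0\}}F)_{y}=0$ for every $y\in M\times\mathbb R$ and every real $C^1$ function $\varphi$ defined near $y$ with $\varphi(y)=0$ and $d\varphi(y)\in U$. Let $\tau$ be the covariable dual to the coordinate $t$ of $\mathbb R$, and let $D^b(k^\gamma_M)$ be the Verdier quotient of $D^b(k_{M\times\mathbb R})$ by the triangulated subcategory of all $F$ with $SS(F)\subset\{\tau\le 0\}$. For $c\in\mathbb R$ let $T_c(x,t)=(x,t+c)$ and let $F\star k_{M\times[c,\infty)}=Rs_*(q^{-1}F)$, where $q,s\colon (M\times\mathbb R)\times[c,\infty)\to M\times\mathbb R$ are $q(x,t,u)=(x,t)$ and $s(x,t,u)=(x,t+u)$. For $c\le e$, restriction to the slice $u=e$ gives a morphism $r_{c,e}\colon F\star k_{M\times[c,\infty)}\to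 T_{e*}F$. For all $c$ and $F$, the morphism $r_{c,c}$ is an isomorphism in $D^b(k^\gamma_M)$. For $c\le d$ put $\tau_{c,d}(F)=r_{c,d}\circ r_{c,c}^{-1}\colon T_{c*}F\to T_{d*}F$ in $D^b(k^\gamma_M)$. Then $\tau_{c,c}(F)=\mathrm{id}$ and $\tau_{c,d}(F)\circ\tau_{b,c}(F)=\tau_{b,d}(F)$ for $b\le c\le d$. Call $F$ a torsion object if $\tau_{0,c}(F)\colon F\simeq T_{0*}F\to T_{c*}F$ is $0$ in $D^b(k^\gamma_M)$ for some $c\ge 0$. The torsion objects form a triangulated subcategory $\mathscr N^\gamma_{\mathrm{tor}}$ of $D^b(k^\gamma_M)$. Let $\mathscr T(k_M)=D^b(k^\gamma_M)/\mathscr N^\gamma_{\mathrm{tor}}$ be the Verdier quotient. For every $F$ and every $c\ge 0$, $\tau_{0,c}(F)$ is invertible in $\mathscr T(k_M)$. For all $F,G\in D^b(k^\gamma_M)$, the morphism of $k$-modules $$\varinjlim_{c\to+\infty}\operatorname{Hom}_{D^b(k^\gamma_M)}(F,T_{c*}G)\longrightarrow \operatorname{Hom}_{\mathscr T(k_M)}(F,G)$$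 which sends the class of $u\colon F\to T_{c*}G$ to $\tau_{0,c}(G)^{-1}\circ u$, the transition maps of the colimit being the compositions with $\tau_{c,d}(G)$, is well defined and is an isomorphism. -/

import Mathlib

open CategoryTheory Limits TopologicalSpace
open scoped Manifold ContDiff NNReal

universe u

noncomputable section

namespace SheafTorsion

/-! ### Sheaves of modules and their bounded derived category -/

section Sheaves

/-- Sheaves of `k`-modules on `X`. -/
abbrev Sh (k : Type u) [CommRing k] (X : TopCat.{u}) := TopCat.Sheaf (ModuleCat.{u} k) X

variable (k : Type u) [CommRing k]

instance (X : TopCat.{u}) : Linear k (Sh k X) where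
  homModule _ _ :=
    { smul := fun a f => ⟨a • f.hom⟩
      one_smul := fun f => CategoryTheory.Sheaf.hom_ext (one_smul k f.hom)
      mul_smul := fun a b f => CategoryTheory.Sheaf.hom_ext (mul_smul a b f.hom)
      smul_zero := fun a => CategoryTheory.Sheaf.hom_ext (smul_zero a)
      smul_add := fun a f g => CategoryTheory.Sheaf.hom_ext (smul_add a f.hom g.hom)
      add_smul := fun a b f => CategoryTheory.Sheaf.hom_ext (add_smul a b f.hom)
      zero_smul := fun f => CategoryTheory.Sheaf.hom_ext (zero_smul k f.hom) }
  smul_comp _ _ _ a f g := CategoryTheory.Sheaf.hom_ext (Linear.smul_comp _ _ _ a f.hom g.hom)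
  comp_smul _ _ _ f a g := CategoryTheory.Sheaf.hom_ext (Linear.comp_smul _ _ _ f.hom a g.hom)

instance (X : TopCat.{u}) : HasDerivedCategory.{u+1} (Sh k X) :=
  HasDerivedCategory.standard _

/-- The bounded derived category of sheaves of `k`-modules on `X`. -/
abbrev Db (X : TopCat.{u}) := DerivedCategory.Bounded (Sh k X)

variable {X Y Z : TopCat.{u}}

instance (f : X ⟶ Y) : PreservesFiniteLimits (TopCat.Sheaf.pullback (ModuleCat.{u} k) f) := by
  have : ReflectsLimits (forget (ModuleCat.{u} k)) := reflectsLimits_of_reflectsIsomorphisms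
  apply Functor.sheafPullbackConstruction.preservesFiniteLimits

instance (f : X ⟶ Y) : (TopCat.Sheaf.pullback (ModuleCat.{u} k) f).Additive :=
  Functor.additive_of_preserves_binary_products _

end Sheaves

/-! ### Exact functors on bounded derived categories -/

section Derived

variable {C₁ C₂ C₃ : Type (u + 1)} [Category.{u} C₁] [Category.{u} C₂] [Category.{u} C₃]
  [Abelian C₁] [Abelian C₂] [Abelian C₃]
  [HasDerivedCategory.{u+1} C₁] [HasDerivedCategory.{u+1} C₂] [HasDerivedCategory.{u+1} C₃]

lemma bounded_mapDerivedCategory (F : C₁ ⥤ C₂) [F.Additive] [PreservesFiniteLimits F]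
    [PreservesFiniteColimits F] (X : DerivedCategory C₁)
    (hX : DerivedCategory.TStructure.t.bounded X) :
    DerivedCategory.TStructure.t.bounded (F.mapDerivedCategory.obj X) := by
  obtain ⟨⟨a, ha⟩, ⟨b, hb⟩⟩ := hX
  refine ⟨⟨a, ?_⟩, ⟨b, ?_⟩⟩
  · obtain ⟨K, hK, ⟨e⟩⟩ := DerivedCategory.exists_iso_Q_obj_of_isGE X a
    have : CochainComplex.IsStrictlyGE ((F.mapHomologicalComplex (.up ℤ)).obj K) a := by
      rw [CochainComplex.isStrictlyGE_iff]
      intro i hi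
      exact F.map_isZero (K.isZero_of_isStrictlyGE a i hi)
    have h : ((F.mapHomologicalComplex (.up ℤ) ⋙ DerivedCategory.Q).obj K).IsGE a :=
      inferInstanceAs ((DerivedCategory.Q.obj ((F.mapHomologicalComplex (.up ℤ)).obj K)).IsGE a)
    exact DerivedCategory.TStructure.t.isGE_of_iso
      ((F.mapDerivedCategory.mapIso e ≪≫ F.mapDerivedCategoryFactors.app K).symm) a
  · obtain ⟨K, hK, ⟨e⟩⟩ := DerivedCategory.exists_iso_Q_obj_of_isLE X b
    have : CochainComplex.IsStrictlyLE ((F.mapHomologicalComplex (.up ℤ)).obj K) b := by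
      rw [CochainComplex.isStrictlyLE_iff]
      intro i hi
      exact F.map_isZero (K.isZero_of_isStrictlyLE b i hi)
    have h : ((F.mapHomologicalComplex (.up ℤ) ⋙ DerivedCategory.Q).obj K).IsLE b :=
      inferInstanceAs ((DerivedCategory.Q.obj ((F.mapHomologicalComplex (.up ℤ)).obj K)).IsLE b)
    exact DerivedCategory.TStructure.t.isLE_of_iso
      ((F.mapDerivedCategory.mapIso e ≪≫ F.mapDerivedCategoryFactors.app K).symm) b

/-- The functor between bounded derived categories induced by an exact functor. -/
def dbMap (F : C₁ ⥤ C₂) [F.Additive] [PreservesFiniteLimits F] [PreservesFiniteColimits F] :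
    DerivedCategory.Bounded C₁ ⥤ DerivedCategory.Bounded C₂ :=
  DerivedCategory.TStructure.t.bounded.lift (DerivedCategory.Bounded.ι ⋙ F.mapDerivedCategory)
    (fun X => bounded_mapDerivedCategory F X.obj X.property)

/-- Two functors to a bounded derived category are isomorphic if they are so after inclusion in
the derived category. -/
def liftIso {A : Type*} [Category* A] {F G : A ⥤ DerivedCategory.Bounded C₁}
    (e : F ⋙ DerivedCategory.Bounded.ι ≅ G ⋙ DerivedCategory.Bounded.ι) : F ≅ G :=
  ((DerivedCategory.TStructure.t.bounded (C := DerivedCategory C₁)).fullyFaithfulι.whiskeringRight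
    A).preimageIso e

/-- An isomorphism of exact functors induces an isomorphism of derived functors. -/
def dbMapIso {F G : C₁ ⥤ C₂} [F.Additive] [PreservesFiniteLimits F] [PreservesFiniteColimits F]
    [G.Additive] [PreservesFiniteLimits G] [PreservesFiniteColimits G] (e : F ≅ G) :
    dbMap F ≅ dbMap G :=
  liftIso (Functor.isoWhiskerLeft DerivedCategory.Bounded.ι
    (Localization.liftNatIso DerivedCategory.Q
      (HomologicalComplex.quasiIso C₁ (ComplexShape.up ℤ))
      (F.mapHomologicalComplex (ComplexShape.up ℤ) ⋙ DerivedCategory.Q)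
      (G.mapHomologicalComplex (ComplexShape.up ℤ) ⋙ DerivedCategory.Q)
      F.mapDerivedCategory G.mapDerivedCategory
      (Functor.isoWhiskerRight (NatIso.mapHomologicalComplex e _) DerivedCategory.Q)))

/-- The derived functor of the identity. -/
def dbMapId : dbMap (𝟭 C₁) ≅ 𝟭 _ :=
  liftIso (Functor.isoWhiskerLeft DerivedCategory.Bounded.ι
    (Localization.liftNatIso DerivedCategory.Q
      (HomologicalComplex.quasiIso C₁ (ComplexShape.up ℤ))
      ((𝟭 C₁).mapHomologicalComplex (ComplexShape.up ℤ) ⋙ DerivedCategory.Q)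
      DerivedCategory.Q
      (𝟭 C₁).mapDerivedCategory (𝟭 _)
      (Functor.isoWhiskerRight (Functor.mapHomologicalComplexIdIso _ _) DerivedCategory.Q)))

/-- The derived functor of a composition of exact functors. -/
def dbMapComp (F : C₁ ⥤ C₂) [F.Additive] [PreservesFiniteLimits F] [PreservesFiniteColimits F]
    (G : C₂ ⥤ C₃) [G.Additive] [PreservesFiniteLimits G] [PreservesFiniteColimits G]
    [(F ⋙ G).Additive] [PreservesFiniteLimits (F ⋙ G)] [PreservesFiniteColimits (F ⋙ G)] :
    dbMap (F ⋙ G) ≅ dbMap F ⋙ dbMap G :=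
  liftIso (Functor.isoWhiskerLeft DerivedCategory.Bounded.ι
    (Localization.liftNatIso DerivedCategory.Q
      (HomologicalComplex.quasiIso C₁ (ComplexShape.up ℤ))
      ((F ⋙ G).mapHomologicalComplex (ComplexShape.up ℤ) ⋙ DerivedCategory.Q)
      ((F ⋙ G).mapHomologicalComplex (ComplexShape.up ℤ) ⋙ DerivedCategory.Q)
      (F ⋙ G).mapDerivedCategory (F.mapDerivedCategory ⋙ G.mapDerivedCategory)
      (h₂ := ⟨Functor.isoWhiskerRight F.mapDerivedCategoryFactors G.mapDerivedCategory ≪≫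
        Functor.isoWhiskerLeft (F.mapHomologicalComplex (ComplexShape.up ℤ))
          G.mapDerivedCategoryFactors⟩)
      (Iso.refl _)))

end Derived

/-! ### Microsupport -/

section Microsupport

open scoped ZeroObject

variable (k : Type u) [CommRing k] {X : TopCat.{u}}

/-- The sheaf `k_W` (constant on the open set `W`, extended by zero), functorially in `W`. -/
def constOpen : Opens X ⥤ Sh k X :=
  yoneda ⋙ (Functor.whiskeringRight _ _ _).obj (ModuleCat.free k) ⋙
    presheafToSheaf (Opens.grothendieckTopology X) (ModuleCat.{u} k)

/-- The interior of `{x ∈ W | φ x < 0}`. It equals `{x ∈ W | φ x < 0}` if `φ` is continuous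
on `W`. -/
def negPart (φ : X → ℝ) (W : Opens X) : Opens X :=
  ⟨interior {x | x ∈ W ∧ φ x < 0}, isOpen_interior⟩

lemma negPart_le (φ : X → ℝ) (W : Opens X) : negPart φ W ≤ W :=
  fun _ hx => (interior_subset hx).1

lemma negPart_mono (φ : X → ℝ) {W' W : Opens X} (h : W' ≤ W) : negPart φ W' ≤ negPart φ W :=
  interior_mono fun _ hx => ⟨h hx.1, hx.2⟩

/-- The sheaf `k_{W ∩ {φ ≥ 0}}`: the cokernel of `k_{W ∩ {φ < 0}} ⟶ k_W`. -/
def constNonneg (φ : X → ℝ) (W : Opens X) : Sh k X :=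
  cokernel ((constOpen k).map (homOfLE (negPart_le φ W)))

/-- The natural morphism `k_{W' ∩ {φ ≥ 0}} ⟶ k_{W ∩ {φ ≥ 0}}` for `W' ≤ W`. -/
def constNonnegMap (φ : X → ℝ) {W' W : Opens X} (h : W' ≤ W) :
    constNonneg k φ W' ⟶ constNonneg k φ W :=
  cokernel.map _ _ ((constOpen k).map (homOfLE (negPart_mono φ h)))
    ((constOpen k).map (homOfLE h)) (by
      rw [← Functor.map_comp, ← Functor.map_comp]
      rfl)

/-- The projection `k_W ⟶ k_{W ∩ {φ ≥ 0}}`. -/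
def constNonnegProj (φ : X → ℝ) (W : Opens X) : (constOpen k).obj W ⟶ constNonneg k φ W :=
  cokernel.π ((constOpen k).map (homOfLE (negPart_le φ W)))

instance (φ : X → ℝ) (W : Opens X) : Epi (constNonnegProj k φ W) :=
  inferInstanceAs (Epi (cokernel.π ((constOpen k).map (homOfLE (negPart_le φ W)))))

lemma constNonnegProj_map (φ : X → ℝ) {W' W : Opens X} (h : W' ≤ W) :
    constNonnegProj k φ W' ≫ constNonnegMap k φ h =
      (constOpen k).map (homOfLE h) ≫ constNonnegProj k φ W :=
  cokernel.π_desc _ _ _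

lemma constNonnegMap_comp (φ : X → ℝ) {W'' W' W : Opens X} (h' : W'' ≤ W') (h : W' ≤ W) :
    constNonnegMap k φ (h'.trans h) = constNonnegMap k φ h' ≫ constNonnegMap k φ h := by
  rw [← cancel_epi (constNonnegProj k φ W''), constNonnegProj_map, ← Category.assoc,
    constNonnegProj_map, Category.assoc, constNonnegProj_map, ← Functor.map_comp_assoc]
  rfl

variable {k}

/-- The condition `(RΓ_{φ ≥ 0} F)_x = 0`, for `φ` continuous on the open neighborhood `Ω` of `x`.
It says that, for every `n`, the colimit over the open neighborhoods `W ≤ Ω` of `x` of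
`Hⁿ_{φ ≥ 0}(W; F) = Hom(k_{W ∩ {φ ≥ 0}}[-n], F)` vanishes. -/
def StalkVanishes (F : DerivedCategory (Sh k X)) (φ : X → ℝ) (Ω : Opens X) (x : X) : Prop :=
  ∀ (n : ℤ) (W : Opens X) (_ : W ≤ Ω) (_ : x ∈ W)
    (α : (DerivedCategory.singleFunctor (Sh k X) n).obj (constNonneg k φ W) ⟶ F),
    ∃ (W' : Opens X) (h : W' ≤ W), x ∈ W' ∧
      (DerivedCategory.singleFunctor (Sh k X) n).map (constNonnegMap k φ h) ≫ α = 0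

lemma StalkVanishes.of_isZero {F : DerivedCategory (Sh k X)} (hF : IsZero F) (φ : X → ℝ)
    (Ω : Opens X) (x : X) : StalkVanishes F φ Ω x :=
  fun _ W _ hx _ => ⟨W, le_rfl, hx, hF.eq_of_tgt _ _⟩

lemma StalkVanishes.of_iso {F G : DerivedCategory (Sh k X)} (e : F ≅ G) {φ : X → ℝ}
    {Ω : Opens X} {x : X} (hF : StalkVanishes F φ Ω x) : StalkVanishes G φ Ω x := by
  intro n W hW hx α
  obtain ⟨W', h, hx', h0⟩ := hF n W hW hx (α ≫ e.inv)
  refine ⟨W', h, hx', ?_⟩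
  rw [← cancel_mono e.inv, Category.assoc, h0, zero_comp]

lemma StalkVanishes.ext₂ (T : Pretriangulated.Triangle (DerivedCategory (Sh k X)))
    (hT : T ∈ Pretriangulated.distinguishedTriangles) {φ : X → ℝ} {Ω : Opens X} {x : X}
    (h₁ : StalkVanishes T.obj₁ φ Ω x) (h₃ : StalkVanishes T.obj₃ φ Ω x) :
    StalkVanishes T.obj₂ φ Ω x := by
  intro n W hW hx α
  obtain ⟨W', h, hx', h0⟩ := h₃ n W hW hx (α ≫ T.mor₂)
  obtain ⟨β, hβ⟩ := Pretriangulated.Triangle.coyoneda_exact₂ T hT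
    ((DerivedCategory.singleFunctor (Sh k X) n).map (constNonnegMap k φ h) ≫ α)
    (by rw [Category.assoc, h0])
  obtain ⟨W'', h', hx'', h0'⟩ := h₁ n W' (h.trans hW) hx' β
  refine ⟨W'', h'.trans h, hx'', ?_⟩
  rw [constNonnegMap_comp k φ h' h, Functor.map_comp, Category.assoc, hβ, ← Category.assoc, h0',
    zero_comp]

lemma StalkVanishes.shift {F : DerivedCategory (Sh k X)} (a : ℤ) {φ : X → ℝ}
    {Ω : Opens X} {x : X} (hF : StalkVanishes F φ Ω x) : StalkVanishes (F⟦a⟧) φ Ω x := by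
  intro n W hW hx α
  let e := (DerivedCategory.singleFunctors (Sh k X)).shiftIso a n (a + n) rfl
  obtain ⟨β, hβ⟩ := (shiftFunctor (DerivedCategory (Sh k X)) a).map_surjective
    (e.hom.app (constNonneg k φ W) ≫ α)
  obtain ⟨W', h, hx', h0⟩ := hF (a + n) W hW hx β
  refine ⟨W', h, hx', ?_⟩
  have hn := e.hom.naturality (constNonnegMap k φ h)
  rw [← cancel_epi (e.hom.app _), comp_zero, ← Category.assoc]
  refine (congrArg (· ≫ α) hn.symm).trans ?_
  rw [Category.assoc, ← hβ]
  refine ((shiftFunctor (DerivedCategory (Sh k X)) a).map_comp _ _).symm.trans ?_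
  refine (congrArg (shiftFunctor (DerivedCategory (Sh k X)) a).map h0).trans ?_
  exact Functor.map_zero _ _ _

variable {E H : Type*} [NormedAddCommGroup E] [NormedSpace ℝ E] [TopologicalSpace H]

/-- The cotangent bundle of a manifold. -/
abbrev Cotangent (I : ModelWithCorners ℝ E H) (N : Type*) [TopologicalSpace N]
    [ChartedSpace H N] [IsManifold I ∞ N] : Type _ :=
  Bundle.TotalSpace (E →L[ℝ] ℝ) (fun x : N => TangentSpace I x →L[ℝ] ℝ)

variable (I : ModelWithCorners ℝ E H) {N : Type u} [TopologicalSpace N] [ChartedSpace H N]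
  [IsManifold I ∞ N]

/-- The microsupport of a complex of sheaves on a manifold: `p` is not in it if there is an open
neighborhood `U` of `p` in the cotangent bundle such that `(RΓ_{φ ≥ 0} F)_x = 0` for all `x` and
all real functions `φ` of class `C¹` near `x` with `φ x = 0` and `dφ(x) ∈ U`. -/
def microsupport (F : DerivedCategory (Sh k (TopCat.of N))) : Set (Cotangent I N) :=
  {p | ¬ ∃ U : Set (Cotangent I N), IsOpen U ∧ p ∈ U ∧
    ∀ (x : N) (φ : N → ℝ) (Ω : Opens N), x ∈ Ω →
      ContMDiffOn I (modelWithCornersSelf ℝ ℝ) 1 φ Ω → φ x = 0 →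
      (⟨x, mfderiv I (modelWithCornersSelf ℝ ℝ) φ x⟩ : Cotangent I N) ∈ U →
      StalkVanishes (X := TopCat.of N) F φ Ω x}

/-- The complexes of sheaves whose microsupport does not meet `A`. -/
def NotMeeting (A : Set (Cotangent I N)) : ObjectProperty (Db k (TopCat.of N)) :=
  fun F => Disjoint (microsupport I F.obj) A

instance (A : Set (Cotangent I N)) : (NotMeeting (k := k) I A).IsClosedUnderIsomorphisms where
  of_iso {F G} e hF := by
    rw [NotMeeting, Set.disjoint_right] at hF ⊢
    intro p hp hG
    refine hF hp fun ⟨U, hU, hpU, h⟩ => hG ⟨U, hU, hpU, fun x φ Ω hx hφ h0 hd => ?_⟩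
    exact (h x φ Ω hx hφ h0 hd).of_iso (DerivedCategory.Bounded.ι.mapIso e)

instance (A : Set (Cotangent I N)) : (NotMeeting (k := k) I A).IsTriangulated where
  exists_zero := by
    refine ⟨0, isZero_zero _, ?_⟩
    rw [NotMeeting, Set.disjoint_right]
    intro p _ hF
    exact hF ⟨Set.univ, isOpen_univ, trivial, fun x φ Ω _ _ _ _ => StalkVanishes.of_isZero
      (DerivedCategory.Bounded.ι.map_isZero (isZero_zero (Db k (TopCat.of N)))) φ Ω x⟩
  isStableUnderShiftBy a :=
    { le_shift := by
        intro F hF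
        change NotMeeting I A (F⟦a⟧)
        rw [NotMeeting, Set.disjoint_right] at hF ⊢
        intro p hp hG
        refine hF hp fun ⟨U, hU, hpU, h⟩ => hG ⟨U, hU, hpU, fun x φ Ω hx hφ h0 hd => ?_⟩
        exact ((h x φ Ω hx hφ h0 hd).shift a).of_iso
          ((DerivedCategory.Bounded.ι.commShiftIso a).app F).symm }
  ext₂' T hT h₁ h₃ := by
    refine ObjectProperty.le_isoClosure _ _ ?_
    rw [NotMeeting, Set.disjoint_right] at h₁ h₃ ⊢
    intro p hp hG
    refine h₁ hp fun ⟨U, hU, hpU, h⟩ => h₃ hp fun ⟨U', hU', hpU', h'⟩ =>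
      hG ⟨U ∩ U', hU.inter hU', ⟨hpU, hpU'⟩, fun x φ Ω hx hφ h0 hd => ?_⟩
    exact StalkVanishes.ext₂ (DerivedCategory.Bounded.ι.mapTriangle.obj T)
      (DerivedCategory.Bounded.ι.map_distinguished T hT)
      (h x φ Ω hx hφ h0 hd.1) (h' x φ Ω hx hφ h0 hd.2)

end Microsupport

/-! ### Inverse images, direct images and translations -/

section Operations

variable (k : Type u) [CommRing k]

/-- The inverse image functor `f⁻¹` on bounded derived categories. -/
abbrev pull {X Y : TopCat.{u}} (f : X ⟶ Y) : Db k Y ⥤ Db k X :=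
  dbMap (TopCat.Sheaf.pullback (ModuleCat.{u} k) f)

variable {k} in
/-- `(P, ε)` is the derived direct image `Rf_* A` with its counit `f⁻¹ Rf_* A ⟶ A`, that is,
it represents the functor `H ↦ Hom(f⁻¹ H, A)`. -/
def IsDirectImage {X Y : TopCat.{u}} (f : X ⟶ Y) (A : Db k X) (P : Db k Y)
    (ε : (pull k f).obj P ⟶ A) : Prop :=
  ∀ H : Db k Y, Function.Bijective (fun a : H ⟶ P => (pull k f).map a ≫ ε)

/-- `f_*` for the identity is the identity. -/
def pushforwardId {X : TopCat.{u}} {f : X ⟶ X} (hf : f = 𝟙 X) :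
    TopCat.Sheaf.pushforward (ModuleCat.{u} k) f ≅ 𝟭 (Sh k X) :=
  eqToIso (by subst hf; rfl)

/-- `g_* f_* = h_*` if `h = g ∘ f`. -/
def pushforwardComp {X Y Z : TopCat.{u}} {f : X ⟶ Y} {g : Y ⟶ Z} {h : X ⟶ Z}
    (w : f ≫ g = h) :
    TopCat.Sheaf.pushforward (ModuleCat.{u} k) f ⋙ TopCat.Sheaf.pushforward (ModuleCat.{u} k) g ≅
      TopCat.Sheaf.pushforward (ModuleCat.{u} k) h :=
  eqToIso (by subst w; rfl)

variable (M : Type u) [TopologicalSpace M]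

/-- The space `M × ℝ`. -/
abbrev MR : TopCat.{u} := TopCat.of (M × ℝ)

/-- The translation `(x, t) ↦ (x, t + c)` of `M × ℝ`. -/
def translation (c : ℝ) : MR M ⟶ MR M :=
  TopCat.ofHom ⟨fun p => (p.1, p.2 + c), by fun_prop⟩

lemma translation_zero : translation M 0 = 𝟙 _ := by
  exact TopCat.hom_ext (ContinuousMap.ext fun p => Prod.ext rfl (add_zero p.2))

lemma translation_comp (c d : ℝ) :
    translation M c ≫ translation M d = translation M (c + d) := by
  exact TopCat.hom_ext (ContinuousMap.ext fun p => Prod.ext rfl (add_assoc p.2 c d))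

/-- The direct image by the translation by `c`, on sheaves, is an equivalence of categories. -/
def translationEquiv (c : ℝ) : Sh k (MR M) ≌ Sh k (MR M) :=
  CategoryTheory.Equivalence.mk (TopCat.Sheaf.pushforward (ModuleCat.{u} k) (translation M c))
    (TopCat.Sheaf.pushforward (ModuleCat.{u} k) (translation M (-c)))
    (pushforwardComp k (translation_comp M c (-c)) ≪≫
      pushforwardId k (by rw [add_neg_cancel, translation_zero])).symm
    (pushforwardComp k (translation_comp M (-c) c) ≪≫
      pushforwardId k (by rw [neg_add_cancel, translation_zero]))

instance (c : ℝ) : (TopCat.Sheaf.pushforward (ModuleCat.{u} k) (translation M c)).IsEquivalence :=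
  (translationEquiv k M c).isEquivalence_functor

instance (c : ℝ) : (TopCat.Sheaf.pushforward (ModuleCat.{u} k) (translation M c)).Additive :=
  Functor.additive_of_preserves_binary_products _

/-- The functor `T_{c*}` on the bounded derived category of `M × ℝ`. -/
def Tr (c : ℝ) : Db k (MR M) ⥤ Db k (MR M) :=
  dbMap (TopCat.Sheaf.pushforward (ModuleCat.{u} k) (translation M c))

/-- `T_{0*}` is the identity. -/
def trZero : Tr k M 0 ≅ 𝟭 _ :=
  dbMapIso (pushforwardId k (translation_zero M)) ≪≫ dbMapId

/-! ### Convolution with the constant sheaf on `M × [c, ∞)` -/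

/-- The space `(M × ℝ) × [c, ∞)`. -/
abbrev MRc (c : ℝ) : TopCat.{u} := TopCat.of ((M × ℝ) × Set.Ici c)

/-- The projection `(x, t, u) ↦ (x, t)`. -/
def convProj (c : ℝ) : MRc M c ⟶ MR M :=
  TopCat.ofHom ⟨fun p => p.1, by fun_prop⟩

/-- The sum `(x, t, u) ↦ (x, t + u)`. -/
def convSum (c : ℝ) : MRc M c ⟶ MR M :=
  TopCat.ofHom ⟨fun p => (p.1.1, p.1.2 + p.2), by fun_prop⟩

/-- The embedding `(x, t) ↦ (x, t - e, e)`, for `c ≤ e`. It is the inclusion of the slice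
`u = e`, parametrized by the sum. -/
def convSlice {c e : ℝ} (h : c ≤ e) : MR M ⟶ MRc M c :=
  TopCat.ofHom ⟨fun p => ((p.1, p.2 - e), ⟨e, h⟩), by fun_prop⟩

lemma convSlice_sum {c e : ℝ} (h : c ≤ e) : convSlice M h ≫ convSum M c = 𝟙 _ := by
  exact TopCat.hom_ext (ContinuousMap.ext fun p => Prod.ext rfl (sub_add_cancel p.2 e))

lemma convSlice_proj {c e : ℝ} (h : c ≤ e) :
    convSlice M h ≫ convProj M c = translation M (-e) := by
  exact TopCat.hom_ext (ContinuousMap.ext fun p => Prod.ext rfl (sub_eq_add_neg p.2 e))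

/-- The restriction of `s⁻¹ P` to the slice `u = e` is `P`, where `s` is the sum. -/
def sliceSumIso {c e : ℝ} (h : c ≤ e) :
    pull k (convSum M c) ⋙ pull k (convSlice M h) ≅ 𝟭 _ :=
  (dbMapComp _ _).symm ≪≫
    dbMapIso (Adjunction.leftAdjointUniq
      ((TopCat.Sheaf.pullbackPushforwardAdjunction (ModuleCat.{u} k) (convSum M c)).comp
        (TopCat.Sheaf.pullbackPushforwardAdjunction (ModuleCat.{u} k) (convSlice M h)))
      (Adjunction.id.ofNatIsoRight
        (pushforwardComp k (convSlice_sum M h) ≪≫ pushforwardId k rfl).symm)) ≪≫ dbMapId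

/-- The restriction of `q⁻¹ F` to the slice `u = e` is `T_{e*} F`, where `q` is the projection. -/
def sliceProjIso {c e : ℝ} (h : c ≤ e) :
    pull k (convProj M c) ⋙ pull k (convSlice M h) ≅ Tr k M e :=
  (dbMapComp _ _).symm ≪≫
    dbMapIso (Adjunction.leftAdjointUniq
      ((TopCat.Sheaf.pullbackPushforwardAdjunction (ModuleCat.{u} k) (convProj M c)).comp
        (TopCat.Sheaf.pullbackPushforwardAdjunction (ModuleCat.{u} k) (convSlice M h)))
      ((translationEquiv k M e).toAdjunction.ofNatIsoRight
        (pushforwardComp k (convSlice_proj M h)).symm))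

variable {k M}

/-- `(P, ε)` is the convolution `F ⋆ k_{M × [c, ∞)} = Rs_*(q⁻¹ F)`, where `q` and `s` are the
projection and the sum from `(M × ℝ) × [c, ∞)` to `M × ℝ`. -/
def IsConv (c : ℝ) (F P : Db k (MR M))
    (ε : (pull k (convSum M c)).obj P ⟶ (pull k (convProj M c)).obj F) : Prop :=
  IsDirectImage (convSum M c) ((pull k (convProj M c)).obj F) P ε

/-- The morphism `F ⋆ k_{M × [c, ∞)} ⟶ F ⋆ k_{M × {e}} = T_{e*} F` induced by the restriction
`k_{M × [c, ∞)} ⟶ k_{M × {e}}`, for `c ≤ e`. -/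
def convEval {c e : ℝ} (h : c ≤ e) {F P : Db k (MR M)}
    (ε : (pull k (convSum M c)).obj P ⟶ (pull k (convProj M c)).obj F) : P ⟶ (Tr k M e).obj F :=
  (sliceSumIso k M h).inv.app P ≫ (pull k (convSlice M h)).map ε ≫ (sliceProjIso k M h).hom.app F

end Operations

/-! ### The quotient categories -/

section Tamarkin

variable (k : Type u) [CommRing k]
variable {E : Type u} [NormedAddCommGroup E] [NormedSpace ℝ E]
variable (M : Type u) [TopologicalSpace M] [ChartedSpace E M]
  [IsManifold (modelWithCornersSelf ℝ E) ∞ M]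

/-- The model with corners of the manifold `M × ℝ`. -/
abbrev modelMR (E : Type u) [NormedAddCommGroup E] [NormedSpace ℝ E] :
    ModelWithCorners ℝ (E × ℝ) (ModelProd E ℝ) :=
  (modelWithCornersSelf ℝ E).prod (modelWithCornersSelf ℝ ℝ)

/-- The open subset `{τ > 0}` of the cotangent bundle of `M × ℝ`, where `τ` is the value of a
covector on the unit tangent vector of `ℝ`. -/
def Ugamma (E : Type u) [NormedAddCommGroup E] [NormedSpace ℝ E]
    (M : Type u) [TopologicalSpace M] [ChartedSpace E M]
    [IsManifold (modelWithCornersSelf ℝ E) ∞ M] : Set (Cotangent (modelMR E) (M × ℝ)) :=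
  {p | 0 < p.2 (show E × ℝ from (0, 1))}

/-- The complexes of sheaves on `M × ℝ` with microsupport contained in `{τ ≤ 0}`. -/
abbrev NZ (E : Type u) [NormedAddCommGroup E] [NormedSpace ℝ E]
    (M : Type u) [TopologicalSpace M] [ChartedSpace E M]
    [IsManifold (modelWithCornersSelf ℝ E) ∞ M] : ObjectProperty (Db k (MR M)) :=
  NotMeeting (modelMR E) (Ugamma E M)

variable (E)

/-- The category `D^b(k^γ_M) = D^b(k_{M × ℝ}; {τ > 0})`: the Verdier quotient of `D^b(k_{M × ℝ})`
by the complexes with microsupport contained in `{τ ≤ 0}`. -/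
abbrev Dgamma := (NZ k E M).trW.Localization

/-- The quotient functor `D^b(k_{M × ℝ}) ⥤ D^b(k^γ_M)`. -/
abbrev Qgamma : Db k (MR M) ⥤ Dgamma k E M := (NZ k E M).trW.Q

variable {k M}

/-- The convolution `F ⋆ k_{M × [c, ∞)}` together with the fact that its natural morphism to
`T_{c*} F` is an isomorphism in `D^b(k^γ_M)`. -/
structure ConvData (c : ℝ) (F : Db k (MR M)) where
  /-- the object `F ⋆ k_{M × [c, ∞)}` -/
  obj : Db k (MR M)
  /-- the counit -/
  counit : (pull k (convSum M c)).obj obj ⟶ (pull k (convProj M c)).obj F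
  isConv : IsConv c F obj counit
  isIso : IsIso ((Qgamma k E M).map (convEval le_rfl counit))

open Classical in
/-- The morphism `τ_{c,d}(F) : T_{c*} F ⟶ T_{d*} F` of `D^b(k^γ_M)`, for `c ≤ d`. It is induced by
`k_{M × [c, ∞)} ⟶ k_{M × [d, ∞)}` through the isomorphisms of `F ⋆ k_{M × [c, ∞)}` with
`T_{c*} F`; equivalently it is the composition of the inverse of
`F ⋆ k_{M × [c, ∞)} ⟶ F ⋆ k_{M × {c}} = T_{c*} F` with
`F ⋆ k_{M × [c, ∞)} ⟶ F ⋆ k_{M × {d}} = T_{d*} F`. -/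
def tau {c d : ℝ} (h : c ≤ d) (F : Db k (MR M)) :
    (Qgamma k E M).obj ((Tr k M c).obj F) ⟶ (Qgamma k E M).obj ((Tr k M d).obj F) :=
  if hF : Nonempty (ConvData E c F) then
    haveI := hF.some.isIso
    inv ((Qgamma k E M).map (convEval le_rfl hF.some.counit)) ≫
      (Qgamma k E M).map (convEval h hF.some.counit)
  else 0

/-- The morphism `τ_{0,c}(F) : F ⟶ T_{c*} F` of `D^b(k^γ_M)`, for `c ≥ 0`. -/
def tauZero (c : ℝ≥0) (F : Db k (MR M)) :
    (Qgamma k E M).obj F ⟶ (Qgamma k E M).obj ((Tr k M c).obj F) :=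
  (Qgamma k E M).map ((trZero k M).inv.app F) ≫ tau E c.2 F

variable (k M)

/-- The torsion objects of `D^b(k^γ_M)`: those `F` with `τ_{0,c}(F) = 0` for some `c ≥ 0`. -/
def Ntor : ObjectProperty (Dgamma k E M) :=
  fun X => ∃ F : Db k (MR M), Nonempty ((Qgamma k E M).obj F ≅ X) ∧
    ∃ c : ℝ≥0, tauZero E c F = 0

/-- The category `𝒯(k_M)`: the quotient of `D^b(k^γ_M)` by the torsion objects. -/
abbrev TorQuot := (Ntor k E M).trW.Localization

/-- The quotient functor `D^b(k^γ_M) ⥤ 𝒯(k_M)`. -/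
abbrev Qtor : Dgamma k E M ⥤ TorQuot k E M := (Ntor k E M).trW.Q

variable {k M}

/-- The `k`-module `Hom(F, T_{c*} G)` in `D^b(k^γ_M)`. -/
abbrev HomTr (F G : Db k (MR M)) (c : ℝ≥0) : Type _ :=
  (Qgamma k E M).obj F ⟶ (Qgamma k E M).obj ((Tr k M c).obj G)

/-- The transition map `Hom(F, T_{c*} G) ⟶ Hom(F, T_{d*} G)`, the composition with `τ_{c,d}(G)`. -/
def homTrMap (F G : Db k (MR M)) (c d : ℝ≥0) (h : c ≤ d) :
    HomTr E F G c →ₗ[k] HomTr E F G d :=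
  Linear.rightComp k _ (tau E (NNReal.coe_le_coe.2 h) G)

/-- The `k`-module `colim_{c → ∞} Hom(F, T_{c*} G)`. -/
abbrev ColimHomTr (F G : Db k (MR M)) : Type _ :=
  Module.DirectLimit (HomTr E F G) (homTrMap E F G)

end Tamarkin

end SheafTorsion

end

open SheafTorsion

/-!
The statement splits into a geometric part, the construction of the morphisms `τ_{c,d}` in
`D^b(k^γ_M)` with their compatibilities, and a formal part about triangulated categories.

**Formal part.** A triangulated category with endofunctors `T c` and natural morphisms
`τ c : X ⟶ T c X`, compatible with the shift, with addition and with each other (`Persistence`),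
has a triangulated subcategory of torsion objects, those with `τ c X = 0` for some `c`. The cone of
`τ c X` is a torsion object (`Persistence.torsion_trW_τ`), and every morphism with torsion cone
divides some `τ c` (`Persistence.exists_comp_eq_τ`). Hence the `τ c` are cofinal among the
denominators of left fractions, and the morphisms `F ⟶ G` of the quotient are the colimit of the
morphisms `F ⟶ T c G` (`Persistence.exists_comp_map_τ_eq_zero`,
`Persistence.exists_map_eq_comp_map_τ`).

**Existence of the convolution.** `Rs_* q⁻¹ F` has bounded cohomology because the part of
`(M × ℝ) × [c, ∞)` over a chart has finite cohomological dimension: finitely many real functions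
separate its points, and induction on their number, with the Mayer–Vietoris argument along the
fibres of the last one and an exhaustion by compact sets, shows that cocycles of flasque complexes
in high degrees are boundaries (`isBoundaryOn_of_separating`, `exists_isConv`).

**The evaluation on the first slice is an isomorphism modulo `{τ ≤ 0}`.** Let `φ` be a function
with `∂φ/∂t > 0` at `x`. On a small box around `x`, the function `φ` is increasing along `ℝ` and
negative at the bottom, so that by excision the sheaf `k_{φ ≥ 0}` on the box is the quotient of the
sheaves `k_U` of two open sets which are stable under moving down in the direction of `ℝ`. Such a
sheaf `K` is descending (`IsDescending`): if `g` is obtained from `f` by moving down, then there is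
a morphism `f⁻¹ K ⟶ g⁻¹ K`. Since `[c, ∞)` retracts to `c` by moving down, homotopy invariance
(`full_pull_cylProj`) implies that the morphisms `s⁻¹ K ⟶ q⁻¹ F` are the same as their restrictions
to the slice `u = c`, that is, `Hom(K, F ⋆ k_{M × [c, ∞)}) = Hom(K, T_{c*} F)`
(`IsDescending.bijective_comp_convEval`). So the cone of the evaluation receives no morphism from
these sheaves, and its microsupport is contained in `{τ ≤ 0}` (`isIso_convEval`).

**The morphisms `τ`.** For any `η : s⁻¹ H ⟶ q⁻¹ F`, the morphism `τ_{c,d}(F)` sends the evaluation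
of `η` on the slice `c` to that on the slice `d` (`convEval_comp_tau`). This characterizes it, and
gives the composition law, naturality, and the compatibility with translations and with the shift,
once the identifications between inverse images by composed maps are known to be coherent
(`pullIso_assoc`). Translations preserve `{τ ≤ 0}` (`NZ_pull_translation`), hence act on
`D^b(k^γ_M)`, and the formal part applies to `persistenceGamma`.
-/

noncomputable section

namespace SheafTorsion

/-! ### Persistence structures on triangulated categories -/

open Pretriangulated
open scoped ZeroObject

section Persistence

variable (D : Type*) [Category* D] [HasZeroObject D] [HasShift D ℤ] [Preadditive D]
  [∀ n : ℤ, (shiftFunctor D n).Additive] [Pretriangulated D]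

/-- A persistence structure on a triangulated category: triangulated endofunctors `T c`, for real
`c ≥ 0`, with natural morphisms `τ c : X ⟶ T c X` compatible with the shift, such that
`τ (c + d)` is, up to an isomorphism, `τ c` followed by `T c (τ d)`, and such that `τ d` at `T c X`
is `T c (τ d)`, up to an isomorphism which is the identity for `c = d`. -/
structure Persistence where
  /-- the endofunctors -/
  T : ℝ≥0 → D ⥤ D
  commShift (c : ℝ≥0) : (T c).CommShift ℤ
  isTriangulated (c : ℝ≥0) : (T c).IsTriangulated
  /-- the structural morphisms -/
  τ (c : ℝ≥0) (X : D) : X ⟶ (T c).obj X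
  τ_naturality (c : ℝ≥0) {X Y : D} (f : X ⟶ Y) : f ≫ τ c Y = τ c X ≫ (T c).map f
  τ_shift (c : ℝ≥0) (n : ℤ) (X : D) :
    ∃ e : ((T c).obj X)⟦n⟧ ≅ (T c).obj (X⟦n⟧), τ c (X⟦n⟧) = (τ c X)⟦n⟧' ≫ e.hom
  τ_add (c d : ℝ≥0) (X : D) : ∃ e : (T c).obj ((T d).obj X) ≅ (T (c + d)).obj X,
    τ (c + d) X = τ c X ≫ (T c).map (τ d X) ≫ e.hom
  τ_obj (c d : ℝ≥0) (X : D) : ∃ e : (T c).obj ((T d).obj X) ≅ (T d).obj ((T c).obj X),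
    τ d ((T c).obj X) = (T c).map (τ d X) ≫ e.hom
  τ_obj_self (c : ℝ≥0) (X : D) : τ c ((T c).obj X) = (T c).map (τ c X)

namespace Persistence

attribute [instance] commShift isTriangulated

variable {D} (S : Persistence D)

/-- The objects `X` such that `τ c X = 0` for some `c`. -/
def torsion : ObjectProperty D := fun X => ∃ c, S.τ c X = 0

instance : S.torsion.IsClosedUnderIsomorphisms where
  of_iso {X Y} e := by
    rintro ⟨c, hc⟩
    refine ⟨c, ?_⟩
    rw [← cancel_epi e.hom, S.τ_naturality, hc, zero_comp, comp_zero]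

lemma τ_shift_eq_zero {c : ℝ≥0} {X : D} (n : ℤ) (h : S.τ c X = 0) : S.τ c (X⟦n⟧) = 0 := by
  obtain ⟨e, he⟩ := S.τ_shift c n X
  rw [he, h, Functor.map_zero, zero_comp]

lemma comp_τ_shift_eq_zero {c : ℝ≥0} {X Y : D} (n : ℤ) (f : Y ⟶ X⟦n⟧)
    (h : f ≫ (S.τ c X)⟦n⟧' = 0) : f ≫ S.τ c (X⟦n⟧) = 0 := by
  obtain ⟨e, he⟩ := S.τ_shift c n X
  rw [he, reassoc_of% h, zero_comp]

/-- If `τ d` and `τ c` vanish on the first and the third term of a distinguished triangle, then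
`τ (c + d)` vanishes on the second one. -/
lemma torsion_ext₂ (T : Triangle D) (hT : T ∈ distTriang D) (h₁ : S.torsion T.obj₁)
    (h₃ : S.torsion T.obj₃) : S.torsion T.obj₂ := by
  obtain ⟨d, hd⟩ := h₁
  obtain ⟨c, hc⟩ := h₃
  refine ⟨c + d, ?_⟩
  obtain ⟨e, he⟩ := S.τ_add c d T.obj₂
  obtain ⟨x, hx⟩ : ∃ x, S.τ c T.obj₂ = x ≫ (S.T c).map T.mor₁ :=
    Triangle.coyoneda_exact₂ _ ((S.T c).map_distinguished T hT) (S.τ c T.obj₂) (by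
      change S.τ c T.obj₂ ≫ (S.T c).map T.mor₂ = 0
      rw [← S.τ_naturality, hc, comp_zero])
  rw [he, hx, Category.assoc, ← Functor.map_comp_assoc, S.τ_naturality, hd, zero_comp,
    Functor.map_zero, zero_comp, comp_zero]

instance : S.torsion.IsTriangulated where
  exists_zero := ⟨0, isZero_zero D, 0, (isZero_zero D).eq_of_src _ _⟩
  isStableUnderShiftBy n := { le_shift := fun _ ⟨c, hc⟩ => ⟨c, S.τ_shift_eq_zero n hc⟩ }
  ext₂' T hT h₁ h₃ := ObjectProperty.le_isoClosure _ _ (S.torsion_ext₂ T hT h₁ h₃)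

/-- The cone `C` of `τ c X` is a torsion object: `C ⟶ T c C` factors through `T c (T c X)`, and
`T c (T c X) ⟶ T c C ⟶ T c (T c C)` vanishes. -/
lemma torsion_trW_τ (c : ℝ≥0) (X : D) : S.torsion.trW (S.τ c X) := by
  obtain ⟨C, p, δ, hT⟩ := distinguished_cocone_triangle (S.τ c X)
  refine ⟨C, p, δ, hT, c + c, ?_⟩
  obtain ⟨e, he⟩ := S.τ_add c c C
  have h31 : δ ≫ (S.τ c X)⟦1⟧' = 0 := comp_distTriang_mor_zero₃₁ _ hT
  have h12 : S.τ c X ≫ p = 0 := comp_distTriang_mor_zero₁₂ _ hT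
  obtain ⟨x, hx⟩ : ∃ x, S.τ c C = x ≫ (S.T c).map p :=
    Triangle.coyoneda_exact₃ _ ((S.T c).map_distinguished _ hT) (S.τ c C) (by
      change S.τ c C ≫ (S.T c).map δ ≫ ((S.T c).commShiftIso (1 : ℤ)).hom.app X = 0
      rw [← Category.assoc, ← S.τ_naturality, S.comp_τ_shift_eq_zero _ _ h31, zero_comp])
  have h0 : p ≫ S.τ c C = 0 := by
    rw [S.τ_naturality, S.τ_obj_self, ← Functor.map_comp, h12, Functor.map_zero]
  rw [he]
  nth_rewrite 1 [hx]
  rw [Category.assoc, ← Functor.map_comp_assoc, h0, Functor.map_zero, zero_comp, comp_zero]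

/-- A morphism with torsion cone divides some `τ c`. -/
lemma exists_comp_eq_τ {X Y : D} (s : X ⟶ Y) (hs : S.torsion.trW s) :
    ∃ (c : ℝ≥0) (g : Y ⟶ (S.T c).obj X), s ≫ g = S.τ c X := by
  rw [ObjectProperty.trW_iff'] at hs
  obtain ⟨Z, f, h, hT, c, hc⟩ := hs
  obtain ⟨g, hg⟩ := Triangle.yoneda_exact₂ _ hT (S.τ c X) (by
    change f ≫ S.τ c X = 0
    rw [S.τ_naturality, hc, zero_comp])
  exact ⟨c, g, hg.symm⟩

variable [IsTriangulated D]

/-- A morphism to `T c G` that vanishes in the quotient by the torsion objects is killed by a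
morphism with torsion cone, hence by some `τ d`. -/
lemma exists_comp_map_τ_eq_zero {F G : D} (c : ℝ≥0) (v : F ⟶ (S.T c).obj G)
    (hv : S.torsion.trW.Q.map v = 0) : ∃ d, v ≫ (S.T c).map (S.τ d G) = 0 := by
  obtain ⟨Y, s, hs, h⟩ := (MorphismProperty.map_eq_iff_postcomp S.torsion.trW.Q S.torsion.trW v 0).1
    (by rw [hv, Functor.map_zero])
  obtain ⟨d, g, hg⟩ := S.exists_comp_eq_τ s hs
  refine ⟨d, ?_⟩
  obtain ⟨e, he⟩ := S.τ_obj c d G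
  rw [← cancel_mono e.hom, Category.assoc, ← he, ← hg, reassoc_of% h]
  simp

/-- A morphism of the quotient by the torsion objects is a left fraction `f / s`; since `s` divides
some `τ c`, the denominator can be taken to be `τ c`. -/
lemma exists_map_eq_comp_map_τ {F G : D} (f : S.torsion.trW.Q.obj F ⟶ S.torsion.trW.Q.obj G) :
    ∃ (c : ℝ≥0) (v : F ⟶ (S.T c).obj G),
      f ≫ S.torsion.trW.Q.map (S.τ c G) = S.torsion.trW.Q.map v := by
  obtain ⟨φ, rfl⟩ := Localization.exists_leftFraction S.torsion.trW.Q S.torsion.trW f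
  obtain ⟨c, g, hg⟩ := S.exists_comp_eq_τ φ.s φ.hs
  refine ⟨c, φ.f ≫ g, ?_⟩
  rw [← hg, Functor.map_comp, Functor.map_comp]
  exact MorphismProperty.LeftFraction.map_comp_map_s_assoc _ _ _ _

end Persistence
end Persistence

/-! ### Sections of sheaves -/

open Opposite

section Sections

variable {k : Type u} [CommRing k] {X : TopCat.{u}}

/-- The sections of `G` on `U`. -/
abbrev Sec (G : Sh k X) (U : Opens X) : Type u := (G.obj.obj (op U) : ModuleCat.{u} k)

/-- The restriction of sections. -/
def res (G : Sh k X) {V U : Opens X} (h : V ≤ U) : Sec G U →ₗ[k] Sec G V :=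
  (G.obj.map (homOfLE h).op).hom

/-- The map on sections induced by a morphism of sheaves. -/
def secMap {G H : Sh k X} (f : G ⟶ H) (U : Opens X) : Sec G U →ₗ[k] Sec H U :=
  (f.hom.app (op U)).hom

lemma res_res (G : Sh k X) {W V U : Opens X} (h' : W ≤ V) (h : V ≤ U) (s : Sec G U) :
    res G h' (res G h s) = res G (h'.trans h) s := by
  have := G.obj.map_comp (homOfLE h).op (homOfLE h').op
  exact (congrArg (fun φ => φ.hom s) this).symm

lemma res_self (G : Sh k X) {U : Opens X} (s : Sec G U) : res G le_rfl s = s :=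
  congrArg (fun φ => φ.hom s) (G.obj.map_id (op U))

lemma secMap_res {G H : Sh k X} (f : G ⟶ H) {V U : Opens X} (h : V ≤ U) (s : Sec G U) :
    secMap f V (res G h s) = res H h (secMap f U s) :=
  congrArg (fun φ => φ.hom s) (f.hom.naturality (homOfLE h).op)

@[simp] lemma secMap_comp {G H K : Sh k X} (f : G ⟶ H) (g : H ⟶ K) (U : Opens X) (s : Sec G U) :
    secMap (f ≫ g) U s = secMap g U (secMap f U s) := rfl

@[simp] lemma secMap_zero {G H : Sh k X} (U : Opens X) (s : Sec G U) :
    secMap (0 : G ⟶ H) U s = 0 := rfl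

lemma sec_eq_of_locally {G : Sh k X} {U : Opens X} {s t : Sec G U}
    (h : ∀ x ∈ U, ∃ (V : Opens X) (hV : V ≤ U), x ∈ V ∧ res G hV s = res G hV t) : s = t := by
  choose V hV hx hst using h
  refine TopCat.Sheaf.eq_of_locally_eq' G (fun x : U => V x.1 x.2) U
    (fun x => homOfLE (hV x.1 x.2)) (fun x hxU => ?_) s t (fun x => hst x.1 x.2)
  exact Opens.mem_iSup.2 ⟨⟨x, hxU⟩, hx x hxU⟩

lemma exists_glue {ι : Type*} {G : Sh k X} {U : ι → Opens X} {W : Opens X}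
    (hU : ∀ i, U i ≤ W) (hW : W ≤ iSup U) (s : ∀ i, Sec G (U i))
    (h : ∀ i j, res G (inf_le_left : U i ⊓ U j ≤ U i) (s i) = res G inf_le_right (s j)) :
    ∃ t : Sec G W, ∀ i, res G (hU i) t = s i := by
  obtain ⟨t, ht, -⟩ := TopCat.Sheaf.existsUnique_gluing' G U W (fun i => homOfLE (hU i)) hW s h
  exact ⟨t, ht⟩

lemma exists_glue₂ {G : Sh k X} {U₁ U₂ : Opens X} (s₁ : Sec G U₁) (s₂ : Sec G U₂)
    (h : res G inf_le_left s₁ = res G (inf_le_right : U₁ ⊓ U₂ ≤ U₂) s₂) :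
    ∃ t : Sec G (U₁ ⊔ U₂), res G le_sup_left t = s₁ ∧ res G le_sup_right t = s₂ := by
  obtain ⟨t, ht⟩ := exists_glue (G := G) (U := fun b : Bool => cond b U₁ U₂) (W := U₁ ⊔ U₂)
    (by rintro (_ | _); exacts [le_sup_right, le_sup_left])
    (sup_le (le_iSup (fun b : Bool => cond b U₁ U₂) true)
      (le_iSup (fun b : Bool => cond b U₁ U₂) false))
    (fun b => match b with | true => s₁ | false => s₂) (by
      rintro (_ | _) (_ | _)
      · rfl
      · have := congrArg (res G (le_of_eq (inf_comm U₂ U₁))) h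
        rw [res_res, res_res] at this
        exact this.symm
      · exact h
      · rfl)
  exact ⟨t, ht true, ht false⟩

lemma epi_iff_locally_surjective {G H : Sh k X} (f : G ⟶ H) :
    Epi f ↔ ∀ (U : Opens X) (t : Sec H U), ∀ x ∈ U, ∃ (V : Opens X) (hV : V ≤ U), x ∈ V ∧
      ∃ s : Sec G V, secMap f V s = res H hV t := by
  rw [← TopCat.Sheaf.isLocallySurjective_iff_epi, TopCat.Presheaf.isLocallySurjective_iff]
  constructor
  · intro h U t x hx
    obtain ⟨V, hV, ⟨s, hs⟩, hxV⟩ := h U t x hx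
    exact ⟨V, hV, hxV, s, hs⟩
  · intro h U t x hx
    obtain ⟨V, hV, hxV, s, hs⟩ := h U t x hx
    exact ⟨V, hV, ⟨s, hs⟩, hxV⟩

end Sections

/-! ### Vanishing of cohomology for complexes of flasque sheaves -/

section Flasque

variable {k : Type u} [CommRing k] {X : TopCat.{u}}

/-- All restriction maps of the terms of the complex `J` are surjective. -/
def IsFlasqueComplex (J : CochainComplex (Sh k X) ℤ) : Prop :=
  ∀ (m : ℤ) (U V : Opens X) (h : V ≤ U), Function.Surjective (res (J.X m) h)

/-- The section `α` of `J.X m` is a boundary on the open set `O`. -/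
def IsBoundaryOn (J : CochainComplex (Sh k X) ℤ) {m : ℤ} {U : Opens X} (α : Sec (J.X m) U)
    (O : Opens X) : Prop :=
  ∃ (h : O ≤ U) (β : Sec (J.X (m - 1)) O), secMap (J.d (m - 1) m) O β = res (J.X m) h α

/-- The cocycle condition for a section. -/
def IsCocycle (J : CochainComplex (Sh k X) ℤ) {m : ℤ} {U : Opens X} (α : Sec (J.X m) U) : Prop :=
  secMap (J.d m (m + 1)) U α = 0

/-- Cocycles of degree `m` defined near `K` are boundaries near `K`. -/
def VanishesNear (J : CochainComplex (Sh k X) ℤ) (m : ℤ) (K : Set X) : Prop :=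
  ∀ (U : Opens X), K ⊆ U → ∀ α : Sec (J.X m) U, IsCocycle J α →
    ∃ O : Opens X, K ⊆ O ∧ IsBoundaryOn J α O

variable {J : CochainComplex (Sh k X) ℤ}

lemma IsCocycle.res {m : ℤ} {U V : Opens X} {α : Sec (J.X m) U} (hα : IsCocycle J α)
    (h : V ≤ U) : IsCocycle J (res (J.X m) h α) := by
  rw [IsCocycle, secMap_res, show secMap _ U α = 0 from hα, map_zero]

lemma IsBoundaryOn.mono {m : ℤ} {U O V : Opens X} {α : Sec (J.X m) U} (hα : IsBoundaryOn J α O)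
    (h : V ≤ O) : IsBoundaryOn J α V := by
  obtain ⟨hO, β, hβ⟩ := hα
  exact ⟨h.trans hO, res _ h β, by rw [secMap_res, hβ, res_res]⟩

lemma isCocycle_of_secMap_eq_zero {m m' : ℤ} (hm : m + 1 = m') {U : Opens X} {α : Sec (J.X m) U}
    (hα : secMap (J.d m m') U α = 0) : IsCocycle J α := by
  subst hm
  exact hα

lemma secMap_d_d {i j l : ℤ} {U : Opens X} (α : Sec (J.X i) U) :
    secMap (J.d j l) U (secMap (J.d i j) U α) = 0 := by
  rw [← secMap_comp, J.d_comp_d, secMap_zero]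

/-- Two primitives of the same cocycle whose difference is a boundary on `O` can be made to agree
on `O`, by extending a primitive of the difference. -/
lemma exists_primitive_eq_on (hJ : IsFlasqueComplex J) {m l : ℤ} {O₁ O₂ O : Opens X}
    (h₁ : O ≤ O₁) (h₂ : O ≤ O₂) (β₁ : Sec (J.X m) O₁) (β₂ : Sec (J.X m) O₂)
    (h : IsBoundaryOn J (res _ h₁ β₁ - res _ h₂ β₂) O) :
    ∃ β : Sec (J.X m) O₁, secMap (J.d m l) O₁ β = secMap (J.d m l) O₁ β₁ ∧
      res _ h₁ β = res _ h₂ β₂ := by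
  obtain ⟨_, γ, hγ⟩ := h
  obtain ⟨γ', hγ'⟩ := hJ (m - 1) O₁ O h₁ γ
  refine ⟨β₁ - secMap (J.d (m - 1) m) O₁ γ', ?_, ?_⟩
  · rw [map_sub, secMap_d_d, sub_zero]
  · rw [map_sub, ← secMap_res, hγ', hγ, res_self, sub_sub_cancel]

lemma isCocycle_sub {m : ℤ} {U O₁ O₂ O : Opens X} {α : Sec (J.X m) U} (hU₁ : O₁ ≤ U) (hU₂ : O₂ ≤ U)
    (h₁ : O ≤ O₁) (h₂ : O ≤ O₂) (β₁ : Sec (J.X (m - 1)) O₁) (β₂ : Sec (J.X (m - 1)) O₂)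
    (hβ₁ : secMap (J.d (m - 1) m) O₁ β₁ = res _ hU₁ α)
    (hβ₂ : secMap (J.d (m - 1) m) O₂ β₂ = res _ hU₂ α) :
    IsCocycle J (res _ h₁ β₁ - res _ h₂ β₂) := by
  refine isCocycle_of_secMap_eq_zero (m' := m) (by lia) ?_
  rw [map_sub, secMap_res, secMap_res, hβ₁, hβ₂, res_res, res_res, sub_self]

lemma isBoundaryOn_sup {m : ℤ} {U O₁ O₂ : Opens X} {α : Sec (J.X m) U} (hU₁ : O₁ ≤ U)
    (hU₂ : O₂ ≤ U) (β₁ : Sec (J.X (m - 1)) O₁) (β₂ : Sec (J.X (m - 1)) O₂)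
    (hβ₁ : secMap (J.d (m - 1) m) O₁ β₁ = res _ hU₁ α)
    (hβ₂ : secMap (J.d (m - 1) m) O₂ β₂ = res _ hU₂ α)
    (h : res _ inf_le_left β₁ = res _ (inf_le_right : O₁ ⊓ O₂ ≤ O₂) β₂) :
    IsBoundaryOn J α (O₁ ⊔ O₂) := by
  obtain ⟨β, h₁, h₂⟩ := exists_glue₂ β₁ β₂ h
  refine ⟨sup_le hU₁ hU₂, β, sec_eq_of_locally ?_⟩
  rintro x (hx | hx)
  · exact ⟨O₁, le_sup_left, hx, by rw [← secMap_res, h₁, hβ₁, res_res]⟩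
  · exact ⟨O₂, le_sup_right, hx, by rw [← secMap_res, h₂, hβ₂, res_res]⟩

/-- Neighbourhoods of two compact sets can be shrunk so that their intersection lies in a given
neighbourhood of the intersection of the compact sets. -/
lemma exists_opens_inf_le [T2Space X] {K₁ K₂ : Set X} (hK₁ : IsCompact K₁) (hK₂ : IsCompact K₂)
    {O₁ O₂ O : Opens X} (h₁ : K₁ ⊆ O₁) (h₂ : K₂ ⊆ O₂) (h : K₁ ∩ K₂ ⊆ O) :
    ∃ O₁' O₂' : Opens X, O₁' ≤ O₁ ∧ O₂' ≤ O₂ ∧ K₁ ⊆ O₁' ∧ K₂ ⊆ O₂' ∧ O₁' ⊓ O₂' ≤ O := by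
  obtain ⟨A₁, A₂, hA₁, hA₂, hKA₁, hKA₂, hA⟩ := SeparatedNhds.of_isCompact_isCompact
    (hK₁.diff O.isOpen) (hK₂.diff O.isOpen) (by
      rw [Set.disjoint_left]
      exact fun x hx hx' => hx.2 (h ⟨hx.1, hx'.1⟩))
  refine ⟨O₁ ⊓ (⟨A₁, hA₁⟩ ⊔ O), O₂ ⊓ (⟨A₂, hA₂⟩ ⊔ O), inf_le_left, inf_le_left,
    fun x hx => ⟨h₁ hx, ?_⟩, fun x hx => ⟨h₂ hx, ?_⟩, ?_⟩
  · by_cases hxO : x ∈ O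
    exacts [Or.inr hxO, Or.inl (hKA₁ ⟨hx, hxO⟩)]
  · by_cases hxO : x ∈ O
    exacts [Or.inr hxO, Or.inl (hKA₂ ⟨hx, hxO⟩)]
  · rintro x ⟨⟨-, hx₁ | hx₁⟩, -, hx₂ | hx₂⟩
    exacts [(Set.disjoint_left.1 hA hx₁ hx₂).elim, hx₂, hx₁, hx₁]

/-- The Mayer–Vietoris argument. -/
lemma exists_isBoundaryOn_union [T2Space X] (hJ : IsFlasqueComplex J) {K₁ K₂ : Set X}
    (hK₁ : IsCompact K₁) (hK₂ : IsCompact K₂) {m : ℤ} {U : Opens X} {α : Sec (J.X m) U}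
    (h₁ : ∃ O : Opens X, K₁ ⊆ O ∧ IsBoundaryOn J α O)
    (h₂ : ∃ O : Opens X, K₂ ⊆ O ∧ IsBoundaryOn J α O)
    (h : VanishesNear J (m - 1) (K₁ ∩ K₂)) :
    ∃ O : Opens X, K₁ ∪ K₂ ⊆ O ∧ IsBoundaryOn J α O := by
  obtain ⟨O₁, hKO₁, hU₁, β₁, hβ₁⟩ := h₁
  obtain ⟨O₂, hKO₂, hU₂, β₂, hβ₂⟩ := h₂
  -- The difference of the two primitives is a cocycle near `K₁ ∩ K₂`, hence a boundary there; the
  -- sheaves being flasque, `β₁` can be corrected so that it agrees with `β₂` near `K₁ ∩ K₂`.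
  obtain ⟨O, hKO, hO, γ, hγ⟩ := h (O₁ ⊓ O₂) (fun x hx => ⟨hKO₁ hx.1, hKO₂ hx.2⟩)
    _ (isCocycle_sub hU₁ hU₂ inf_le_left inf_le_right β₁ β₂ hβ₁ hβ₂)
  have hO₁ := hO.trans inf_le_left
  have hO₂ := hO.trans inf_le_right
  obtain ⟨β, hβ, hβ'⟩ := exists_primitive_eq_on (l := m) hJ hO₁ hO₂ β₁ β₂
    ⟨le_rfl, γ, by rw [hγ, map_sub, map_sub, res_res, res_res, res_res, res_res]⟩
  obtain ⟨O₁', O₂', hO₁', hO₂', hKO₁', hKO₂', hO'⟩ := exists_opens_inf_le hK₁ hK₂ hKO₁ hKO₂ hKO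
  refine ⟨O₁' ⊔ O₂', Set.union_subset_union hKO₁' hKO₂',
    isBoundaryOn_sup (hO₁'.trans hU₁) (hO₂'.trans hU₂) (res _ hO₁' β) (res _ hO₂' β₂)
      (by rw [secMap_res, hβ, hβ₁, res_res]) (by rw [secMap_res, hβ₂, res_res]) ?_⟩
  have := congrArg (res _ hO') hβ'
  rwa [res_res, res_res] at this ⊢

/-- If the cohomology near the fibers of a real function on a compact set vanishes in the degrees
`m` and `m - 1`, then it vanishes near the compact set in degree `m`. -/
lemma vanishesNear_of_slices [T2Space X] (hJ : IsFlasqueComplex J) {K : Set X} (hK : IsCompact K)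
    {π : X → ℝ} (hπ : ContinuousOn π K) {m : ℤ}
    (h : ∀ s, VanishesNear J m (K ∩ π ⁻¹' {s})) (h' : ∀ s, VanishesNear J (m - 1) (K ∩ π ⁻¹' {s})) :
    VanishesNear J m K := by
  intro U hKU α hα
  have hc (C : Set ℝ) (hC : IsClosed C) : IsCompact (K ∩ π ⁻¹' C) :=
    hK.of_isClosed_subset (hπ.preimage_isClosed_of_isClosed hK.isClosed hC) Set.inter_subset_left
  choose O hKO hO using fun s => h s U (Set.inter_subset_left.trans hKU) α hα
  -- By compactness, a neighbourhood of the fibre over `s` contains the fibres over the points near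
  -- `s`.
  have hA (s : ℝ) : IsOpen {r | K ∩ π ⁻¹' {r} ⊆ O s} := by
    have : {r | K ∩ π ⁻¹' {r} ⊆ O s} = (π '' (K \ O s))ᶜ := by
      ext r
      simp only [Set.mem_ofPred_eq, Set.mem_compl_iff, Set.mem_image, not_exists, not_and]
      refine ⟨fun hr x hx hxr => hx.2 (hr ⟨hx.1, hxr⟩), fun hr x hx => ?_⟩
      by_contra hxO
      exact hr x ⟨hx.1, hxO⟩ hx.2
    rw [this, isOpen_compl_iff]
    exact ((hK.diff (O s).isOpen).image_of_continuousOn (hπ.mono Set.sdiff_subset)).isClosed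
  obtain ⟨a, b, hab, hab'⟩ : ∃ a b, a ≤ b ∧ ∀ x ∈ K, π x ∈ Set.Icc a b := by
    obtain ⟨r, hr⟩ := (hK.image_of_continuousOn hπ).isBounded.subset_closedBall 0
    refine ⟨-|r|, |r|, by linarith [abs_nonneg r], fun x hx => ?_⟩
    have := hr (Set.mem_image_of_mem π hx)
    rw [mem_closedBall_zero_iff, Real.norm_eq_abs] at this
    exact abs_le.1 (this.trans (le_abs_self r))
  -- The slabs over the intervals of a fine subdivision are glued one after the other; two
  -- successive ones meet in a fibre, where the cohomology vanishes in degree `m - 1`.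
  obtain ⟨t, ht0, htm, ⟨N, hN⟩, ht⟩ := exists_monotone_Icc_subset_open_cover_Icc hab
    (c := fun s => Subtype.val ⁻¹' {r | K ∩ π ⁻¹' {r} ⊆ O s})
    (fun s => (hA s).preimage continuous_subtype_val)
    (fun r _ => Set.mem_iUnion.2 ⟨r.1, hKO r.1⟩)
  have key (n : ℕ) : ∃ O' : Opens X, K ∩ π ⁻¹' (Set.Icc a (t n)) ⊆ O' ∧ IsBoundaryOn J α O' := by
    induction n with
    | zero =>
      refine ⟨O a, ?_, hO a⟩
      rw [ht0, Set.Icc_self]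
      exact hKO a
    | succ n ih =>
      obtain ⟨s, hs⟩ := ht n
      have htn : (t n : ℝ) ≤ t (n + 1) := htm n.le_succ
      obtain ⟨O', hO', hO''⟩ := exists_isBoundaryOn_union hJ (hc (Set.Icc a (t n)) isClosed_Icc)
        (hc (Set.Icc (t n) (t (n + 1))) isClosed_Icc) ih ⟨O s, fun x hx =>
          hs (a := ⟨π x, hab' x hx.1⟩) ⟨hx.2.1, hx.2.2⟩ ⟨hx.1, rfl⟩, hO s⟩ (by
          convert h' (t n) using 1
          rw [← Set.inter_inter_distrib_left, ← Set.preimage_inter,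
            Set.Icc_inter_Icc_eq_singleton (t n).2.1 htn])
      refine ⟨O', ?_, hO''⟩
      rwa [← Set.inter_union_distrib_left, ← Set.preimage_union,
        Set.Icc_union_Icc_eq_Icc (t n).2.1 htn] at hO'
  obtain ⟨O', hO', hO''⟩ := key N
  refine ⟨O', fun x hx => hO' ⟨hx, ?_⟩, hO''⟩
  rw [hN N le_rfl]
  exact hab' x hx

/-- The complex `J` is exact in degree `m`, in terms of sections. -/
def IsLocallyExactAt (J : CochainComplex (Sh k X) ℤ) (m : ℤ) : Prop :=
  ∀ x : X, VanishesNear J m {x}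

/-- A compact set on which `d` real functions separate the points has cohomological dimension at
most `d`. -/
lemma vanishesNear_of_separating [T2Space X] (hJ : IsFlasqueComplex J) {b : ℤ}
    (hb : ∀ m, b < m → IsLocallyExactAt J m) {O : Set X} (π : ℕ → X → ℝ)
    (hπ : ∀ i, ContinuousOn (π i) O) (d : ℕ) (K : Set X) (hK : IsCompact K) (hKO : K ⊆ O)
    (hd : ∀ x ∈ K, ∀ y ∈ K, (∀ i < d, π i x = π i y) → x = y) (m : ℤ) (hm : b + d < m) :
    VanishesNear J m K := by
  induction d generalizing K m with
  | zero =>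
    rcases K.eq_empty_or_nonempty with rfl | ⟨x, hx⟩
    · exact fun U _ α _ => ⟨⊥, Set.empty_subset _, bot_le, 0,
        sec_eq_of_locally fun x hx => hx.elim⟩
    -- Without functions, separation means that there is at most one point.
    · obtain rfl : K = {x} := Set.eq_singleton_iff_unique_mem.2
        ⟨hx, fun y hy => hd y hy x hx (by simp)⟩
      exact hb m (by simpa using hm) x
  | succ d ih =>
    have hs (s : ℝ) (m : ℤ) (hm : b + d < m) : VanishesNear J m (K ∩ π d ⁻¹' {s}) := by
      refine ih _ (hK.of_isClosed_subset (((hπ d).mono hKO).preimage_isClosed_of_isClosed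
        hK.isClosed isClosed_singleton) Set.inter_subset_left)
        (Set.inter_subset_left.trans hKO) (fun x hx y hy h => hd x hx.1 y hy.1 fun i hi => ?_) m hm
      rcases Nat.lt_succ_iff_lt_or_eq.1 hi with hi | rfl
      exacts [h i hi, hx.2.trans hy.2.symm]
    push_cast at hm
    exact vanishesNear_of_slices hJ hK ((hπ d).mono hKO) (fun s => hs s m (by lia))
      (fun s => hs s (m - 1) (by lia))

/-- Cocycles on an increasing union of open sets, separated by compact sets near which the
cohomology vanishes in degrees `m` and `m - 1`, are boundaries: primitives are corrected one after
the other so that each one extends the previous one. -/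
lemma isBoundaryOn_of_exhaustion (hJ : IsFlasqueComplex J) {O : Opens X} {m : ℤ}
    {V : ℕ → Opens X} {K : ℕ → Set X} (hVO : ∀ i, V i ≤ O) (hOV : O ≤ iSup V)
    (hVK : ∀ i, (V i : Set X) ⊆ K i) (hKV : ∀ i, K i ⊆ V (i + 1))
    (h : ∀ i, VanishesNear J m (K i)) (h' : ∀ i, VanishesNear J (m - 1) (K i))
    (α : Sec (J.X m) O) (hα : IsCocycle J α) : IsBoundaryOn J α O := by
  have hV (i : ℕ) : V i ≤ V (i + 1) := (hVK i).trans (hKV i)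
  have hVm : Monotone V := monotone_nat_of_le_succ hV
  -- The primitives are taken on `V (i + 1)`, but only their restrictions to `V i` are kept by the
  -- next step.
  let P (i : ℕ) := {β : Sec (J.X (m - 1)) (V (i + 1)) //
    secMap (J.d (m - 1) m) _ β = res _ (hVO _) α}
  have h₀ (i : ℕ) : Nonempty (P i) := by
    obtain ⟨O', hO', h''⟩ := h (i + 1) O ((hKV _).trans (hVO _)) α hα
    obtain ⟨_, β, hβ⟩ := h''.mono ((hVK (i + 1)).trans hO')
    exact ⟨β, hβ⟩
  have step (i : ℕ) (β : P i) : ∃ β' : P (i + 1),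
      res _ ((hV i).trans (hV (i + 1))) β'.1 = res _ (hV i) β.1 := by
    -- A primitive on `V (i + 2)` differs from `β` by a boundary near `K i`, which is extended.
    obtain ⟨β₀⟩ := h₀ (i + 1)
    obtain ⟨O', hO', _, γ, hγ⟩ := h' i (V (i + 1)) (hKV i) _
      (isCocycle_sub (hVO _) (hVO _) (hV (i + 1)) le_rfl β₀.1 β.1 β₀.2 β.2)
    have hi : V i ≤ O' := (hVK i).trans hO'
    obtain ⟨β', h₁, h₂⟩ := exists_primitive_eq_on (l := m) hJ ((hV i).trans (hV (i + 1))) (hV i)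
      β₀.1 β.1 ⟨le_rfl, res _ hi γ, by
        rw [secMap_res, hγ, map_sub, map_sub, map_sub, res_res, res_res, res_res, res_res, res_res,
          res_res]⟩
    exact ⟨⟨β', h₁.trans β₀.2⟩, h₂⟩
  choose f hf using step
  let β (i : ℕ) : P i := Nat.rec (h₀ 0).some f i
  have hβ (i j : ℕ) (hij : i ≤ j) :
      res _ (hVm hij) (res _ (hV j) (β j).1) = res _ (hV i) (β i).1 := by
    induction j, hij using Nat.le_induction with
    | base => rw [res_self]
    | succ j hij ih =>
      rw [← ih, res_res, res_res]
      have := congrArg (res _ (hVm hij)) (hf j (β j))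
      rwa [res_res, res_res] at this
  obtain ⟨θ, hθ⟩ := exists_glue hVO hOV (fun i => res _ (hV i) (β i).1) (by
    intro i j
    rcases le_total i j with hij | hij
    · rw [← hβ i j hij, res_res, res_res]
    · rw [← hβ j i hij, res_res, res_res, res_res])
  refine ⟨le_rfl, θ, sec_eq_of_locally fun x hx => ?_⟩
  obtain ⟨i, hi⟩ := Opens.mem_iSup.1 (hOV hx)
  exact ⟨V i, hVO i, hi, by rw [← secMap_res, hθ, secMap_res, (β i).2, res_res, res_res]⟩

/-- A σ-compact open set on which `d` real functions separate the points has cohomological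
dimension at most `d + 1`. -/
theorem isBoundaryOn_of_separating [T2Space X] (hJ : IsFlasqueComplex J) {b : ℤ}
    (hb : ∀ m, b < m → IsLocallyExactAt J m) {O : Opens X} [SigmaCompactSpace O]
    [WeaklyLocallyCompactSpace O] (π : ℕ → X → ℝ) (hπ : ∀ i, ContinuousOn (π i) O) (d : ℕ)
    (hd : ∀ x ∈ O, ∀ y ∈ O, (∀ i < d, π i x = π i y) → x = y) {m : ℤ} (hm : b + d + 1 < m)
    (α : Sec (J.X m) O) (hα : IsCocycle J α) : IsBoundaryOn J α O := by
  let C := CompactExhaustion.choice O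
  let K (i : ℕ) : Set X := Subtype.val '' C i
  have hK (i : ℕ) : IsCompact (K i) := (C.isCompact i).image continuous_subtype_val
  have hKO (i : ℕ) : K i ⊆ O := by
    rintro _ ⟨x, -, rfl⟩
    exact x.2
  let V (i : ℕ) : Opens X :=
    ⟨Subtype.val '' interior (C i), O.isOpen.isOpenMap_subtype_val _ isOpen_interior⟩
  have hVK (i : ℕ) : (V i : Set X) ⊆ K i := Set.image_mono interior_subset
  have hK' (i : ℕ) (m : ℤ) (hm : b + d < m) : VanishesNear J m (K i) :=
    vanishesNear_of_separating hJ hb π hπ d (K i) (hK i) (hKO i)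
      (fun x hx y hy => hd x (hKO i hx) y (hKO i hy)) m hm
  have hKV (i : ℕ) : K i ⊆ V (i + 1) := Set.image_mono (C.subset_interior_succ i)
  refine isBoundaryOn_of_exhaustion hJ (fun i => (hVK i).trans (hKO i)) (fun x hx => ?_) hVK hKV
    (fun i => hK' i m (by lia)) (fun i => hK' i (m - 1) (by lia)) α hα
  obtain ⟨n, hn⟩ := C.exists_mem ⟨x, hx⟩
  exact Opens.mem_iSup.2 ⟨n + 1, hKV n ⟨_, hn, rfl⟩⟩

end Flasque

/-! ### Sections as morphisms from the sheaves `k_U` -/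

open Opposite
open scoped ZeroObject

section ConstOpen

variable {k : Type u} [CommRing k] {X : TopCat.{u}}

variable (k X) in
/-- The presheaf `V ↦ k[V ⟶ U]`, of which `k_U` is the associated sheaf. -/
abbrev constOpenPre : Opens X ⥤ ((Opens X)ᵒᵖ ⥤ ModuleCat.{u} k) :=
  yoneda ⋙ (Functor.whiskeringRight _ _ _).obj (ModuleCat.free k)

variable (k) in
/-- The section `1` of `k_U` on `V`, for `V ≤ U`. -/
def constOne {V U : Opens X} (h : V ≤ U) : Sec ((constOpen k).obj U) V :=
  ((toSheafify (Opens.grothendieckTopology X) ((constOpenPre k X).obj U)).app (op V)).hom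
    (ModuleCat.freeMk (X := V ⟶ U) (homOfLE h))

lemma res_constOne {W V U : Opens X} (h' : W ≤ V) (h : V ≤ U) :
    res _ h' (constOne k h) = constOne k (h'.trans h) := by
  have := congrArg (fun φ => φ.hom (ModuleCat.freeMk (X := V ⟶ U) (homOfLE h)))
    ((toSheafify (Opens.grothendieckTopology X) ((constOpenPre k X).obj U)).naturality
      (homOfLE h').op)
  refine this.symm.trans ?_
  refine congrArg (((toSheafify (Opens.grothendieckTopology X)
    ((constOpenPre k X).obj U)).app (op W)).hom) ?_
  exact ModuleCat.free_map_apply _ _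

lemma constOpen_map_constOne {W V U : Opens X} (h' : W ≤ V) (h : V ≤ U) :
    secMap ((constOpen k).map (homOfLE h)) W (constOne k h') = constOne k (h'.trans h) := by
  have := congrArg (fun φ => (φ.app (op W)).hom (ModuleCat.freeMk (X := W ⟶ V) (homOfLE h')))
    (toSheafify_naturality (Opens.grothendieckTopology X) ((constOpenPre k X).map (homOfLE h)))
  refine this.symm.trans ?_
  refine congrArg (((toSheafify (Opens.grothendieckTopology X)
    ((constOpenPre k X).obj U)).app (op W)).hom) ?_
  exact ModuleCat.free_map_apply _ _

/-- The section of `G` on `U` that corresponds to a morphism `k_U ⟶ G`. -/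
def toSec {U : Opens X} {G : Sh k X} (f : (constOpen k).obj U ⟶ G) : Sec G U :=
  secMap f U (constOne k le_rfl)

lemma toSec_comp {U : Opens X} {G H : Sh k X} (f : (constOpen k).obj U ⟶ G) (g : G ⟶ H) :
    toSec (f ≫ g) = secMap g U (toSec f) := rfl

lemma toSec_add {U : Opens X} {G : Sh k X} (f g : (constOpen k).obj U ⟶ G) :
    toSec (f + g) = toSec f + toSec g := rfl

lemma toSec_zero {U : Opens X} {G : Sh k X} : toSec (0 : (constOpen k).obj U ⟶ G) = 0 := rfl

lemma toSec_map {V U : Opens X} (h : V ≤ U) {G : Sh k X} (f : (constOpen k).obj U ⟶ G) :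
    toSec ((constOpen k).map (homOfLE h) ≫ f) = res G h (toSec f) := by
  rw [toSec, secMap_comp, constOpen_map_constOne, ← res_constOne h le_rfl, secMap_res]
  rfl

lemma toSec_injective (U : Opens X) (G : Sh k X) :
    Function.Injective (toSec : ((constOpen k).obj U ⟶ G) → Sec G U) := by
  intro f g hfg
  refine CategoryTheory.Sheaf.hom_ext ?_
  refine sheafify_hom_ext _ (P := (constOpenPre k X).obj U) f.hom g.hom G.property ?_
  ext V : 2
  refine ModuleCat.free_hom_ext fun i => ?_
  have := congrArg (res G (leOfHom i)) hfg
  rw [toSec, toSec, ← secMap_res, ← secMap_res, res_constOne] at this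
  exact this

lemma toSec_surjective (U : Opens X) (G : Sh k X) :
    Function.Surjective (toSec : ((constOpen k).obj U ⟶ G) → Sec G U) := by
  intro s
  let φ : (constOpenPre k X).obj U ⟶ G.obj :=
    { app := fun V => ModuleCat.freeDesc (↾fun i : V.unop ⟶ U => res G (leOfHom i) s)
      naturality := fun V W i => ModuleCat.free_hom_ext fun j => by
        change (ModuleCat.freeDesc (↾fun i : W.unop ⟶ U => res G (leOfHom i) s)).hom
          ((ModuleCat.free k).map ((yoneda.obj U).map i) (ModuleCat.freeMk j)) =
          res G (leOfHom i.unop) ((ModuleCat.freeDesc (↾fun i : V.unop ⟶ U =>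
            res G (leOfHom i) s)).hom (ModuleCat.freeMk j))
        rw [ModuleCat.free_map_apply]
        erw [ModuleCat.freeDesc_apply, ModuleCat.freeDesc_apply]
        exact (res_res _ _ _ _).symm }
  refine ⟨⟨sheafifyLift (Opens.grothendieckTopology X) φ G.property⟩, ?_⟩
  have := congrArg (fun φ => (φ.app (op U)).hom (ModuleCat.freeMk (X := U ⟶ U) (homOfLE le_rfl)))
    (toSheafify_sheafifyLift (Opens.grothendieckTopology X) φ G.property)
  refine this.trans ?_
  exact (ModuleCat.freeDesc_apply _ _).trans (res_self G s)

/-- The morphism `k_U ⟶ G` that corresponds to a section of `G` on `U`. -/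
def ofSec {U : Opens X} {G : Sh k X} (s : Sec G U) : (constOpen k).obj U ⟶ G :=
  (toSec_surjective U G s).choose

@[simp] lemma toSec_ofSec {U : Opens X} {G : Sh k X} (s : Sec G U) : toSec (ofSec s) = s :=
  (toSec_surjective U G s).choose_spec

lemma secMap_injective_of_mono {G H : Sh k X} (f : G ⟶ H) [Mono f] (U : Opens X) :
    Function.Injective (secMap f U) := by
  intro s t h
  rw [← toSec_ofSec s, ← toSec_ofSec t]
  congr 1
  rw [← cancel_mono f]
  refine toSec_injective _ _ ?_
  rw [toSec_comp, toSec_comp, toSec_ofSec, toSec_ofSec, h]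

/-- A sheaf is covered by the sheaves `k_V` for its sections with a given local property. -/
lemma exists_epi_of_local (A : Sh k X) (P : ∀ V : Opens X, Sec A V → Prop)
    (hP : ∀ (U : Opens X) (s : Sec A U), ∀ x ∈ U, ∃ (V : Opens X) (hV : V ≤ U), x ∈ V ∧
      P V (res A hV s)) :
    ∃ (ι : Type u) (V : ι → Opens X) (s : ∀ i, Sec A (V i)), (∀ i, P (V i) (s i)) ∧
      Epi (Sigma.desc fun i => ofSec (s i)) := by
  refine ⟨{x : Σ V : Opens X, Sec A V // P x.1 x.2}, fun i => i.1.1, fun i => i.1.2,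
    fun i => i.2, ?_⟩
  rw [epi_iff_locally_surjective]
  intro U s x hx
  obtain ⟨V, hV, hxV, h⟩ := hP U s x hx
  refine ⟨V, hV, hxV, toSec (Sigma.ι (fun i : {x : Σ V : Opens X, Sec A V // P x.1 x.2} =>
    (constOpen k).obj i.1.1) ⟨⟨V, res A hV s⟩, h⟩), ?_⟩
  rw [← toSec_comp, Sigma.ι_desc, toSec_ofSec]

/-- A morphism of complexes of sheaves is surjective on cohomology if it is so locally. -/
lemma epi_homologyMap_of_local {K L : CochainComplex (Sh k X) ℤ} (φ : K ⟶ L) (m : ℤ)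
    (h : ∀ (U : Opens X) (s : Sec (L.X m) U), IsCocycle L s → ∀ x ∈ U,
      ∃ (V : Opens X) (hV : V ≤ U), x ∈ V ∧ ∃ (t : Sec (K.X m) V) (r : Sec (L.X (m - 1)) V),
        IsCocycle K t ∧ res _ hV s = secMap (φ.f m) V t + secMap (L.d (m - 1) m) V r) :
    Epi (HomologicalComplex.homologyMap φ m) := by
  rw [HomologicalComplex.epi_homologyMap_iff_up_to_refinements φ (m - 1) m (m + 1)
    (by simp) (by simp)]
  intro A y hy
  obtain ⟨ι, V, s, hs, hepi⟩ := exists_epi_of_local A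
    (fun V s => ∃ (t : Sec (K.X m) V) (r : Sec (L.X (m - 1)) V),
        IsCocycle K t ∧ secMap y V s = secMap (φ.f m) V t + secMap (L.d (m - 1) m) V r) (by
    intro U s x hx
    obtain ⟨V, hV, hxV, t, r, ht, htr⟩ := h U (secMap y U s)
      (by rw [IsCocycle, ← secMap_comp, hy, secMap_zero]) x hx
    exact ⟨V, hV, hxV, t, r, ht, by rw [secMap_res, htr]⟩)
  choose t r ht htr using hs
  refine ⟨_, _, hepi, Sigma.desc fun i => ofSec (t i), ?_, Sigma.desc fun i => ofSec (r i), ?_⟩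
  · refine Sigma.hom_ext _ _ fun i => toSec_injective _ _ ?_
    rw [Sigma.ι_desc_assoc, toSec_comp, toSec_ofSec, comp_zero, toSec_zero]
    exact ht i
  · refine Sigma.hom_ext _ _ fun i => toSec_injective _ _ ?_
    rw [Preadditive.comp_add, toSec_add, Sigma.ι_desc_assoc, Sigma.ι_desc_assoc,
      Sigma.ι_desc_assoc, toSec_comp, toSec_comp, toSec_comp, toSec_ofSec, toSec_ofSec,
      toSec_ofSec, htr]

/-- A morphism of complexes of sheaves is injective on cohomology if it is so locally. -/
lemma mono_homologyMap_of_local {K L : CochainComplex (Sh k X) ℤ} (φ : K ⟶ L) (m : ℤ)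
    (h : ∀ (U : Opens X) (s : Sec (K.X m) U) (r : Sec (L.X (m - 1)) U), IsCocycle K s →
      secMap (φ.f m) U s = secMap (L.d (m - 1) m) U r → ∀ x ∈ U,
      ∃ (V : Opens X) (hV : V ≤ U), x ∈ V ∧ ∃ t : Sec (K.X (m - 1)) V,
        res _ hV s = secMap (K.d (m - 1) m) V t) :
    Mono (HomologicalComplex.homologyMap φ m) := by
  rw [HomologicalComplex.mono_homologyMap_iff_up_to_refinements φ (m - 1) m (m + 1)
    (by simp) (by simp)]
  intro A y hy z hz
  obtain ⟨ι, V, s, hs, hepi⟩ := exists_epi_of_local A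
    (fun V s => ∃ t : Sec (K.X (m - 1)) V, secMap y V s = secMap (K.d (m - 1) m) V t) (by
    intro U s x hx
    obtain ⟨V, hV, hxV, t, ht⟩ := h U (secMap y U s) (secMap z U s)
      (by rw [IsCocycle, ← secMap_comp, hy, secMap_zero])
      (by rw [← secMap_comp, ← secMap_comp, hz]) x hx
    exact ⟨V, hV, hxV, t, by rw [secMap_res, ht]⟩)
  choose t ht using hs
  refine ⟨_, _, hepi, Sigma.desc fun i => ofSec (t i), ?_⟩
  refine Sigma.hom_ext _ _ fun i => toSec_injective _ _ ?_
  rw [Sigma.ι_desc_assoc, Sigma.ι_desc_assoc, toSec_comp, toSec_comp, toSec_ofSec, toSec_ofSec,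
    ht]

/-- Exactness from the local exactness in terms of sections; the converse of
`isLocallyExactAt_of_exactAt`. -/
lemma exactAt_of_isLocallyExactAt {K : CochainComplex (Sh k X) ℤ} {m : ℤ}
    (h : ∀ (U : Opens X) (s : Sec (K.X m) U), IsCocycle K s → ∀ x ∈ U,
      ∃ (V : Opens X), x ∈ V ∧ IsBoundaryOn K s V) : K.ExactAt m := by
  rw [HomologicalComplex.exactAt_iff_isZero_homology]
  have : Mono (HomologicalComplex.homologyMap (0 : K ⟶ (0 : CochainComplex (Sh k X) ℤ)) m) :=
    mono_homologyMap_of_local _ _ fun U s _ hs _ x hx => by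
      obtain ⟨V, hxV, hV, t, ht⟩ := h U s hs x hx
      exact ⟨V, hV, hxV, t, ht.symm⟩
  exact IsZero.of_mono
    (HomologicalComplex.homologyMap (0 : K ⟶ (0 : CochainComplex (Sh k X) ℤ)) m)
    ((HomologicalComplex.homologyFunctor _ _ m).map_isZero (isZero_zero _))

/-- Near each point, an epimorphism onto a sheaf `k_U` lifts the section `1`. -/
lemma exists_lift_of_epi {U : Opens X} {A : Sh k X} (π : A ⟶ (constOpen k).obj U) [Epi π] (x : X)
    (hx : x ∈ U) : ∃ (V : Opens X) (hV : V ≤ U) (f : (constOpen k).obj V ⟶ A), x ∈ V ∧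
      f ≫ π = (constOpen k).map (homOfLE hV) := by
  obtain ⟨V, hV, hxV, s, hs⟩ := (epi_iff_locally_surjective π).1 inferInstance U
    (constOne k le_rfl) x hx
  refine ⟨V, hV, ofSec s, hxV, toSec_injective _ _ ?_⟩
  rw [toSec_comp, toSec_ofSec, hs, toSec, constOpen_map_constOne, res_constOne]

/-- Local form of surjectivity on cohomology. -/
lemma exists_local_of_epi_homologyMap {K L : CochainComplex (Sh k X) ℤ} (φ : K ⟶ L) {m : ℤ}
    (h : Epi (HomologicalComplex.homologyMap φ m)) {U : Opens X} (s : Sec (L.X m) U)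
    (hs : IsCocycle L s) (x : X) (hx : x ∈ U) :
    ∃ (V : Opens X) (hV : V ≤ U), x ∈ V ∧ ∃ (t : Sec (K.X m) V) (r : Sec (L.X (m - 1)) V),
      IsCocycle K t ∧ res _ hV s = secMap (φ.f m) V t + secMap (L.d (m - 1) m) V r := by
  rw [HomologicalComplex.epi_homologyMap_iff_up_to_refinements φ (m - 1) m (m + 1)
    (by simp) (by simp)] at h
  obtain ⟨A, π, _, t, ht, r, hr⟩ := h (ofSec s)
    (toSec_injective _ _ (by rwa [toSec_comp, toSec_ofSec, toSec_zero]))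
  obtain ⟨V, hV, f, hxV, hf⟩ := exists_lift_of_epi π x hx
  refine ⟨V, hV, hxV, toSec (f ≫ t), toSec (f ≫ r), ?_, ?_⟩
  · rw [IsCocycle, ← toSec_comp, Category.assoc, ht, comp_zero, toSec_zero]
  · rw [← toSec_comp, ← toSec_comp, ← toSec_add, Category.assoc, Category.assoc,
      ← Preadditive.comp_add, ← hr, ← Category.assoc, hf, toSec_map, toSec_ofSec]

/-- Local form of injectivity on cohomology. -/
lemma exists_local_of_mono_homologyMap {K L : CochainComplex (Sh k X) ℤ} (φ : K ⟶ L) {m : ℤ}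
    (h : Mono (HomologicalComplex.homologyMap φ m)) {U : Opens X} (s : Sec (K.X m) U)
    (hs : IsCocycle K s) (r : Sec (L.X (m - 1)) U)
    (hsr : secMap (φ.f m) U s = secMap (L.d (m - 1) m) U r) (x : X) (hx : x ∈ U) :
    ∃ (V : Opens X), x ∈ V ∧ IsBoundaryOn K s V := by
  rw [HomologicalComplex.mono_homologyMap_iff_up_to_refinements φ (m - 1) m (m + 1)
    (by simp) (by simp)] at h
  obtain ⟨A, π, _, t, ht⟩ := h (ofSec s)
    (toSec_injective _ _ (by rwa [toSec_comp, toSec_ofSec, toSec_zero])) (ofSec r)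
    (toSec_injective _ _ (by rw [toSec_comp, toSec_comp, toSec_ofSec, toSec_ofSec, hsr]))
  obtain ⟨V, hV, f, hxV, hf⟩ := exists_lift_of_epi π x hx
  refine ⟨V, hxV, hV, toSec (f ≫ t), ?_⟩
  rw [← toSec_comp, Category.assoc, ← ht, ← Category.assoc, hf, toSec_map, toSec_ofSec]

lemma isLocallyExactAt_of_exactAt {K : CochainComplex (Sh k X) ℤ} {m : ℤ} (h : K.ExactAt m) :
    IsLocallyExactAt K m := by
  intro x U hx α hα
  rw [HomologicalComplex.exactAt_iff_isZero_homology] at h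
  obtain ⟨V, hxV, hV⟩ := exists_local_of_mono_homologyMap (0 : K ⟶ 0)
    ⟨fun _ _ _ => h.eq_of_tgt _ _⟩ α hα 0 (by simp) x (hx rfl)
  exact ⟨V, Set.singleton_subset_iff.2 hxV, hV⟩

instance mono_constOpen_map {V U : Opens X} (h : V ≤ U) :
    Mono ((constOpen k).map (homOfLE h)) := by
  have (W : (Opens X)ᵒᵖ) : Mono (((constOpenPre k X).map (homOfLE h)).app W) := by
    rw [ModuleCat.mono_iff_injective]
    exact Finsupp.mapDomain_injective fun i j _ => Subsingleton.elim (α := W.unop ⟶ V) i j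
  have := NatTrans.mono_of_mono_app ((constOpenPre k X).map (homOfLE h))
  exact inferInstanceAs (Mono ((presheafToSheaf _ _).map ((constOpenPre k X).map (homOfLE h))))

/-- Injective sheaves are flasque. -/
lemma res_surjective_of_injective (G : Sh k X) [Injective G] {V U : Opens X} (h : V ≤ U) :
    Function.Surjective (res G h) := by
  intro s
  refine ⟨toSec (Injective.factorThru (ofSec s) ((constOpen k).map (homOfLE h))), ?_⟩
  rw [← toSec_map, Injective.comp_factorThru, toSec_ofSec]

end ConstOpen

/-! ### Derived direct images -/

section Adjunction

variable {A B : Type*} [Category* A] [Category* B] {F : A ⥤ B} {G : B ⥤ A} (adj : F ⊣ G)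

lemma unit_comp_map_comp {X : A} {Y : B} (f : X ⟶ G.obj Y) :
    adj.unit.app X ≫ G.map (F.map f ≫ adj.counit.app Y) = f := by
  simp

lemma map_comp_comp_counit {X : A} {Y : B} (g : F.obj X ⟶ Y) :
    F.map (adj.unit.app X ≫ G.map g) ≫ adj.counit.app Y = g := by
  simp

end Adjunction

section DerivedAdjunction

variable {A B : Type*} [Category* A] [Category* B] [Abelian A] [Abelian B]
  [HasDerivedCategory A] [HasDerivedCategory B]

/-- Morphisms of the derived category to a K-injective complex are represented by morphisms of
complexes. -/
lemma exists_Q_map_eq_of_isKInjective {K L : CochainComplex A ℤ} [L.IsKInjective]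
    (a : DerivedCategory.Q.obj K ⟶ DerivedCategory.Q.obj L) :
    ∃ f : K ⟶ L, DerivedCategory.Q.map f = a := by
  let e := DerivedCategory.quotientCompQhIso A
  obtain ⟨g, hg⟩ := (CochainComplex.IsKInjective.Qh_map_bijective _ L).surjective
    (e.hom.app K ≫ a ≫ e.inv.app L)
  obtain ⟨f, rfl⟩ := (HomotopyCategory.quotient _ _).map_surjective g
  refine ⟨f, ?_⟩
  have := e.hom.naturality f
  rw [← cancel_epi (e.hom.app K)]
  refine this.symm.trans ?_
  dsimp at hg ⊢
  rw [hg]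
  simp

lemma nonempty_homotopy_zero_of_Q_map_eq_zero {K L : CochainComplex A ℤ} [L.IsKInjective]
    (f : K ⟶ L) (hf : DerivedCategory.Q.map f = 0) : Nonempty (Homotopy f 0) := by
  let e := DerivedCategory.quotientCompQhIso A
  rw [← HomotopyCategory.quotient_map_eq_zero_iff]
  apply (CochainComplex.IsKInjective.Qh_map_bijective _ L).injective
  have := e.hom.naturality f
  rw [hf, comp_zero] at this
  rw [Functor.map_zero, ← cancel_mono (e.hom.app L), zero_comp]
  exact this

variable {F : A ⥤ B} {G : B ⥤ A} (adj : F ⊣ G) [F.Additive] [G.Additive]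

/-- The unit of an adjunction, on complexes. -/
def unitComplex (K : CochainComplex A ℤ) :
    K ⟶ (G.mapHomologicalComplex (.up ℤ)).obj ((F.mapHomologicalComplex (.up ℤ)).obj K) where
  f i := adj.unit.app (K.X i)
  comm' i j _ := (adj.unit.naturality (K.d i j)).symm

/-- The counit of an adjunction, on complexes. -/
def counitComplex (K : CochainComplex B ℤ) :
    (F.mapHomologicalComplex (.up ℤ)).obj ((G.mapHomologicalComplex (.up ℤ)).obj K) ⟶ K where
  f i := adj.counit.app (K.X i)
  comm' i j _ := (adj.counit.naturality (K.d i j)).symm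

variable [PreservesFiniteLimits F] [PreservesFiniteColimits F]

/-- The counit of an adjunction with exact left adjoint, in the derived category. -/
def derivedCounit (J : CochainComplex B ℤ) :
    F.mapDerivedCategory.obj (DerivedCategory.Q.obj ((G.mapHomologicalComplex (.up ℤ)).obj J)) ⟶
      DerivedCategory.Q.obj J :=
  F.mapDerivedCategoryFactors.hom.app _ ≫ DerivedCategory.Q.map (counitComplex adj J)

/-- For a K-injective complex `J` such that `G J` is K-injective, the adjunction between `F` and
`G` holds for `J` in the derived categories. -/
lemma derivedCounit_bijective (J : CochainComplex B ℤ) [J.IsKInjective]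
    [CochainComplex.IsKInjective ((G.mapHomologicalComplex (.up ℤ)).obj J)]
    (H : DerivedCategory A) :
    Function.Bijective (fun a : H ⟶ DerivedCategory.Q.obj ((G.mapHomologicalComplex (.up ℤ)).obj J)
      => F.mapDerivedCategory.map a ≫ derivedCounit adj J) := by
  -- It suffices to treat the complexes `H = Q K`, for which the statement is the adjunction for
  -- morphisms of complexes.
  obtain ⟨K, ⟨e⟩⟩ : ∃ K, Nonempty (DerivedCategory.Q.obj K ≅ H) :=
    ⟨_, ⟨DerivedCategory.Q.objObjPreimageIso H⟩⟩
  suffices h : Function.Bijective (fun a : DerivedCategory.Q.obj K ⟶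
      DerivedCategory.Q.obj ((G.mapHomologicalComplex (.up ℤ)).obj J) =>
      F.mapDerivedCategory.map a ≫ derivedCounit adj J) by
    constructor
    · intro a b hab
      rw [← cancel_epi e.hom]
      apply h.injective
      dsimp only at hab ⊢
      rw [Functor.map_comp, Functor.map_comp, Category.assoc, hab, Category.assoc]
    · intro b
      obtain ⟨a, ha⟩ := h.surjective (F.mapDerivedCategory.map e.hom ≫ b)
      refine ⟨e.inv ≫ a, ?_⟩
      dsimp only at ha ⊢
      rw [Functor.map_comp, Category.assoc, ha, ← Functor.map_comp_assoc]
      simp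
  have key (f : K ⟶ (G.mapHomologicalComplex (.up ℤ)).obj J) :
      F.mapDerivedCategory.map (DerivedCategory.Q.map f) ≫ derivedCounit adj J =
        F.mapDerivedCategoryFactors.hom.app K ≫ DerivedCategory.Q.map
          ((F.mapHomologicalComplex (.up ℤ)).map f ≫ counitComplex adj J) := by
    rw [derivedCounit, F.mapDerivedCategoryFactors_hom_naturality_assoc, Functor.map_comp]
  constructor
  · intro a b hab
    rw [← sub_eq_zero]
    obtain ⟨f, hf⟩ := exists_Q_map_eq_of_isKInjective (a - b)
    have h0 : F.mapDerivedCategory.map (a - b) ≫ derivedCounit adj J = 0 := by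
      rw [Functor.map_sub, Preadditive.sub_comp, sub_eq_zero]
      exact hab
    rw [← hf, key] at h0
    have h1 : DerivedCategory.Q.map
        ((F.mapHomologicalComplex (.up ℤ)).map f ≫ counitComplex adj J) = 0 := by
      rwa [← cancel_epi (F.mapDerivedCategoryFactors.hom.app K), comp_zero]
    obtain ⟨h⟩ := nonempty_homotopy_zero_of_Q_map_eq_zero _ h1
    have h2 : f = unitComplex adj K ≫ (G.mapHomologicalComplex (.up ℤ)).map
        ((F.mapHomologicalComplex (.up ℤ)).map f ≫ counitComplex adj J) := by
      ext i
      exact (unit_comp_map_comp adj (f.f i)).symm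
    rw [← hf, h2, DerivedCategory.Q_map_eq_of_homotopy _
      ((G.mapHomotopy h).compLeft (unitComplex adj K))]
    simp
  · intro b
    obtain ⟨g, hg⟩ := exists_Q_map_eq_of_isKInjective
      (F.mapDerivedCategoryFactors.inv.app K ≫ b)
    refine ⟨DerivedCategory.Q.map (unitComplex adj K ≫ (G.mapHomologicalComplex (.up ℤ)).map g), ?_⟩
    dsimp only
    rw [key]
    have : (F.mapHomologicalComplex (.up ℤ)).map
        (unitComplex adj K ≫ (G.mapHomologicalComplex (.up ℤ)).map g) ≫
          counitComplex adj J = g := by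
      ext i
      exact map_comp_comp_counit adj (g.f i)
    rw [this, hg, Iso.hom_inv_id_app_assoc]

end DerivedAdjunction

section DirectImage

open Opposite

variable {k : Type u} [CommRing k] {X Y : TopCat.{u}}

instance (f : X ⟶ Y) : (TopCat.Sheaf.pushforward (ModuleCat.{u} k) f).Additive where
  map_add := rfl

variable (k) in
/-- The direct image by `f` on complexes of sheaves. -/
abbrev pushComplex (f : X ⟶ Y) : CochainComplex (Sh k X) ℤ ⥤ CochainComplex (Sh k Y) ℤ :=
  (TopCat.Sheaf.pushforward (ModuleCat.{u} k) f).mapHomologicalComplex (.up ℤ)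

instance injective_pushforward (f : X ⟶ Y) (J : Sh k X) [Injective J] :
    Injective ((TopCat.Sheaf.pushforward (ModuleCat.{u} k) f).obj J) :=
  Injective.injective_of_adjoint (TopCat.Sheaf.pullbackPushforwardAdjunction _ f) J

lemma isKInjective_pushComplex (f : X ⟶ Y) (J : CochainComplex (Sh k X) ℤ)
    [∀ n, Injective (J.X n)] (n : ℤ) [J.IsStrictlyGE n] :
    CochainComplex.IsKInjective ((pushComplex k f).obj J) := by
  have (m : ℤ) : Injective (((pushComplex k f).obj J).X m) :=
    injective_pushforward f (J.X m)
  have : CochainComplex.IsStrictlyGE ((pushComplex k f).obj J) n := by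
    rw [CochainComplex.isStrictlyGE_iff]
    intro i hi
    exact (TopCat.Sheaf.pushforward (ModuleCat.{u} k) f).map_isZero
      (J.isZero_of_isStrictlyGE n i hi)
  exact CochainComplex.isKInjective_of_injective _ n

/-- A bounded complex of sheaves is isomorphic to a bounded below complex of injective sheaves which
is exact in high degrees. -/
lemma exists_injective_resolution (A : Db k X) :
    ∃ (J : CochainComplex (Sh k X) ℤ) (n b : ℤ), (∀ n, Injective (J.X n)) ∧ J.IsStrictlyGE n ∧
      (∀ m, b < m → J.ExactAt m) ∧ Nonempty (DerivedCategory.Q.obj J ≅ A.obj) := by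
  obtain ⟨⟨n, hn⟩, ⟨b, hb⟩⟩ := A.property
  obtain ⟨K, _, ⟨e⟩⟩ := DerivedCategory.exists_iso_Q_obj_of_isGE A.obj n
  obtain ⟨J, i, _, _, _⟩ :=
    CochainComplex.Plus.modelCategoryQuillen.exists_quasiIso_injective K n
  let e' : DerivedCategory.Q.obj J ≅ A.obj := (asIso (DerivedCategory.Q.map i)).symm ≪≫ e.symm
  refine ⟨J, n, b, inferInstance, inferInstance, fun m hm => ?_, ⟨e'⟩⟩
  have : (DerivedCategory.Q.obj J).IsLE b := DerivedCategory.TStructure.t.isLE_of_iso e'.symm b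
  have : J.IsLE b := by
    rwa [← DerivedCategory.isLE_Q_obj_iff]
  exact CochainComplex.exactAt_of_isLE J b m hm

lemma isFlasqueComplex_of_injective (J : CochainComplex (Sh k X) ℤ) [∀ n, Injective (J.X n)] :
    IsFlasqueComplex J :=
  fun m _ _ h => res_surjective_of_injective (J.X m) h

/-- The direct image of a bounded complex exists in the bounded derived category, if the
cohomology of injective resolutions on the inverse images of small open sets vanishes in high
degrees. -/
lemma exists_isDirectImage (f : X ⟶ Y) (A : Db k X) (d : ℤ)
    (h : ∀ (J : CochainComplex (Sh k X) ℤ) (b m : ℤ), IsFlasqueComplex J →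
      (∀ m, b < m → IsLocallyExactAt J m) → b + d < m → ∀ (U : Opens Y),
      ∀ x ∈ U, ∃ V ≤ U, x ∈ V ∧ ∀ α : Sec (J.X m) ((Opens.map f).obj V), IsCocycle J α →
        IsBoundaryOn J α ((Opens.map f).obj V)) :
    ∃ (P : Db k Y) (ε : (pull k f).obj P ⟶ A), IsDirectImage f A P ε := by
  obtain ⟨J, n, b, _, _, hb, ⟨e⟩⟩ := exists_injective_resolution A
  have := CochainComplex.isKInjective_of_injective J n
  have := isKInjective_pushComplex f J n
  have hP : DerivedCategory.TStructure.t.bounded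
      (DerivedCategory.Q.obj ((pushComplex k f).obj J)) := by
    refine ⟨⟨n, ?_⟩, ⟨b + d, ?_⟩⟩
    -- The lower bound is that of the resolution, the upper one is the hypothesis on cohomology.
    · have : CochainComplex.IsStrictlyGE ((pushComplex k f).obj J) n := by
        rw [CochainComplex.isStrictlyGE_iff]
        intro i hi
        exact (TopCat.Sheaf.pushforward (ModuleCat.{u} k) f).map_isZero
          (J.isZero_of_isStrictlyGE n i hi)
      exact inferInstanceAs (DerivedCategory.IsGE (DerivedCategory.Q.obj _) n)
    · have : CochainComplex.IsLE ((pushComplex k f).obj J) (b + d) := by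
        rw [CochainComplex.isLE_iff]
        intro m hm
        refine exactAt_of_isLocallyExactAt fun U s hs x hx => ?_
        obtain ⟨V, hVU, hxV, hV⟩ := h J b m (isFlasqueComplex_of_injective J)
          (fun m hm => isLocallyExactAt_of_exactAt (hb m hm)) hm U x hx
        have hVU' : (Opens.map f).obj V ≤ (Opens.map f).obj U := (Opens.map f).monotone hVU
        obtain ⟨_, β, hβ⟩ := hV (res (J.X m) hVU' s) (IsCocycle.res (J := J) hs hVU')
        exact ⟨V, hxV, hVU, β, hβ.trans (res_self _ _)⟩
      exact inferInstanceAs (DerivedCategory.IsLE (DerivedCategory.Q.obj _) (b + d))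
  refine ⟨⟨_, hP⟩, ObjectProperty.homMk (derivedCounit
    (TopCat.Sheaf.pullbackPushforwardAdjunction (ModuleCat.{u} k) f) J ≫ e.hom), fun H => ?_⟩
  have hbij := derivedCounit_bijective
    (TopCat.Sheaf.pullbackPushforwardAdjunction (ModuleCat.{u} k) f) J H.obj
  constructor
  · intro a a' ha
    apply DerivedCategory.Bounded.ι.map_injective
    apply hbij.injective
    refine (cancel_mono e.hom).1 ((Category.assoc _ _ _).trans ?_)
    exact (congrArg (·.hom) ha).trans (Category.assoc _ _ _).symm
  · intro b
    obtain ⟨a, ha⟩ := hbij.surjective (b.hom ≫ e.inv)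
    refine ⟨ObjectProperty.homMk a, ?_⟩
    apply DerivedCategory.Bounded.ι.map_injective
    refine (Category.assoc _ _ _).symm.trans ((congrArg (· ≫ e.hom) ha).trans ?_)
    exact (Category.assoc _ _ _).trans ((congrArg (b.hom ≫ ·) e.inv_hom_id).trans
      (Category.comp_id _))

end DirectImage

/-! ### Existence of the convolution -/

section Convolution

variable {k : Type u} [CommRing k]

/-- The convolution exists, since the space `(M × ℝ) × [c, ∞)` has finite cohomological dimension
over small open subsets of `M`: the coordinates of a chart and the two real variables separate the
points. -/
lemma exists_isConv (E : Type u) [NormedAddCommGroup E] [NormedSpace ℝ E] [FiniteDimensional ℝ E]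
    {M : Type u} [TopologicalSpace M] [T2Space M] [SecondCountableTopology M] [ChartedSpace E M]
    (c : ℝ) (F : Db k (MR M)) :
    ∃ (P : Db k (MR M)) (ε : (pull k (convSum M c)).obj P ⟶ (pull k (convProj M c)).obj F),
      IsConv c F P ε := by
  refine exists_isDirectImage (convSum M c) _ (Module.finrank ℝ E + 3) ?_
  intro J b m hJ hb hm U x hx
  let φ := chartAt E x.1
  let V : Opens (MR M) := U ⊓ ⟨Prod.fst ⁻¹' φ.source, φ.open_source.preimage continuous_fst⟩
  refine ⟨V, inf_le_left, ⟨hx, mem_chart_source E x.1⟩, fun α hα => ?_⟩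
  let O := (Opens.map (convSum M c)).obj V
  have : LocallyCompactSpace M := ChartedSpace.locallyCompactSpace E M
  have : LocallyCompactSpace (Set.Ici c) :=
    isClosed_Ici.isClosedEmbedding_subtypeVal.locallyCompactSpace
  have : LocallyCompactSpace O :=
    O.isOpen.locallyCompactSpace (X := (M × ℝ) × Set.Ici c)
  have : SecondCountableTopology O :=
    inferInstanceAs (SecondCountableTopology (O : Set ((M × ℝ) × Set.Ici c)))
  have : T2Space (MRc M c) := inferInstanceAs (T2Space ((M × ℝ) × Set.Ici c))
  let e : E ≃L[ℝ] (Fin (Module.finrank ℝ E) → ℝ) := ContinuousLinearEquiv.ofFinrankEq (by simp)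
  let n := Module.finrank ℝ E
  -- The functions are the `n` coordinates of the chart, then `t`, then `u`. These are `n + 2`
  -- functions, and the exhaustion by compact sets costs one more degree.
  let π (i : ℕ) (p : (M × ℝ) × Set.Ici c) : ℝ :=
    if h : i < n then e (φ p.1.1) ⟨i, h⟩ else if i = n then p.1.2 else p.2
  refine isBoundaryOn_of_separating (X := MRc M c) hJ hb (O := O) π (fun i => ?_) (n + 2)
    (fun p hp q hq hpq => ?_) (by push_cast; lia) α hα
  · by_cases hi : i < n
    · simp only [π, hi, dif_pos]
      refine (continuous_apply (A := fun _ => ℝ) (⟨i, hi⟩ : Fin n)).comp_continuousOn ?_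
      refine e.continuous.comp_continuousOn (φ.continuousOn.comp
        (continuous_fst.comp continuous_fst).continuousOn fun p hp => hp.2)
    · simp only [π, hi, dif_neg, not_false_eq_true]
      split_ifs <;> fun_prop
  · have h₁ : p.1.1 = q.1.1 := by
      refine φ.injOn (x₁ := p.1.1) (x₂ := q.1.1) hp.2 hq.2 (e.injective (funext fun i => ?_))
      have := hpq i (by lia)
      simpa only [π, show (i : ℕ) < n from i.2, dif_pos] using this
    have h₂ : p.1.2 = q.1.2 := by
      simpa only [π, lt_irrefl, dif_neg, not_false_eq_true, if_true] using hpq n (by lia)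
    have h₃ : (p.2 : ℝ) = q.2 := by
      simpa [π] using hpq (n + 1) (by lia)
    exact Prod.ext (Prod.ext h₁ h₂) (Subtype.ext h₃)

end Convolution

/-! ### Sections of inverse images -/

open Opposite

section PullSections

variable {k : Type u} [CommRing k] {X Y : TopCat.{u}} (f : X ⟶ Y)

/-- The inverse image of a section. -/
def pullSec (G : Sh k Y) {V : Opens Y} (s : Sec G V) :
    Sec ((TopCat.Sheaf.pullback (ModuleCat.{u} k) f).obj G) ((Opens.map f).obj V) :=
  secMap ((TopCat.Sheaf.pullbackPushforwardAdjunction (ModuleCat.{u} k) f).unit.app G) V s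

/-- The sheafification of the presheaf inverse image. -/
abbrev pullSheafify (G : Sh k Y) : Sh k X :=
  (presheafToSheaf (Opens.grothendieckTopology X) (ModuleCat.{u} k)).obj
    ((TopCat.Presheaf.pullback (ModuleCat.{u} k) f).obj G.obj)

/-- The inverse image is the sheafification of the presheaf inverse image. -/
def pullIsoSheafify (G : Sh k Y) :
    (TopCat.Sheaf.pullback (ModuleCat.{u} k) f).obj G ≅ pullSheafify f G :=
  (Functor.sheafPullbackConstruction.sheafPullbackIso (Opens.map f) (ModuleCat.{u} k)
    (Opens.grothendieckTopology Y) (Opens.grothendieckTopology X)).app G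

/-- The inverse image of a section, in the sheafification of the presheaf inverse image. -/
def pullSec' (G : Sh k Y) {V : Opens Y} (s : Sec G V) :
    Sec (pullSheafify f G) ((Opens.map f).obj V) :=
  ((toSheafify (Opens.grothendieckTopology X)
    ((TopCat.Presheaf.pullback (ModuleCat.{u} k) f).obj G.obj)).app (op ((Opens.map f).obj V))).hom
    ((((TopCat.Presheaf.pullbackPushforwardAdjunction (ModuleCat.{u} k) f).unit.app G.obj).app
      (op V)).hom s)

lemma secMap_pullSec (G : Sh k Y) {V : Opens Y} (s : Sec G V) :
    secMap (pullIsoSheafify f G).hom _ (pullSec f G s) = pullSec' f G s := by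
  have h := Adjunction.unit_leftAdjointUniq_hom_app
    (Functor.sheafAdjunctionContinuous (Opens.map f) (ModuleCat.{u} k)
      (Opens.grothendieckTopology Y) (Opens.grothendieckTopology X))
    (Functor.sheafPullbackConstruction.sheafAdjunctionContinuous (Opens.map f) (ModuleCat.{u} k)
      (Opens.grothendieckTopology Y) (Opens.grothendieckTopology X)) G
  have h' := Adjunction.map_restrictFullyFaithful_unit_app
    (((Opens.map f).op.lanAdjunction (ModuleCat.{u} k)).comp
      (sheafificationAdjunction (Opens.grothendieckTopology X) (ModuleCat.{u} k)))
    (fullyFaithfulSheafToPresheaf (Opens.grothendieckTopology Y) (ModuleCat.{u} k))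
    (Functor.FullyFaithful.id _)
    (L := Functor.sheafPullbackConstruction.sheafPullback (Opens.map f) (ModuleCat.{u} k)
      (Opens.grothendieckTopology Y) (Opens.grothendieckTopology X))
    (R := (Opens.map f).sheafPushforwardContinuous (ModuleCat.{u} k)
      (Opens.grothendieckTopology Y) (Opens.grothendieckTopology X))
    (Iso.refl _) (Iso.refl _) G
  have h1 := congrArg (fun φ => secMap φ V s) h
  refine h1.trans ?_
  have h2 := congrArg (fun φ => (φ.app (op V)).hom s) h'
  refine h2.trans ?_
  simp
  rfl

/-- Every section of an inverse image is locally the inverse image of a section. -/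
lemma exists_pullSec_eq (G : Sh k Y) {U : Opens X}
    (t : Sec ((TopCat.Sheaf.pullback (ModuleCat.{u} k) f).obj G) U) (x : X) (hx : x ∈ U) :
    ∃ (V : Opens Y) (s : Sec G V) (W : Opens X) (hW : W ≤ U) (hWV : W ≤ (Opens.map f).obj V),
      x ∈ W ∧ res _ hW t = res _ hWV (pullSec f G s) := by
  let iso := pullIsoSheafify f G
  let P := (TopCat.Presheaf.pullback (ModuleCat.{u} k) f).obj G.obj
  have hs : Presheaf.IsLocallySurjective (Opens.grothendieckTopology X)
      (toSheafify (Opens.grothendieckTopology X) P) := inferInstance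
  obtain ⟨W, i₀, ⟨t', ht'⟩, hxW⟩ := (TopCat.Presheaf.isLocallySurjective_iff _).1 hs U
    (secMap iso.hom U t) x hx
  -- The stalk of the presheaf inverse image at `x` is the stalk of `G` at `f x`.
  obtain ⟨a, ha⟩ := ((ConcreteCategory.bijective_of_isIso
    (TopCat.Presheaf.stalkPullbackIso (ModuleCat.{u} k) f G.obj x).hom).surjective
      (P.germ W x hxW t'))
  obtain ⟨V, hV, s, rfl⟩ := TopCat.Presheaf.exists_germ_eq G.obj a
  have h1 := congrArg (fun φ => φ.hom s)
    (TopCat.Presheaf.germ_stalkPullbackHom (ModuleCat.{u} k) f G.obj x V hV)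
  obtain ⟨W', hxW', i₁, i₂, h2⟩ := P.germ_eq x hxW hV t' _ (ha.symm.trans h1)
  refine ⟨V, s, W', i₁.le.trans i₀, i₂.le, hxW', ?_⟩
  apply secMap_injective_of_mono iso.hom
  rw [secMap_res, secMap_res]
  refine (res_res _ i₁.le i₀ _).symm.trans ((congrArg (res _ i₁.le) ht'.symm).trans ?_)
  refine Eq.trans ?_ (congrArg (res _ i₂.le) (secMap_pullSec f G s)).symm
  have n₁ := congrArg (fun φ => φ.hom t')
    ((toSheafify (Opens.grothendieckTopology X) P).naturality i₁.op)
  have n₂ := congrArg (fun φ => φ.hom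
      ((((TopCat.Presheaf.pullbackPushforwardAdjunction (ModuleCat.{u} k) f).unit.app G.obj).app
      (op V)).hom s))
    ((toSheafify (Opens.grothendieckTopology X) P).naturality i₂.op)
  refine n₁.symm.trans (Eq.trans ?_ n₂)
  exact congrArg ((toSheafify (Opens.grothendieckTopology X) P).app (op W')).hom h2

/-- If the inverse image of a section vanishes near `x`, then the section vanishes near `f x`. -/
lemma exists_res_eq_zero_of_pullSec (G : Sh k Y) {V : Opens Y} (s : Sec G V) {W : Opens X}
    (hW : W ≤ (Opens.map f).obj V) (hs : res _ hW (pullSec f G s) = 0) (x : X) (hx : x ∈ W) :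
    ∃ (V' : Opens Y) (hV' : V' ≤ V), f x ∈ V' ∧ res G hV' s = 0 := by
  let iso := pullIsoSheafify f G
  let P := (TopCat.Presheaf.pullback (ModuleCat.{u} k) f).obj G.obj
  have h0 : res _ hW (pullSec' f G s) = 0 := by
    rw [← secMap_pullSec, ← secMap_res, hs, map_zero]
  have hinj : Presheaf.IsLocallyInjective (Opens.grothendieckTopology X)
      (toSheafify (Opens.grothendieckTopology X) P) := inferInstance
  let s' := (((TopCat.Presheaf.pullbackPushforwardAdjunction (ModuleCat.{u} k) f).unit.app
    G.obj).app (op V)).hom s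
  have n := congrArg (fun φ => φ.hom s')
    ((toSheafify (Opens.grothendieckTopology X) P).naturality (homOfLE hW).op)
  obtain ⟨W', i, hi, hxW'⟩ := Presheaf.equalizerSieve_mem (Opens.grothendieckTopology X)
    (toSheafify (Opens.grothendieckTopology X) P) (X := op W) (P.map (homOfLE hW).op s') 0
    ((n.trans h0).trans (map_zero _).symm) x hx
  have hi' : P.map i.op (P.map (homOfLE hW).op s') = 0 := hi.trans (map_zero _)
  have hg : P.germ ((Opens.map f).obj V) x (hW hx) s' = 0 := by
    rw [← P.germ_res_apply (homOfLE hW) x hx, ← P.germ_res_apply i x hxW', hi', map_zero]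
  have h1 := congrArg (fun φ => φ.hom s)
    (TopCat.Presheaf.germ_stalkPullbackHom (ModuleCat.{u} k) f G.obj x V (hW hx))
  have h2 : TopCat.Presheaf.germ G.obj V (f x) (hW hx) s =
      TopCat.Presheaf.germ G.obj V (f x) (hW hx) 0 := by
    apply (ConcreteCategory.bijective_of_isIso
      (TopCat.Presheaf.stalkPullbackIso (ModuleCat.{u} k) f G.obj x).hom).injective
    rw [map_zero, map_zero]
    exact h1.trans hg
  obtain ⟨V', hxV', i₁, i₂, h3⟩ := TopCat.Presheaf.germ_eq G.obj (f x) (hW hx) (hW hx) s 0 h2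
  exact ⟨V', i₁.le, hxV', h3.trans (map_zero _)⟩

lemma res_pullSec (G : Sh k Y) {V' V : Opens Y} (h : V' ≤ V) (s : Sec G V) :
    res _ ((Opens.map f).monotone h) (pullSec f G s) = pullSec f G (res G h s) :=
  (secMap_res ((TopCat.Sheaf.pullbackPushforwardAdjunction (ModuleCat.{u} k) f).unit.app G)
    h s).symm

lemma secMap_map_pullSec {G H : Sh k Y} (φ : G ⟶ H) {V : Opens Y} (s : Sec G V) :
    secMap ((TopCat.Sheaf.pullback (ModuleCat.{u} k) f).map φ) _ (pullSec f G s) =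
      pullSec f H (secMap φ V s) :=
  congrArg (fun ψ => secMap ψ V s)
    ((TopCat.Sheaf.pullbackPushforwardAdjunction (ModuleCat.{u} k) f).unit.naturality φ).symm

variable (k) in
/-- The inverse image by `f` on complexes of sheaves. -/
abbrev pullComplex : CochainComplex (Sh k Y) ℤ ⥤ CochainComplex (Sh k X) ℤ :=
  (TopCat.Sheaf.pullback (ModuleCat.{u} k) f).mapHomologicalComplex (.up ℤ)

variable {f} in
/-- The properties of the map from the sections of `K` to those of `L`, for a morphism of complexes
`K ⟶ f_* L` which identifies `L` with the inverse image of `K`. -/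
structure IsPullSec {K : CochainComplex (Sh k Y) ℤ} {L : CochainComplex (Sh k X) ℤ}
    (p : ∀ (m : ℤ) (V : Opens Y), Sec (K.X m) V →ₗ[k] Sec (L.X m) ((Opens.map f).obj V)) :
    Prop where
  res_apply {m : ℤ} {V' V : Opens Y} (h : V' ≤ V) (s : Sec (K.X m) V) :
    res _ ((Opens.map f).monotone h) (p m V s) = p m V' (res _ h s)
  d_apply {m m' : ℤ} {V : Opens Y} (s : Sec (K.X m) V) :
    secMap (L.d m m') _ (p m V s) = p m' V (secMap (K.d m m') V s)
  exists_eq {m : ℤ} {U : Opens X} (t : Sec (L.X m) U) (x : X) (hx : x ∈ U) :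
    ∃ (V : Opens Y) (s : Sec (K.X m) V) (W : Opens X) (hW : W ≤ U)
      (hWV : W ≤ (Opens.map f).obj V), x ∈ W ∧ res _ hW t = res _ hWV (p m V s)
  exists_res_eq_zero {m : ℤ} {V : Opens Y} (s : Sec (K.X m) V) {W : Opens X}
    (hW : W ≤ (Opens.map f).obj V) (hs : res _ hW (p m V s) = 0) (x : X) (hx : x ∈ W) :
    ∃ (V' : Opens Y) (hV' : V' ≤ V), f x ∈ V' ∧ res _ hV' s = 0

lemma isPullSec_pullComplex (K : CochainComplex (Sh k Y) ℤ) :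
    IsPullSec (f := f) (K := K) (L := (pullComplex k f).obj K)
      (fun m V => secMap
        ((TopCat.Sheaf.pullbackPushforwardAdjunction (ModuleCat.{u} k) f).unit.app (K.X m)) V) where
  res_apply h s := res_pullSec f _ h s
  d_apply s := secMap_map_pullSec f _ s
  exists_eq t x hx := exists_pullSec_eq f _ t x hx
  exists_res_eq_zero s _ hW hs x hx := exists_res_eq_zero_of_pullSec f _ s hW hs x hx

variable {f} {K : CochainComplex (Sh k Y) ℤ} {L J : CochainComplex (Sh k X) ℤ}
  {p : ∀ (m : ℤ) (V : Opens Y), Sec (K.X m) V →ₗ[k] Sec (L.X m) ((Opens.map f).obj V)}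

/-- A map as in `IsPullSec`, up to quasi-isomorphism. -/
structure IsDerivedPullSec
    (p : ∀ (m : ℤ) (V : Opens Y), Sec (K.X m) V →ₗ[k] Sec (J.X m) ((Opens.map f).obj V)) :
    Prop where
  res_apply {m : ℤ} {V' V : Opens Y} (h : V' ≤ V) (s : Sec (K.X m) V) :
    res _ ((Opens.map f).monotone h) (p m V s) = p m V' (res _ h s)
  d_apply {m m' : ℤ} {V : Opens Y} (s : Sec (K.X m) V) :
    secMap (J.d m m') _ (p m V s) = p m' V (secMap (K.d m m') V s)
  /-- cocycles of `J` come locally from cocycles of `K` -/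
  exists_eq_add {m : ℤ} {U : Opens X} (α : Sec (J.X m) U) (hα : IsCocycle J α) (x : X)
    (hx : x ∈ U) :
    ∃ (V : Opens Y) (s : Sec (K.X m) V) (W : Opens X) (hW : W ≤ U) (hWV : W ≤ (Opens.map f).obj V)
      (β : Sec (J.X (m - 1)) W), x ∈ W ∧ IsCocycle K s ∧
      res _ hW α = res _ hWV (p m V s) + secMap (J.d (m - 1) m) W β
  /-- a cocycle of `K` is a boundary near `f x` if its image is a boundary near `x` -/
  exists_isBoundaryOn {m : ℤ} {V : Opens Y} (s : Sec (K.X m) V)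
    (hs : IsCocycle K s) {W : Opens X} (hWV : W ≤ (Opens.map f).obj V) (β : Sec (J.X (m - 1)) W)
    (h : res _ hWV (p m V s) = secMap (J.d (m - 1) m) W β) (x : X) (hx : x ∈ W) :
    ∃ V' : Opens Y, f x ∈ V' ∧ IsBoundaryOn K s V'

/-- The composition of the map to the sections of the inverse image with a quasi-isomorphism, such
as the one to an injective resolution. -/
lemma IsPullSec.comp_quasiIso (hp : IsPullSec p) (g : L ⟶ J) [QuasiIso g] :
    IsDerivedPullSec (K := K) (fun m V => secMap (g.f m) _ ∘ₗ p m V) where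
  res_apply {m V' V} h s := by
    dsimp
    rw [← secMap_res, hp.res_apply]
  d_apply {m m' V} s := by
    dsimp
    rw [← hp.d_apply, ← secMap_comp, ← secMap_comp, g.comm]
  exists_eq_add {m U} α hα x hx := by
    obtain ⟨W, hW, hxW, t, r, ht, h⟩ := exists_local_of_epi_homologyMap g (m := m) inferInstance
      α hα x hx
    obtain ⟨V, s, W', hW', hWV', hxW', hs⟩ := hp.exists_eq t x hxW
    obtain ⟨V', hV', hxV', hs'⟩ := hp.exists_res_eq_zero
      (secMap (K.d m (m + 1)) V s) hWV' (by
        rw [← hp.d_apply, ← secMap_res, ← hs, secMap_res,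
          show secMap _ W t = 0 from ht, map_zero]) x hxW'
    refine ⟨V', res _ hV' s, W' ⊓ (Opens.map f).obj V', inf_le_left.trans (hW'.trans hW),
      inf_le_right, res _ (inf_le_left.trans hW') r, ⟨hxW', hxV'⟩, ?_, ?_⟩
    · rw [IsCocycle, secMap_res, hs']
    · have h' := congrArg (res _ (inf_le_left.trans hW' : W' ⊓ (Opens.map f).obj V' ≤ W)) h
      rw [res_res, map_add, ← secMap_res, ← res_res _ inf_le_left hW', hs, ← secMap_res,
        res_res] at h'
      dsimp
      rw [h', ← hp.res_apply, ← secMap_res, res_res]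
  exists_isBoundaryOn {m V} s hs W hWV β h x hx := by
    obtain ⟨W₁, hxW₁, hW₁, t, ht⟩ := exists_local_of_mono_homologyMap g (m := m) inferInstance
      (res _ hWV (p m V s)) (by
        refine IsCocycle.res ?_ _
        rw [IsCocycle, hp.d_apply, show secMap _ V s = 0 from hs, map_zero]) β
        (by rw [secMap_res]; exact h) x hx
    obtain ⟨V₂, s₂, W₂, hW₂, hWV₂, hxW₂, hs₂⟩ := hp.exists_eq t x hxW₁
    have hV : W₂ ⊓ (Opens.map f).obj (V ⊓ V₂) ≤ (Opens.map f).obj (V ⊓ V₂) := inf_le_right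
    obtain ⟨V', hV', hxV', h0⟩ := hp.exists_res_eq_zero
      (res _ (inf_le_left : V ⊓ V₂ ≤ V) s -
        secMap (K.d (m - 1) m) _ (res _ (inf_le_right : V ⊓ V₂ ≤ V₂) s₂)) hV (by
      rw [map_sub, ← hp.d_apply, ← hp.res_apply, ← hp.res_apply, map_sub, res_res,
        ← secMap_res, res_res, ← res_res _ inf_le_left hWV₂, ← hs₂, res_res, secMap_res,
        ht, res_res, res_res, sub_self]) x ⟨hxW₂, hWV (hW₁ hxW₁), hWV₂ hxW₂⟩
    refine ⟨V', hxV', hV'.trans inf_le_left, res _ (hV'.trans inf_le_right) s₂, ?_⟩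
    rw [map_sub, sub_eq_zero, res_res, ← secMap_res, res_res] at h0
    exact h0.symm

end PullSections

/-! ### Homotopy invariance -/

section Cylinder

variable {k : Type u} [CommRing k] (Y : TopCat.{u})

/-- The cylinder `Y × [0, 1]`. -/
abbrev Cyl : TopCat.{u} := TopCat.of (Y × unitInterval)

/-- The projection of the cylinder to its base. -/
def cylProj : Cyl Y ⟶ Y := TopCat.ofHom ⟨fun p => p.1, by fun_prop⟩

variable {Y}

/-- The open box `V × O` in the cylinder. -/
def box (V : Opens Y) (O : Opens unitInterval) : Opens (Cyl Y) :=
  ⟨{p | p.1 ∈ V ∧ p.2 ∈ O}, (V.isOpen.preimage continuous_fst).inter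
    (O.isOpen.preimage continuous_snd)⟩

lemma box_le (V : Opens Y) (O : Opens unitInterval) : box V O ≤ (Opens.map (cylProj Y)).obj V :=
  fun _ hp => hp.1

lemma box_mono {V V' : Opens Y} {O O' : Opens unitInterval} (h : V' ≤ V) (h' : O' ≤ O) :
    box V' O' ≤ box V O := fun _ hp => ⟨h hp.1, h' hp.2⟩

lemma exists_box_le (W : Opens (Cyl Y)) (y : Y) (t : unitInterval) (h : (y, t) ∈ W) :
    ∃ (V : Opens Y) (O : Opens unitInterval), y ∈ V ∧ t ∈ O ∧ box V O ≤ W := by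
  obtain ⟨V, O, hV, hO, hy, ht, hW⟩ := isOpen_prod_iff.1 W.isOpen y t h
  exact ⟨⟨V, hV⟩, ⟨O, hO⟩, hy, ht, fun p hp => hW ⟨hp.1, hp.2⟩⟩

variable {K : CochainComplex (Sh k Y) ℤ} {J : CochainComplex (Sh k (Cyl Y)) ℤ}
  (p : ∀ (m : ℤ) (V : Opens Y), Sec (K.X m) V →ₗ[k] Sec (J.X m) ((Opens.map (cylProj Y)).obj V))

/-- The difference between `α` and the inverse image of `s`. -/
def cylDiff {m : ℤ} {U : Opens (Cyl Y)} (α : Sec (J.X m) U) {V : Opens Y} (s : Sec (K.X m) V) :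
    Sec (J.X m) (U ⊓ (Opens.map (cylProj Y)).obj V) :=
  res _ inf_le_left α - res _ inf_le_right (p m V s)

variable {p} (hp : IsDerivedPullSec p)
include hp

lemma isBoundaryOn_cylDiff_res {m : ℤ} {U : Opens (Cyl Y)} {α : Sec (J.X m) U} {V V' : Opens Y}
    (hV : V' ≤ V) {O O' : Opens unitInterval} (hO : O' ≤ O) {s : Sec (K.X m) V}
    (h : IsBoundaryOn J (cylDiff p α s) (box V O)) :
    IsBoundaryOn J (cylDiff p α (res _ hV s)) (box V' O') := by
  obtain ⟨hb, β, hβ⟩ := h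
  refine ⟨le_inf ((box_mono hV hO).trans (hb.trans inf_le_left)) (box_le _ _),
    res _ (box_mono hV hO) β, ?_⟩
  rw [secMap_res, hβ]
  simp only [cylDiff, map_sub, res_res, ← hp.res_apply]

/-- Near each point of the cylinder, a cocycle is the sum of a cocycle of the base and of a
boundary. -/
lemma exists_isBoundaryOn_cylDiff {m : ℤ} {U : Opens (Cyl Y)} {α : Sec (J.X m) U}
    (hα : IsCocycle J α) (y : Y) (t : unitInterval) (hyt : (y, t) ∈ U) :
    ∃ (V : Opens Y) (O : Opens unitInterval) (s : Sec (K.X m) V), y ∈ V ∧ t ∈ O ∧ IsCocycle K s ∧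
      IsBoundaryOn J (cylDiff p α s) (box V O) := by
  obtain ⟨V, s, W, hW, hWV, β, hx, hs, h⟩ := hp.exists_eq_add α hα (y, t) hyt
  obtain ⟨V', O, hy, ht, hb⟩ := exists_box_le W y t hx
  have hb' : box (V ⊓ V') O ≤ W := (box_mono inf_le_right le_rfl).trans hb
  refine ⟨V ⊓ V', O, res _ inf_le_left s, ⟨hWV hx, hy⟩, ht, hs.res _,
    le_inf (hb'.trans hW) (box_le _ _), res _ hb' β, ?_⟩
  have h' := congrArg (res _ hb') h
  rw [res_res, map_add, res_res, ← secMap_res] at h'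
  rw [cylDiff, map_sub, res_res, res_res, ← hp.res_apply, res_res, h', add_sub_cancel_left]

/-- Cocycles of the base with the same image at a point of the cylinder agree near its
projection. -/
lemma exists_isBoundaryOn_cylDiff_left {m : ℤ} {U : Opens (Cyl Y)} {α : Sec (J.X m) U}
    {V : Opens Y} {O₁ O₂ : Opens unitInterval} {s₁ s₂ : Sec (K.X m) V} (hs₁ : IsCocycle K s₁)
    (hs₂ : IsCocycle K s₂) (h₁ : IsBoundaryOn J (cylDiff p α s₁) (box V O₁))
    (h₂ : IsBoundaryOn J (cylDiff p α s₂) (box V O₂)) (y : Y) (hy : y ∈ V) (t : unitInterval)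
    (ht₁ : t ∈ O₁) (ht₂ : t ∈ O₂) :
    ∃ (V' : Opens Y) (hV' : V' ≤ V), y ∈ V' ∧
      IsBoundaryOn J (cylDiff p α (res _ hV' s₁)) (box V' O₂) := by
  obtain ⟨hb₁, β₁, hβ₁⟩ := h₁
  obtain ⟨hb₂, β₂, hβ₂⟩ := h₂
  have hi₁ : box V (O₁ ⊓ O₂) ≤ box V O₁ := box_mono le_rfl inf_le_left
  have hi₂ : box V (O₁ ⊓ O₂) ≤ box V O₂ := box_mono le_rfl inf_le_right
  obtain ⟨V', hy', hV', σ, hσ⟩ := hp.exists_isBoundaryOn (s₁ - s₂)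
    (by rw [IsCocycle, map_sub, show secMap _ V s₁ = 0 from hs₁, show secMap _ V s₂ = 0 from hs₂,
      sub_zero]) (box_le V (O₁ ⊓ O₂)) (res _ hi₂ β₂ - res _ hi₁ β₁) (by
    rw [map_sub, map_sub, map_sub, secMap_res, secMap_res, hβ₁, hβ₂]
    simp only [cylDiff, map_sub, res_res]
    abel) (y, t) ⟨hy, ht₁, ht₂⟩
  have hb' : box V' O₂ ≤ box V O₂ := box_mono hV' le_rfl
  refine ⟨V', hV', hy', le_inf (hb'.trans (hb₂.trans inf_le_left)) (box_le _ _),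
    res _ hb' β₂ - res _ (box_le _ _) (p (m - 1) V' σ), ?_⟩
  rw [map_sub, secMap_res, hβ₂, secMap_res, hp.d_apply, hσ]
  simp only [cylDiff, map_sub, res_res, ← hp.res_apply]
  abel

/-- Primitives on the boxes over `O₁` and `O₂` can be glued, after shrinking. -/
lemma exists_isBoundaryOn_sup (hJ : IsFlasqueComplex J) {m : ℤ} {U : Opens (Cyl Y)}
    {α : Sec (J.X m) U} {V : Opens Y} {O₁ O₂ : Opens unitInterval} {s : Sec (K.X m) V}
    (h₁ : IsBoundaryOn J (cylDiff p α s) (box V O₁))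
    (h₂ : IsBoundaryOn J (cylDiff p α s) (box V O₂)) (y : Y) (hy : y ∈ V) (t : unitInterval)
    (ht₁ : t ∈ O₁) (ht₂ : t ∈ O₂) :
    ∃ (V' : Opens Y) (hV' : V' ≤ V) (O : Opens unitInterval), y ∈ V' ∧ t ∈ O ∧
      ∀ O₁' O₂' : Opens unitInterval, O₁' ≤ O₁ → O₂' ≤ O₂ → O₁' ⊓ O₂' ≤ O →
        IsBoundaryOn J (cylDiff p α (res _ hV' s)) (box V' (O₁' ⊔ O₂')) := by
  obtain ⟨hb₁, β₁, hβ₁⟩ := h₁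
  obtain ⟨hb₂, β₂, hβ₂⟩ := h₂
  have hi₁ : box V (O₁ ⊓ O₂) ≤ box V O₁ := box_mono le_rfl inf_le_left
  have hi₂ : box V (O₁ ⊓ O₂) ≤ box V O₂ := box_mono le_rfl inf_le_right
  have hδ : IsCocycle J (res _ hi₁ β₁ - res _ hi₂ β₂) :=
    isCocycle_sub hb₁ hb₂ hi₁ hi₂ β₁ β₂ hβ₁ hβ₂
  -- The difference of the primitives is a cocycle near `(y, t)`, that is, a cocycle `s₃` of the
  -- base up to a boundary; as the inverse image of `s₃` is defined over all of `O₂`, it can be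
  -- added to `β₂`.
  obtain ⟨V₃, O, s₃, hy₃, ht, hs₃, hb, γ, hγ⟩ :=
    exists_isBoundaryOn_cylDiff hp hδ y t ⟨hy, ht₁, ht₂⟩
  have hbU : box V₃ O ≤ box V (O₁ ⊓ O₂) := hb.trans inf_le_left
  refine ⟨V ⊓ V₃, inf_le_left, O, ⟨hy, hy₃⟩, ht, fun O₁' O₂' hO₁ hO₂ hO => ?_⟩
  have hc₁ : box (V ⊓ V₃) O₁' ≤ box V O₁ := box_mono inf_le_left hO₁
  have hc₂ : box (V ⊓ V₃) O₂' ≤ box V O₂ := box_mono inf_le_left hO₂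
  have hc₃ : box (V ⊓ V₃) O₂' ≤ (Opens.map (cylProj Y)).obj V₃ :=
    fun q hq => hq.1.2
  have hl : box (V ⊓ V₃) (O₁' ⊓ O₂') ≤ box V₃ O := box_mono inf_le_right hO
  let β₂' := res _ hc₂ β₂ + res _ hc₃ (p (m - 1) V₃ s₃)
  have hdβ₂' : secMap (J.d (m - 1) m) _ β₂' = res _ (hc₂.trans hb₂) (cylDiff p α s) := by
    rw [map_add, secMap_res, hβ₂, secMap_res, hp.d_apply,
      show secMap (K.d (m - 1) m) V₃ s₃ = 0 by
        have := hs₃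
        rw [IsCocycle, sub_add_cancel] at this
        exact this, map_zero, map_zero, add_zero, res_res]
  obtain ⟨β₁', hβ₁', heq⟩ := exists_primitive_eq_on (l := m) hJ
    (O := box (V ⊓ V₃) (O₁' ⊓ O₂')) (box_mono le_rfl inf_le_left) (box_mono le_rfl inf_le_right)
    (res _ hc₁ β₁) β₂' ⟨le_rfl, res _ hl γ, by
      rw [secMap_res, hγ, res_self]
      simp only [cylDiff, β₂', map_sub, map_add, res_res]
      abel⟩
  have hsup := isBoundaryOn_sup (J := J) (α := cylDiff p α s) (hc₁.trans hb₁) (hc₂.trans hb₂)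
    β₁' β₂' (by rw [hβ₁', secMap_res, hβ₁, res_res]) hdβ₂' (by
      have hle : box (V ⊓ V₃) O₁' ⊓ box (V ⊓ V₃) O₂' ≤ box (V ⊓ V₃) (O₁' ⊓ O₂') :=
        fun q hq => ⟨hq.1.1, hq.1.2, hq.2.2⟩
      have := congrArg (res _ hle) heq
      rwa [res_res, res_res] at this)
  have hle : box (V ⊓ V₃) (O₁' ⊔ O₂') ≤ box (V ⊓ V₃) O₁' ⊔ box (V ⊓ V₃) O₂' := by
    rintro q ⟨hq, hq' | hq'⟩
    · exact Or.inl ⟨hq, hq'⟩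
    · exact Or.inr ⟨hq, hq'⟩
  obtain ⟨hle', β, hβ⟩ := hsup.mono hle
  refine ⟨le_inf (hle'.trans inf_le_left) (box_le _ _), β, ?_⟩
  rw [hβ]
  simp only [cylDiff, map_sub, res_res, ← hp.res_apply]

/-- A cocycle near a fibre of the cylinder is the sum of a cocycle of the base and of a boundary. -/
lemma exists_isBoundaryOn_cylDiff_top (hJ : IsFlasqueComplex J) {m : ℤ} {U : Opens (Cyl Y)}
    {α : Sec (J.X m) U} (hα : IsCocycle J α) (y : Y) (hy : ∀ t : unitInterval, (y, t) ∈ U) :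
    ∃ (V : Opens Y) (s : Sec (K.X m) V), y ∈ V ∧ IsCocycle K s ∧
      IsBoundaryOn J (cylDiff p α s) (box V ⊤) := by
  choose V O s hyV htO hs hb using
    fun t => exists_isBoundaryOn_cylDiff hp hα y t (hy t)
  -- The fibre `{y} × [0, 1]` is covered by a finite chain of boxes, and the cocycles of the base
  -- are compared along this chain.
  obtain ⟨t, ht0, htm, ⟨n, hn⟩, htc⟩ :=
    exists_monotone_Icc_subset_open_cover_unitInterval (c := fun t => (O t : Set unitInterval))
      (fun t => (O t).isOpen) (fun t _ => Set.mem_iUnion.2 ⟨t, htO t⟩)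
  have key (i : ℕ) : ∃ (V : Opens Y) (O : Opens unitInterval) (s : Sec (K.X m) V), y ∈ V ∧
      Set.Icc 0 (t i) ⊆ O ∧ IsCocycle K s ∧ IsBoundaryOn J (cylDiff p α s) (box V O) := by
    induction i with
    | zero =>
      refine ⟨V 0, O 0, s 0, hyV 0, ?_, hs 0, hb 0⟩
      rw [ht0, Set.Icc_self, Set.singleton_subset_iff]
      exact htO 0
    | succ i ih =>
      obtain ⟨V₁, O₁, s₁, hy₁, hO₁, hs₁, hb₁⟩ := ih
      obtain ⟨l, hl⟩ := htc i
      have hti₁ : t i ∈ O₁ := hO₁ ⟨unitInterval.nonneg', le_rfl⟩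
      have hti₂ : t i ∈ O l := hl ⟨le_rfl, htm (Nat.le_succ i)⟩
      obtain ⟨V', hV', hy', hb'⟩ := exists_isBoundaryOn_cylDiff_left hp
        (hs₁.res (inf_le_left : V₁ ⊓ V l ≤ V₁)) ((hs l).res inf_le_right)
        (isBoundaryOn_cylDiff_res hp inf_le_left le_rfl hb₁)
        (isBoundaryOn_cylDiff_res hp inf_le_right le_rfl (hb l)) y ⟨hy₁, hyV l⟩ (t i) hti₁ hti₂
      rw [res_res] at hb'
      obtain ⟨V₃, hV₃, O₃, hy₃, ht₃, h₃⟩ := exists_isBoundaryOn_sup hp hJ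
        (isBoundaryOn_cylDiff_res hp (hV'.trans inf_le_left) le_rfl hb₁) hb' y hy' (t i)
        hti₁ hti₂
      let A : Opens unitInterval := ⟨Set.Iio (t i), isOpen_Iio⟩
      let B : Opens unitInterval := ⟨Set.Ioi (t i), isOpen_Ioi⟩
      refine ⟨V₃, O₁ ⊓ (A ⊔ O₃) ⊔ O l ⊓ (B ⊔ O₃), _, hy₃, fun x hx => ?_, (hs₁.res _).res _,
        h₃ _ _ inf_le_left inf_le_left ?_⟩
      · rcases lt_trichotomy x (t i) with h | h | h
        · exact Or.inl ⟨hO₁ ⟨hx.1, h.le⟩, Or.inl h⟩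
        · exact Or.inl ⟨hO₁ ⟨hx.1, h.le⟩, Or.inr (h ▸ ht₃)⟩
        · exact Or.inr ⟨hl ⟨h.le, hx.2⟩, Or.inl h⟩
      · rintro x ⟨⟨-, hx | hx⟩, ⟨-, hx' | hx'⟩⟩
        · exact absurd (lt_trans (show x < t i from hx) hx') (lt_irrefl _)
        all_goals assumption
  obtain ⟨V, O, s, hyV, hO, hs, hb⟩ := key n
  rw [hn n le_rfl] at hO
  have : O = ⊤ := top_le_iff.1 fun x _ => hO ⟨unitInterval.nonneg', unitInterval.le_one'⟩
  subst this
  exact ⟨V, s, hyV, hs, hb⟩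

/-- Reformulation of `exists_isBoundaryOn_cylDiff_top` on the open sets on which both terms of the
difference are defined. -/
lemma exists_res_eq_add_of_fibre (hJ : IsFlasqueComplex J) {m : ℤ} {U : Opens (Cyl Y)}
    (α : Sec (J.X m) U) (hα : IsCocycle J α) (y : Y) (hy : ∀ t : unitInterval, (y, t) ∈ U) :
    ∃ (V : Opens Y) (s : Sec (K.X m) V), y ∈ V ∧ IsCocycle K s ∧
      ∀ (W : Opens (Cyl Y)) (hU : W ≤ U) (hV : W ≤ (Opens.map (cylProj Y)).obj V),
        ∃ β : Sec (J.X (m - 1)) W,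
          res _ hU α = res _ hV (p m V s) + secMap (J.d (m - 1) m) W β := by
  obtain ⟨V, s, hyV, hs, hb, β, hβ⟩ := exists_isBoundaryOn_cylDiff_top hp hJ hα y hy
  refine ⟨V, s, hyV, hs, fun W hU hV =>
    ⟨res _ (show W ≤ box V ⊤ from fun q hq => ⟨hV hq, trivial⟩) β, ?_⟩⟩
  rw [secMap_res, hβ, cylDiff, map_sub, map_sub, res_res, res_res, res_res, res_res,
    add_sub_cancel]

/-- A morphism `K ⟶ pr_* J` which identifies `J` with the inverse image of `K`, up to
quasi-isomorphism, is a quasi-isomorphism. -/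
lemma quasiIso_cylProj (hJ : IsFlasqueComplex J) (f : K ⟶ (pushComplex k (cylProj Y)).obj J)
    (hf : ∀ (m : ℤ) (V : Opens Y) (s : Sec (K.X m) V), secMap (f.f m) V s = p m V s) :
    QuasiIso f := by
  rw [quasiIso_iff]
  intro m
  rw [quasiIsoAt_iff_isIso_homologyMap]
  have h₁ : Mono (HomologicalComplex.homologyMap f m) := by
    refine mono_homologyMap_of_local f m fun V s r hs h y hy => ?_
    obtain ⟨V', hy', hV', t, ht⟩ := hp.exists_isBoundaryOn s hs
      (W := (Opens.map (cylProj Y)).obj V) le_rfl r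
      ((res_self _ _).trans ((hf m V s).symm.trans h)) (y, 0) hy
    exact ⟨V', hV', hy', t, ht.symm⟩
  have h₂ : Epi (HomologicalComplex.homologyMap f m) := by
    refine epi_homologyMap_of_local f m fun V α hα y hy => ?_
    obtain ⟨V', s, hy', hs, h⟩ := exists_res_eq_add_of_fibre hp hJ
      (U := (Opens.map (cylProj Y)).obj V) α hα y (fun t => hy)
    obtain ⟨β, hβ⟩ := h ((Opens.map (cylProj Y)).obj (V' ⊓ V)) (fun q hq => hq.2)
      (fun q hq => hq.1)
    refine ⟨V' ⊓ V, inf_le_right, ⟨hy', hy⟩, res _ inf_le_left s, β, hs.res _, ?_⟩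
    rw [hf]
    exact hβ.trans (congrArg (· + _) (hp.res_apply inf_le_left s))
  exact isIso_of_mono_of_epi _

omit hp in
/-- The inverse image functor by the projection of a cylinder is full: the unit `A ⟶ Rpr_* pr⁻¹ A`
is an isomorphism. -/
instance full_pull_cylProj : (pull k (cylProj Y)).Full where
  map_surjective {A B} Γ := by
    let adj := TopCat.Sheaf.pullbackPushforwardAdjunction (ModuleCat.{u} k) (cylProj Y)
    obtain ⟨J, n, -, _, _, -, ⟨e⟩⟩ := exists_injective_resolution ((pull k (cylProj Y)).obj B)
    have := CochainComplex.isKInjective_of_injective J n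
    have := isKInjective_pushComplex (cylProj Y) J n
    obtain ⟨K, ⟨eK⟩⟩ : ∃ K, Nonempty (DerivedCategory.Q.obj K ≅ B.obj) :=
      ⟨_, ⟨DerivedCategory.Q.objObjPreimageIso B.obj⟩⟩
    let F := TopCat.Sheaf.pullback (ModuleCat.{u} k) (cylProj Y)
    let Γ' : F.mapDerivedCategory.obj A.obj ⟶ F.mapDerivedCategory.obj B.obj := Γ.hom
    let e' : F.mapDerivedCategory.obj B.obj ≅ DerivedCategory.Q.obj J := e.symm
    obtain ⟨g, hg⟩ := exists_Q_map_eq_of_isKInjective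
      (F.mapDerivedCategoryFactors.inv.app K ≫ F.mapDerivedCategory.map eK.hom ≫ e'.hom)
    have hiso : IsIso (DerivedCategory.Q.map g) := by
      rw [hg]
      infer_instance
    have hqg : QuasiIso g := (DerivedCategory.isIso_Q_map_iff_quasiIso _ g).1 hiso
    let f : K ⟶ (pushComplex k (cylProj Y)).obj J :=
      unitComplex adj K ≫ (pushComplex k (cylProj Y)).map g
    have hqf : QuasiIso f := quasiIso_cylProj
      ((isPullSec_pullComplex (cylProj Y) K).comp_quasiIso g) (isFlasqueComplex_of_injective J) f
      (fun m V s => rfl)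
    have hif : IsIso (DerivedCategory.Q.map f) :=
      (DerivedCategory.isIso_Q_map_iff_quasiIso _ f).2 hqf
    have hfg : F.mapDerivedCategory.map (DerivedCategory.Q.map f) ≫ derivedCounit adj J =
        F.mapDerivedCategory.map eK.hom ≫ e'.hom := by
      rw [derivedCounit, F.mapDerivedCategoryFactors_hom_naturality_assoc, ← Functor.map_comp]
      have : (F.mapHomologicalComplex (.up ℤ)).map f ≫ counitComplex adj J = g := by
        ext i
        exact map_comp_comp_counit adj (g.f i)
      rw [this, hg, Iso.hom_inv_id_app_assoc]
    obtain ⟨a, ha⟩ := (derivedCounit_bijective adj J A.obj).surjective (Γ.hom ≫ e'.hom)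
    refine ⟨ObjectProperty.homMk (a ≫ inv (DerivedCategory.Q.map f) ≫ eK.hom), ?_⟩
    -- The unit `B ⟶ Rpr_* pr⁻¹ B` is represented by `f`, so its inverse turns the morphism `a` that
    -- corresponds to `Γ` by adjunction into a preimage of `Γ`.
    have hinv : F.mapDerivedCategory.map (inv (DerivedCategory.Q.map f)) ≫
        F.mapDerivedCategory.map (DerivedCategory.Q.map f) ≫ derivedCounit adj J =
          derivedCounit adj J := by
      rw [← Functor.map_comp_assoc, IsIso.inv_hom_id, CategoryTheory.Functor.map_id,
        Category.id_comp]
    apply DerivedCategory.Bounded.ι.map_injective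
    change F.mapDerivedCategory.map (a ≫ inv (DerivedCategory.Q.map f) ≫ eK.hom) = Γ'
    rw [← cancel_mono e'.hom, Functor.map_comp, Functor.map_comp, Category.assoc, Category.assoc,
      ← hfg, hinv]
    exact ha

end Cylinder

/-! ### Coherence of inverse images -/

open Opposite

section DerivedFunctors

variable {C₁ C₂ C₃ : Type (u + 1)} [Category.{u} C₁] [Category.{u} C₂] [Category.{u} C₃]
  [Abelian C₁] [Abelian C₂] [Abelian C₃]
  [HasDerivedCategory.{u+1} C₁] [HasDerivedCategory.{u+1} C₂] [HasDerivedCategory.{u+1} C₃]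

lemma liftIso_hom_app {A : Type*} [Category* A] {F G : A ⥤ DerivedCategory.Bounded C₁}
    (e : F ⋙ DerivedCategory.Bounded.ι ≅ G ⋙ DerivedCategory.Bounded.ι) (X : A) :
    ((liftIso e).hom.app X).hom = e.hom.app X := by
  have h : Functor.whiskerRight (liftIso e).hom
      (DerivedCategory.TStructure.t.bounded (C := DerivedCategory C₁)).ι = e.hom :=
    Functor.FullyFaithful.map_preimage ((DerivedCategory.TStructure.t.bounded
      (C := DerivedCategory C₁)).fullyFaithfulι.whiskeringRight A) e.hom
  exact congrArg (fun φ : F ⋙ DerivedCategory.Bounded.ι ⟶ G ⋙ DerivedCategory.Bounded.ι =>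
    φ.app X) h

section

variable (L L' : C₁ ⥤ C₂) [L.Additive] [PreservesFiniteLimits L] [PreservesFiniteColimits L]
  [L'.Additive] [PreservesFiniteLimits L'] [PreservesFiniteColimits L']
  {K : CochainComplex C₁ ℤ}

/-- The morphism `L K ⟶ L X` induced by a morphism `e : K ⟶ X` from a complex to an object of the
derived category, where `L` is an exact functor. -/
def reprD {X : DerivedCategory C₁} (e : DerivedCategory.Q.obj K ⟶ X) :
    DerivedCategory.Q.obj ((L.mapHomologicalComplex (.up ℤ)).obj K) ⟶
      L.mapDerivedCategory.obj X :=
  L.mapDerivedCategoryFactors.inv.app K ≫ L.mapDerivedCategory.map e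

instance {X : DerivedCategory C₁} (e : DerivedCategory.Q.obj K ⟶ X) [IsIso e] :
    IsIso (reprD L e) := by
  rw [reprD]
  infer_instance

lemma reprD_comp {X Y : DerivedCategory C₁} (e : DerivedCategory.Q.obj K ⟶ X) (f : X ⟶ Y) :
    reprD L (e ≫ f) = reprD L e ≫ L.mapDerivedCategory.map f := by
  rw [reprD, reprD, Functor.map_comp, Category.assoc]

lemma reprD_map_comp {X : DerivedCategory C₁} {K' : CochainComplex C₁ ℤ} (a : K' ⟶ K)
    (e : DerivedCategory.Q.obj K ⟶ X) :
    reprD L (DerivedCategory.Q.map a ≫ e) =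
      DerivedCategory.Q.map ((L.mapHomologicalComplex (.up ℤ)).map a) ≫ reprD L e := by
  have := L.mapDerivedCategoryFactors.inv.naturality a
  dsimp at this
  rw [reprD, reprD, Functor.map_comp, reassoc_of% this]

variable {X Y : DerivedCategory.Bounded C₁}

/-- The morphism `L K ⟶ L X` induced by a morphism `e : K ⟶ X` from a complex to an object of the
bounded derived category, where `L` is an exact functor. -/
def repr (e : DerivedCategory.Q.obj K ⟶ X.obj) :
    DerivedCategory.Q.obj ((L.mapHomologicalComplex (.up ℤ)).obj K) ⟶ ((dbMap L).obj X).obj :=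
  reprD L e

instance (e : DerivedCategory.Q.obj K ⟶ X.obj) [IsIso e] : IsIso (repr L e) :=
  inferInstanceAs (IsIso (reprD L e))

lemma repr_comp (e : DerivedCategory.Q.obj K ⟶ X.obj) (f : X ⟶ Y) :
    repr L (e ≫ f.hom) = repr L e ≫ ((dbMap L).map f).hom :=
  reprD_comp L e f.hom

lemma repr_map_comp {K' : CochainComplex C₁ ℤ} (a : K' ⟶ K)
    (e : DerivedCategory.Q.obj K ⟶ X.obj) :
    repr L (DerivedCategory.Q.map a ≫ e) =
      DerivedCategory.Q.map ((L.mapHomologicalComplex (.up ℤ)).map a) ≫ repr L e :=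
  reprD_map_comp L a e

variable {L L'} in
/-- On complexes, the isomorphism of derived functors induced by `α` is `α` termwise. -/
lemma repr_comp_dbMapIso (α : L ≅ L') (e : DerivedCategory.Q.obj K ⟶ X.obj) :
    repr L e ≫ ((dbMapIso α).hom.app X).hom =
      DerivedCategory.Q.map ((NatTrans.mapHomologicalComplex α.hom (.up ℤ)).app K) ≫
        repr L' e := by
  let β := Localization.liftNatIso DerivedCategory.Q
      (HomologicalComplex.quasiIso C₁ (ComplexShape.up ℤ))
      (L.mapHomologicalComplex (ComplexShape.up ℤ) ⋙ DerivedCategory.Q)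
      (L'.mapHomologicalComplex (ComplexShape.up ℤ) ⋙ DerivedCategory.Q)
      L.mapDerivedCategory L'.mapDerivedCategory
      (Functor.isoWhiskerRight (NatIso.mapHomologicalComplex α _) DerivedCategory.Q)
  have h' : β.hom.app (DerivedCategory.Q.obj K) =
      L.mapDerivedCategoryFactors.hom.app K ≫ DerivedCategory.Q.map
        ((NatTrans.mapHomologicalComplex α.hom (.up ℤ)).app K) ≫
        L'.mapDerivedCategoryFactors.inv.app K :=
    Localization.liftNatTrans_app _ _ _ _ _ _ _ _
  have key : reprD L e ≫ β.hom.app X.obj = DerivedCategory.Q.map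
      ((NatTrans.mapHomologicalComplex α.hom (.up ℤ)).app K) ≫ reprD L' e := by
    rw [reprD, reprD, Category.assoc, β.hom.naturality, h']
    simp
  exact (congrArg (reprD L e ≫ ·) (liftIso_hom_app _ X)).trans key

end

/-- On complexes, the isomorphism of the derived functor of the identity with the identity is the
identity. -/
lemma repr_comp_dbMapId {K : CochainComplex C₁ ℤ} {X : DerivedCategory.Bounded C₁}
    (e : DerivedCategory.Q.obj K ⟶ X.obj) :
    repr (𝟭 C₁) e ≫ (dbMapId.hom.app X).hom =
      DerivedCategory.Q.map ((Functor.mapHomologicalComplexIdIso C₁ (.up ℤ)).hom.app K) ≫ e := by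
  let β := Localization.liftNatIso DerivedCategory.Q
      (HomologicalComplex.quasiIso C₁ (ComplexShape.up ℤ))
      ((𝟭 C₁).mapHomologicalComplex (ComplexShape.up ℤ) ⋙ DerivedCategory.Q)
      DerivedCategory.Q
      (𝟭 C₁).mapDerivedCategory (𝟭 _)
      (Functor.isoWhiskerRight (Functor.mapHomologicalComplexIdIso _ _) DerivedCategory.Q)
  have h' : β.hom.app (DerivedCategory.Q.obj K) =
      (𝟭 C₁).mapDerivedCategoryFactors.hom.app K ≫ DerivedCategory.Q.map
        ((Functor.mapHomologicalComplexIdIso C₁ (.up ℤ)).hom.app K) :=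
    (Localization.liftNatTrans_app _ _ _ _ _ _ _ _).trans (by
      refine congrArg ((𝟭 C₁).mapDerivedCategoryFactors.hom.app K ≫ ·) ?_
      exact Category.comp_id _)
  have key : reprD (𝟭 C₁) e ≫ β.hom.app X.obj =
      DerivedCategory.Q.map ((Functor.mapHomologicalComplexIdIso C₁ (.up ℤ)).hom.app K) ≫ e := by
    rw [reprD, Category.assoc, β.hom.naturality, h']
    exact (congrArg _ (Category.assoc _ _ _)).trans
      (((𝟭 C₁).mapDerivedCategoryFactors.app K).inv_hom_id_assoc _)
  exact (congrArg (reprD (𝟭 C₁) e ≫ ·) (liftIso_hom_app _ X)).trans key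

/-- On complexes, the isomorphism of the derived functor of a composition with the composition of
the derived functors is the identity. -/
lemma repr_comp_dbMapComp (F : C₁ ⥤ C₂) [F.Additive] [PreservesFiniteLimits F]
    [PreservesFiniteColimits F] (G : C₂ ⥤ C₃) [G.Additive] [PreservesFiniteLimits G]
    [PreservesFiniteColimits G] [(F ⋙ G).Additive] [PreservesFiniteLimits (F ⋙ G)]
    [PreservesFiniteColimits (F ⋙ G)] {K : CochainComplex C₁ ℤ} {X : DerivedCategory.Bounded C₁}
    (e : DerivedCategory.Q.obj K ⟶ X.obj) :
    repr (F ⋙ G) e ≫ ((dbMapComp F G).hom.app X).hom =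
      repr (X := (dbMap F).obj X) G (repr F e) := by
  let : Localization.Lifting DerivedCategory.Q (HomologicalComplex.quasiIso C₁ (.up ℤ))
      ((F ⋙ G).mapHomologicalComplex (ComplexShape.up ℤ) ⋙ DerivedCategory.Q)
      (F.mapDerivedCategory ⋙ G.mapDerivedCategory) :=
    ⟨Functor.isoWhiskerRight F.mapDerivedCategoryFactors G.mapDerivedCategory ≪≫
        Functor.isoWhiskerLeft (F.mapHomologicalComplex (ComplexShape.up ℤ))
          G.mapDerivedCategoryFactors⟩
  let β := Localization.liftNatIso DerivedCategory.Q
      (HomologicalComplex.quasiIso C₁ (ComplexShape.up ℤ))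
      ((F ⋙ G).mapHomologicalComplex (ComplexShape.up ℤ) ⋙ DerivedCategory.Q)
      ((F ⋙ G).mapHomologicalComplex (ComplexShape.up ℤ) ⋙ DerivedCategory.Q)
      (F ⋙ G).mapDerivedCategory (F.mapDerivedCategory ⋙ G.mapDerivedCategory) (Iso.refl _)
  have h' : β.hom.app (DerivedCategory.Q.obj K) =
      (F ⋙ G).mapDerivedCategoryFactors.hom.app K ≫ 𝟙 _ ≫
        (G.mapDerivedCategoryFactors.inv.app ((F.mapHomologicalComplex (ComplexShape.up ℤ)).obj K) ≫
        G.mapDerivedCategory.map (F.mapDerivedCategoryFactors.inv.app K)) :=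
    Localization.liftNatTrans_app _ _ _ _ _ _ _ _
  have key : reprD (F ⋙ G) e ≫ β.hom.app X.obj = reprD G (reprD F e) := by
    rw [reprD, Category.assoc, β.hom.naturality, h', reprD, reprD]
    refine (congrArg _ (Category.assoc _ _ _)).trans
      ((((F ⋙ G).mapDerivedCategoryFactors.app K).inv_hom_id_assoc _).trans ?_)
    refine (congrArg (· ≫ G.mapDerivedCategory.map (F.mapDerivedCategory.map e))
      (Category.id_comp _)).trans ((Category.assoc _ _ _).trans ?_)
    exact congrArg (G.mapDerivedCategoryFactors.inv.app _ ≫ ·) (Functor.map_comp _ _ _).symm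
  exact (congrArg (reprD (F ⋙ G) e ≫ ·) (liftIso_hom_app _ X)).trans key

end DerivedFunctors

section Sheaves

variable {k : Type u} [CommRing k] {W X Y Z : TopCat.{u}}

/-- A morphism from an inverse image is determined by its values on inverse images of sections. -/
lemma pull_hom_ext (f : X ⟶ Y) {G : Sh k Y} {B : Sh k X}
    {φ ψ : (TopCat.Sheaf.pullback (ModuleCat.{u} k) f).obj G ⟶ B}
    (h : ∀ (V : Opens Y) (s : Sec G V),
      secMap φ _ (pullSec f G s) = secMap ψ _ (pullSec f G s)) : φ = ψ := by
  apply ((TopCat.Sheaf.pullbackPushforwardAdjunction (ModuleCat.{u} k) f).homEquiv _ _).injective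
  rw [Adjunction.homEquiv_unit, Adjunction.homEquiv_unit]
  apply CategoryTheory.Sheaf.hom_ext
  ext V s
  exact h V.unop s

lemma pull_pull_hom_ext (f : X ⟶ Y) (g : Y ⟶ Z) {G : Sh k Z} {B : Sh k X}
    {φ ψ : (TopCat.Sheaf.pullback (ModuleCat.{u} k) f).obj
      ((TopCat.Sheaf.pullback (ModuleCat.{u} k) g).obj G) ⟶ B}
    (h : ∀ (V : Opens Z) (s : Sec G V),
      secMap φ _ (pullSec f _ (pullSec g G s)) = secMap ψ _ (pullSec f _ (pullSec g G s))) :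
    φ = ψ := by
  apply ((TopCat.Sheaf.pullbackPushforwardAdjunction (ModuleCat.{u} k) f).homEquiv _ _).injective
  rw [Adjunction.homEquiv_unit, Adjunction.homEquiv_unit]
  exact pull_hom_ext g h

lemma unit_ofNatIsoRight_app {A B : Type*} [Category* A] [Category* B] {L : A ⥤ B} {R R' : B ⥤ A}
    (adj : L ⊣ R) (θ : R ≅ R') (G : A) :
    (adj.ofNatIsoRight θ).unit.app G = adj.unit.app G ≫ θ.hom.app (L.obj G) := by
  rw [← Adjunction.homEquiv_id, Adjunction.homEquiv_ofNatIsoRight_apply, Adjunction.homEquiv_id]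

/-- The isomorphism of a composition `f⁻¹ g⁻¹` with another left adjoint, on sections. -/
lemma secMap_leftAdjointUniq_comp (f : X ⟶ Y) (g : Y ⟶ Z) {L : Sh k Z ⥤ Sh k X}
    {R : Sh k X ⥤ Sh k Z} (adj : L ⊣ R)
    (θ : TopCat.Sheaf.pushforward (ModuleCat.{u} k) f ⋙
      TopCat.Sheaf.pushforward (ModuleCat.{u} k) g ≅ R) (G : Sh k Z) {V : Opens Z} (s : Sec G V) :
    secMap ((Adjunction.leftAdjointUniq
      ((TopCat.Sheaf.pullbackPushforwardAdjunction (ModuleCat.{u} k) g).comp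
        (TopCat.Sheaf.pullbackPushforwardAdjunction (ModuleCat.{u} k) f))
      (adj.ofNatIsoRight θ.symm)).hom.app G) _ (pullSec f _ (pullSec g G s)) =
      secMap (θ.inv.app (L.obj G)) V (secMap (adj.unit.app G) V s) := by
  have h := Adjunction.unit_leftAdjointUniq_hom_app
    ((TopCat.Sheaf.pullbackPushforwardAdjunction (ModuleCat.{u} k) g).comp
      (TopCat.Sheaf.pullbackPushforwardAdjunction (ModuleCat.{u} k) f))
    (adj.ofNatIsoRight θ.symm) G
  rw [Adjunction.comp_unit_app, unit_ofNatIsoRight_app] at h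
  exact congrArg (fun φ => secMap φ V s) h

/-- `f⁻¹ g⁻¹ = h⁻¹` for sheaves, if `h = g ∘ f`. -/
def sheafPullIso (f : X ⟶ Y) (g : Y ⟶ Z) {h : X ⟶ Z} (w : f ≫ g = h) :
    TopCat.Sheaf.pullback (ModuleCat.{u} k) g ⋙ TopCat.Sheaf.pullback (ModuleCat.{u} k) f ≅
      TopCat.Sheaf.pullback (ModuleCat.{u} k) h :=
  Adjunction.leftAdjointUniq
    ((TopCat.Sheaf.pullbackPushforwardAdjunction (ModuleCat.{u} k) g).comp
      (TopCat.Sheaf.pullbackPushforwardAdjunction (ModuleCat.{u} k) f))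
    ((TopCat.Sheaf.pullbackPushforwardAdjunction (ModuleCat.{u} k) h).ofNatIsoRight
      (pushforwardComp k w).symm)

lemma map_obj_map_obj_le {f : X ⟶ Y} {g : Y ⟶ Z} {h : X ⟶ Z} (w : f ≫ g = h) (V : Opens Z) :
    (Opens.map f).obj ((Opens.map g).obj V) ≤ (Opens.map h).obj V := by
  subst w
  exact le_rfl

lemma secMap_pushforwardComp_inv {f : X ⟶ Y} {g : Y ⟶ Z} {h : X ⟶ Z} (w : f ≫ g = h) (G : Sh k X)
    (V : Opens Z) (s : Sec G ((Opens.map h).obj V)) :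
    secMap ((pushforwardComp k w).inv.app G) V s = res G (map_obj_map_obj_le w V) s := by
  subst w
  exact (res_self G s).symm

/-- `sheafPullIso` is characterized by its effect on inverse images of sections. -/
lemma secMap_sheafPullIso (f : X ⟶ Y) (g : Y ⟶ Z) {h : X ⟶ Z} (w : f ≫ g = h) (G : Sh k Z)
    {V : Opens Z} (s : Sec G V) :
    secMap ((sheafPullIso f g w).hom.app G) _ (pullSec f _ (pullSec g G s)) =
      res _ (map_obj_map_obj_le w V) (pullSec h G s) :=
  (secMap_leftAdjointUniq_comp f g _ _ G s).trans (secMap_pushforwardComp_inv w _ V _)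

/-- `f⁻¹ = id` for sheaves, if `f = id`. -/
def sheafPullId {f : X ⟶ X} (hf : f = 𝟙 X) :
    TopCat.Sheaf.pullback (ModuleCat.{u} k) f ≅ 𝟭 _ :=
  Adjunction.leftAdjointUniq (TopCat.Sheaf.pullbackPushforwardAdjunction (ModuleCat.{u} k) f)
    (Adjunction.id.ofNatIsoRight (pushforwardId k hf).symm)

lemma map_obj_le {f : X ⟶ X} (hf : f = 𝟙 X) (V : Opens X) : (Opens.map f).obj V ≤ V := by
  subst hf
  exact le_rfl

lemma secMap_pushforwardId_inv {f : X ⟶ X} (hf : f = 𝟙 X) (G : Sh k X) (V : Opens X) (s : Sec G V) :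
    secMap ((pushforwardId k hf).inv.app G) V s = res G (map_obj_le hf V) s := by
  subst hf
  exact (res_self G s).symm

lemma secMap_sheafPullId {f : X ⟶ X} (hf : f = 𝟙 X) (G : Sh k X) {V : Opens X} (s : Sec G V) :
    secMap ((sheafPullId hf).hom.app G) _ (pullSec f G s) = res G (map_obj_le hf V) s := by
  have h := Adjunction.unit_leftAdjointUniq_hom_app
    (TopCat.Sheaf.pullbackPushforwardAdjunction (ModuleCat.{u} k) f)
    (Adjunction.id.ofNatIsoRight (pushforwardId k hf).symm) G
  rw [unit_ofNatIsoRight_app] at h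
  exact (congrArg (fun φ => secMap φ V s) h).trans (secMap_pushforwardId_inv hf G V s)

lemma pull_pull_pull_hom_ext (f : W ⟶ X) (g : X ⟶ Y) (h : Y ⟶ Z) {G : Sh k Z} {B : Sh k W}
    {φ ψ : (TopCat.Sheaf.pullback (ModuleCat.{u} k) f).obj
      ((TopCat.Sheaf.pullback (ModuleCat.{u} k) g).obj
        ((TopCat.Sheaf.pullback (ModuleCat.{u} k) h).obj G)) ⟶ B}
    (H : ∀ (V : Opens Z) (s : Sec G V),
      secMap φ _ (pullSec f _ (pullSec g _ (pullSec h G s))) =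
        secMap ψ _ (pullSec f _ (pullSec g _ (pullSec h G s)))) : φ = ψ := by
  apply ((TopCat.Sheaf.pullbackPushforwardAdjunction (ModuleCat.{u} k) f).homEquiv _ _).injective
  rw [Adjunction.homEquiv_unit, Adjunction.homEquiv_unit]
  exact pull_pull_hom_ext g h H

/-- Associativity of `sheafPullIso`. -/
lemma sheafPullIso_assoc (f : W ⟶ X) (g : X ⟶ Y) (h : Y ⟶ Z) {fg : W ⟶ Y} {gh : X ⟶ Z} {l : W ⟶ Z}
    (w₁ : f ≫ g = fg) (w₂ : g ≫ h = gh) (w₃ : f ≫ gh = l) (w₄ : fg ≫ h = l) (G : Sh k Z) :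
    (TopCat.Sheaf.pullback (ModuleCat.{u} k) f).map ((sheafPullIso g h w₂).hom.app G) ≫
      (sheafPullIso f gh w₃).hom.app G =
    (sheafPullIso f g w₁).hom.app ((TopCat.Sheaf.pullback (ModuleCat.{u} k) h).obj G) ≫
      (sheafPullIso fg h w₄).hom.app G := by
  subst w₁ w₂ w₃
  refine pull_pull_pull_hom_ext f g h fun V s => ?_
  have e₁ : secMap ((TopCat.Sheaf.pullback (ModuleCat.{u} k) f).map
      ((sheafPullIso g h rfl).hom.app G)) _ (pullSec f _ (pullSec g _ (pullSec h G s))) =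
      pullSec f _ (pullSec (g ≫ h) G s) :=
    (secMap_map_pullSec f _ _).trans (congrArg (pullSec f _)
      ((secMap_sheafPullIso g h rfl G s).trans (res_self _ _)))
  have e₂ : secMap ((sheafPullIso f g rfl).hom.app
      ((TopCat.Sheaf.pullback (ModuleCat.{u} k) h).obj G)) _
      (pullSec f _ (pullSec g _ (pullSec h G s))) = pullSec (f ≫ g) _ (pullSec h G s) :=
    (secMap_sheafPullIso f g rfl _ (pullSec h G s)).trans (res_self _ _)
  refine ((congrArg (secMap ((sheafPullIso f (g ≫ h) rfl).hom.app G) _) e₁).trans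
    (secMap_sheafPullIso f (g ≫ h) rfl G s)).trans ?_
  exact ((congrArg (secMap ((sheafPullIso (f ≫ g) h w₄).hom.app G) _) e₂).trans
    (secMap_sheafPullIso (f ≫ g) h w₄ G s)).symm

lemma sheafPullIso_map_id (f : X ⟶ Y) {i : Y ⟶ Y} (hi : i = 𝟙 Y) (w : f ≫ i = f) (G : Sh k Y) :
    (TopCat.Sheaf.pullback (ModuleCat.{u} k) f).map ((sheafPullId hi).hom.app G) =
      (sheafPullIso f i w).hom.app G := by
  subst hi
  refine pull_pull_hom_ext f (𝟙 Y) fun V s => ?_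
  refine ((secMap_map_pullSec f _ _).trans (congrArg (pullSec f _)
    ((secMap_sheafPullId rfl G s).trans (res_self _ _)))).trans ?_
  exact ((secMap_sheafPullIso f (𝟙 Y) w G s).trans (res_self _ _)).symm

lemma sheafPullIso_id_app {i : X ⟶ X} (hi : i = 𝟙 X) (f : X ⟶ Y) (w : i ≫ f = f) (G : Sh k Y) :
    (sheafPullIso i f w).hom.app G =
      (sheafPullId hi).hom.app ((TopCat.Sheaf.pullback (ModuleCat.{u} k) f).obj G) := by
  subst hi
  refine pull_pull_hom_ext (𝟙 X) f fun V s => ?_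
  refine ((secMap_sheafPullIso (𝟙 X) f w G s).trans (res_self _ _)).trans ?_
  exact ((secMap_sheafPullId rfl _ (pullSec f G s)).trans (res_self _ _)).symm

/-- The inverse image by the translation by `-e` is the direct image by the translation by `e`. -/
def sheafPullTr (k : Type u) [CommRing k] (M : Type u) [TopologicalSpace M] (e : ℝ) :
    TopCat.Sheaf.pullback (ModuleCat.{u} k) (translation M (-e)) ≅
      TopCat.Sheaf.pushforward (ModuleCat.{u} k) (translation M e) :=
  Adjunction.leftAdjointUniq
    (TopCat.Sheaf.pullbackPushforwardAdjunction (ModuleCat.{u} k) (translation M (-e)))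
    ((translationEquiv k M e).toAdjunction.ofNatIsoRight (Iso.refl _).symm)

/-- An isomorphism of `f⁻¹ g⁻¹` with a left adjoint `L` of the direct image by `h = g ∘ f` is the
composition of the isomorphisms of both with `h⁻¹`. -/
lemma leftAdjointUniq_comp_eq (f : X ⟶ Y) (g : Y ⟶ Z) {h : X ⟶ Z} (w : f ≫ g = h)
    {L : Sh k Z ⥤ Sh k X} {R : Sh k X ⥤ Sh k Z} (adj : L ⊣ R)
    (θ : TopCat.Sheaf.pushforward (ModuleCat.{u} k) h ≅ R) (G : Sh k Z) :
    (Adjunction.leftAdjointUniq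
      ((TopCat.Sheaf.pullbackPushforwardAdjunction (ModuleCat.{u} k) g).comp
        (TopCat.Sheaf.pullbackPushforwardAdjunction (ModuleCat.{u} k) f))
      (adj.ofNatIsoRight (pushforwardComp k w ≪≫ θ).symm)).hom.app G =
    (sheafPullIso f g w).hom.app G ≫ (Adjunction.leftAdjointUniq
      (TopCat.Sheaf.pullbackPushforwardAdjunction (ModuleCat.{u} k) h)
      (adj.ofNatIsoRight θ.symm)).hom.app G := by
  refine pull_pull_hom_ext f g fun V s => ?_
  have hu := Adjunction.unit_leftAdjointUniq_hom_app
    (TopCat.Sheaf.pullbackPushforwardAdjunction (ModuleCat.{u} k) h)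
    (adj.ofNatIsoRight θ.symm) G
  rw [unit_ofNatIsoRight_app] at hu
  generalize (Adjunction.leftAdjointUniq
    (TopCat.Sheaf.pullbackPushforwardAdjunction (ModuleCat.{u} k) h)
    (adj.ofNatIsoRight θ.symm)).hom.app G = φ at hu ⊢
  have hs : secMap φ _ (pullSec h G s) = secMap (θ.inv.app (L.obj G)) V
    (secMap (adj.unit.app G) V s) := congrArg (fun φ => secMap φ V s) hu
  have h₁ := secMap_leftAdjointUniq_comp f g adj (pushforwardComp k w ≪≫ θ) G s
  have h₂ : secMap ((pushforwardComp k w ≪≫ θ).inv.app (L.obj G)) V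
      (secMap (adj.unit.app G) V s) = res _ (map_obj_map_obj_le w V)
        (secMap (θ.inv.app (L.obj G)) V (secMap (adj.unit.app G) V s)) :=
    secMap_pushforwardComp_inv w _ V _
  have h₃ := congrArg (secMap φ _) (secMap_sheafPullIso f g w G s)
  have h₄ := secMap_res φ (map_obj_map_obj_le w V) (pullSec h G s)
  rw [hs] at h₄
  exact h₁.trans (h₂.trans (h₄.symm.trans (h₃.symm.trans (secMap_comp _ φ _ _).symm)))

end Sheaves

section Derived

variable (k : Type u) [CommRing k] {W X Y Z : TopCat.{u}}

/-- `f⁻¹ g⁻¹ = h⁻¹` on bounded derived categories, if `h = g ∘ f`. -/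
def pullIso (f : X ⟶ Y) (g : Y ⟶ Z) {h : X ⟶ Z} (w : f ≫ g = h) :
    pull k g ⋙ pull k f ≅ pull k h :=
  (dbMapComp _ _).symm ≪≫ dbMapIso (sheafPullIso f g w)

/-- `f⁻¹ = id` on bounded derived categories, if `f = id`. -/
def pullId {f : X ⟶ X} (hf : f = 𝟙 X) : pull k f ≅ 𝟭 _ :=
  dbMapIso (sheafPullId hf) ≪≫ dbMapId

/-- The inverse image by the translation by `-e` is the direct image by the translation by `e`. -/
def pullTr (M : Type u) [TopologicalSpace M] (e : ℝ) :
    pull k (translation M (-e)) ≅ Tr k M e :=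
  dbMapIso (sheafPullTr k M e)

variable {k}

/-- The morphism `f⁻¹ K ⟶ f⁻¹ A` induced by a morphism `e : K ⟶ A` from a complex. -/
abbrev pullRepr (f : X ⟶ Y) {K : CochainComplex (Sh k Y) ℤ} {A : Db k Y}
    (e : DerivedCategory.Q.obj K ⟶ A.obj) :
    DerivedCategory.Q.obj ((pullComplex k f).obj K) ⟶ ((pull k f).obj A).obj :=
  repr (TopCat.Sheaf.pullback (ModuleCat.{u} k) f) e

/-- The morphism of complexes induced by a natural transformation. -/
abbrev complexMap {A B : Type*} [Category* A] [Category* B] [Preadditive A] [Preadditive B]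
    {F G : A ⥤ B} [F.Additive] [G.Additive] (α : F ⟶ G) (K : CochainComplex A ℤ) :
    (F.mapHomologicalComplex (.up ℤ)).obj K ⟶ (G.mapHomologicalComplex (.up ℤ)).obj K :=
  (NatTrans.mapHomologicalComplex α (.up ℤ)).app K

lemma Db.hom_ext_of_epi {A B : Db k X} {K : CochainComplex (Sh k X) ℤ}
    (e : DerivedCategory.Q.obj K ⟶ A.obj) [Epi e] {φ ψ : A ⟶ B} (h : e ≫ φ.hom = e ≫ ψ.hom) :
    φ = ψ :=
  ObjectProperty.hom_ext _ ((cancel_epi e).1 h)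

lemma Db.exists_repr (A : Db k X) :
    ∃ (K : CochainComplex (Sh k X) ℤ) (e : DerivedCategory.Q.obj K ⟶ A.obj), IsIso e :=
  ⟨_, (DerivedCategory.Q.objObjPreimageIso A.obj).hom, inferInstance⟩

variable {K : CochainComplex (Sh k Z) ℤ} {A : Db k Z} (e : DerivedCategory.Q.obj K ⟶ A.obj)

lemma comp_eq_of_comp_eq {D : Type*} [Category* D] {A B C E : D} {r : A ⟶ B} {c : B ⟶ C}
    {c' : C ⟶ B} {p : A ⟶ C} {i : B ⟶ E} {q : A ⟶ E} (h₁ : r ≫ c = p) (h₂ : c ≫ c' = 𝟙 _)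
    (h₃ : r ≫ i = q) : p ≫ c' ≫ i = q := by
  rw [← h₁, Category.assoc, reassoc_of% h₂, h₃]

lemma comp_eq_of_comp_eq' {D : Type*} [Category* D] {A A' A'' B C E : D} {r : A ⟶ B} {c : B ⟶ C}
    {a : A ⟶ A'} {p : A' ⟶ C} {i : C ⟶ E} {a' : A' ⟶ A''} {q : A'' ⟶ E} (h₁ : r ≫ c = a ≫ p)
    (h₂ : p ≫ i = a' ≫ q) : r ≫ c ≫ i = (a ≫ a') ≫ q := by
  rw [reassoc_of% h₁, h₂, Category.assoc]

lemma pullRepr_pullIso (f : X ⟶ Y) (g : Y ⟶ Z) {h : X ⟶ Z} (w : f ≫ g = h) :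
    pullRepr f (pullRepr g e) ≫ ((pullIso k f g w).hom.app A).hom =
      DerivedCategory.Q.map (Y := (pullComplex k h).obj K)
        (complexMap (sheafPullIso f g w).hom K) ≫ pullRepr h e := by
  have h₁ := repr_comp_dbMapComp (TopCat.Sheaf.pullback (ModuleCat.{u} k) g)
    (TopCat.Sheaf.pullback (ModuleCat.{u} k) f) e
  have h₂ := repr_comp_dbMapIso (sheafPullIso (k := k) f g w) e
  have h₃ : ((dbMapComp (TopCat.Sheaf.pullback (ModuleCat.{u} k) g)
    (TopCat.Sheaf.pullback (ModuleCat.{u} k) f)).hom.app A).hom ≫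
    ((dbMapComp (TopCat.Sheaf.pullback (ModuleCat.{u} k) g)
    (TopCat.Sheaf.pullback (ModuleCat.{u} k) f)).inv.app A).hom = 𝟙 _ :=
    congrArg (·.hom) ((dbMapComp (TopCat.Sheaf.pullback (ModuleCat.{u} k) g)
      (TopCat.Sheaf.pullback (ModuleCat.{u} k) f)).hom_inv_id_app A)
  exact comp_eq_of_comp_eq h₁ h₃ h₂

lemma pullRepr_pullId {f : Z ⟶ Z} (hf : f = 𝟙 Z) :
    pullRepr f e ≫ ((pullId k hf).hom.app A).hom =
      DerivedCategory.Q.map (X := (pullComplex k f).obj K) (Y := K)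
        { f := fun i => (sheafPullId hf).hom.app (K.X i)
          comm' := fun i j _ => ((sheafPullId hf).hom.naturality (K.d i j)).symm } ≫ e := by
  have h₁ := repr_comp_dbMapIso (sheafPullId (k := k) hf) e
  have h₂ := repr_comp_dbMapId e
  refine (comp_eq_of_comp_eq' h₁ h₂).trans ?_
  rw [← Functor.map_comp]
  congr 2

lemma pullRepr_map (f : Y ⟶ Z) {B : Db k Z} (φ : A ⟶ B) {L : CochainComplex (Sh k Z) ℤ}
    (a : K ⟶ L) (e' : DerivedCategory.Q.obj L ⟶ B.obj)
    (h : e ≫ φ.hom = DerivedCategory.Q.map a ≫ e') :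
    pullRepr f e ≫ ((pull k f).map φ).hom =
      DerivedCategory.Q.map ((pullComplex k f).map a) ≫ pullRepr f e' := by
  refine (repr_comp (TopCat.Sheaf.pullback (ModuleCat.{u} k) f) e φ).symm.trans ?_
  rw [h]
  exact repr_map_comp _ a e'

lemma comp_eq_comp_of_Q {C : Type (u + 1)} [Category.{u} C] [Abelian C]
    [HasDerivedCategory.{u+1} C] {K L M : CochainComplex C ℤ} {X Y Z : DerivedCategory C}
    {x : DerivedCategory.Q.obj K ⟶ X} {φ : X ⟶ Y} {y : DerivedCategory.Q.obj L ⟶ Y} {a : K ⟶ L}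
    {ψ : Y ⟶ Z} {z : DerivedCategory.Q.obj M ⟶ Z} {b : L ⟶ M}
    (h₁ : x ≫ φ = DerivedCategory.Q.map a ≫ y) (h₂ : y ≫ ψ = DerivedCategory.Q.map b ≫ z) :
    x ≫ φ ≫ ψ = DerivedCategory.Q.map (a ≫ b) ≫ z := by
  rw [reassoc_of% h₁, h₂, Functor.map_comp, Category.assoc]

variable (A) in
/-- Associativity of `pullIso`. -/
lemma pullIso_assoc (f : W ⟶ X) (g : X ⟶ Y) (h : Y ⟶ Z) {fg : W ⟶ Y} {gh : X ⟶ Z} {l : W ⟶ Z}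
    (w₁ : f ≫ g = fg) (w₂ : g ≫ h = gh) (w₃ : f ≫ gh = l) (w₄ : fg ≫ h = l) :
    (pull k f).map ((pullIso k g h w₂).hom.app A) ≫ (pullIso k f gh w₃).hom.app A =
      (pullIso k f g w₁).hom.app ((pull k h).obj A) ≫ (pullIso k fg h w₄).hom.app A := by
  obtain ⟨K, e, _⟩ := Db.exists_repr A
  refine Db.hom_ext_of_epi (pullRepr f (pullRepr g (pullRepr h e))) ?_
  have h₁ := comp_eq_comp_of_Q (pullRepr_map _ f _ _ _ (pullRepr_pullIso e g h w₂))
    (pullRepr_pullIso e f gh w₃)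
  have h₂ := comp_eq_comp_of_Q (pullRepr_pullIso (pullRepr h e) f g w₁)
    (pullRepr_pullIso e fg h w₄)
  refine h₁.trans (Eq.trans ?_ h₂.symm)
  refine congrArg (fun φ => DerivedCategory.Q.map φ ≫ pullRepr l e) ?_
  ext i
  exact sheafPullIso_assoc f g h w₁ w₂ w₃ w₄ (K.X i)

variable (A) in
lemma pullIso_map_id (f : X ⟶ Z) {i : Z ⟶ Z} (hi : i = 𝟙 Z) (w : f ≫ i = f) :
    (pull k f).map ((pullId k hi).hom.app A) = (pullIso k f i w).hom.app A := by
  obtain ⟨K, e, _⟩ := Db.exists_repr A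
  refine Db.hom_ext_of_epi (pullRepr f (pullRepr i e)) ?_
  refine (pullRepr_map _ f _ _ _ (pullRepr_pullId e hi)).trans
    (Eq.trans ?_ (pullRepr_pullIso e f i w).symm)
  refine congrArg (fun φ => DerivedCategory.Q.map φ ≫ pullRepr f e) ?_
  ext j
  exact sheafPullIso_map_id f hi w (K.X j)

variable (A) in
lemma pullIso_id_app {i : X ⟶ X} (hi : i = 𝟙 X) (f : X ⟶ Z) (w : i ≫ f = f) :
    (pullIso k i f w).hom.app A = (pullId k hi).hom.app ((pull k f).obj A) := by
  obtain ⟨K, e, _⟩ := Db.exists_repr A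
  refine Db.hom_ext_of_epi (pullRepr i (pullRepr f e)) ?_
  refine (pullRepr_pullIso e i f w).trans (Eq.trans ?_ (pullRepr_pullId (pullRepr f e) hi).symm)
  refine congrArg (fun φ => DerivedCategory.Q.map φ ≫ pullRepr f e) ?_
  ext j
  exact sheafPullIso_id_app hi f w (K.X j)

/-- `dbMapIso` is compatible with composition. -/
lemma dbMapIso_hom_app_eq_comp {C₁ C₂ : Type (u + 1)} [Category.{u} C₁] [Category.{u} C₂]
    [Abelian C₁] [Abelian C₂] [HasDerivedCategory.{u+1} C₁] [HasDerivedCategory.{u+1} C₂]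
    {F G H : C₁ ⥤ C₂} [F.Additive] [PreservesFiniteLimits F] [PreservesFiniteColimits F]
    [G.Additive] [PreservesFiniteLimits G] [PreservesFiniteColimits G] [H.Additive]
    [PreservesFiniteLimits H] [PreservesFiniteColimits H] (α : F ≅ H) (β : F ≅ G) (γ : G ≅ H)
    (h : ∀ X, α.hom.app X = β.hom.app X ≫ γ.hom.app X) (A : DerivedCategory.Bounded C₁) :
    (dbMapIso α).hom.app A = (dbMapIso β).hom.app A ≫ (dbMapIso γ).hom.app A := by
  let e := (DerivedCategory.Q.objObjPreimageIso A.obj).hom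
  apply ObjectProperty.hom_ext
  refine (cancel_epi (repr F e)).1 ((repr_comp_dbMapIso α e).trans ?_)
  refine Eq.trans ?_ (comp_eq_comp_of_Q (repr_comp_dbMapIso β e) (repr_comp_dbMapIso γ e)).symm
  refine congrArg (fun φ => DerivedCategory.Q.map φ ≫ repr H e) ?_
  ext i
  exact h _

end Derived

section Slices

variable {k : Type u} [CommRing k] {M : Type u} [TopologicalSpace M]

/-- The identification of the restriction of `s⁻¹ P` to a slice in terms of the coherent
isomorphisms `pullIso` and `pullId`. -/
lemma sliceSumIso_hom_app {c e : ℝ} (h : c ≤ e) (P : Db k (MR M)) :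
    (sliceSumIso k M h).hom.app P =
      (pullIso k (convSlice M h) (convSum M c) (convSlice_sum M h)).hom.app P ≫
        (pullId k rfl).hom.app P := by
  have := dbMapIso_hom_app_eq_comp
    (Adjunction.leftAdjointUniq
      ((TopCat.Sheaf.pullbackPushforwardAdjunction (ModuleCat.{u} k) (convSum M c)).comp
        (TopCat.Sheaf.pullbackPushforwardAdjunction (ModuleCat.{u} k) (convSlice M h)))
      (Adjunction.id.ofNatIsoRight
        (pushforwardComp k (convSlice_sum M h) ≪≫ pushforwardId k rfl).symm))
    (sheafPullIso (convSlice M h) (convSum M c) (convSlice_sum M h)) (sheafPullId rfl)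
    (leftAdjointUniq_comp_eq _ _ _ Adjunction.id (pushforwardId k rfl)) P
  refine (congrArg (fun φ => (dbMapComp _ _).inv.app P ≫ φ ≫ dbMapId.hom.app P) this).trans ?_
  simp only [Category.assoc]
  exact (Category.assoc _ _ _).symm

/-- The identification of the restriction of `q⁻¹ F` to a slice in terms of the coherent
isomorphisms `pullIso`. -/
lemma sliceProjIso_hom_app {c e : ℝ} (h : c ≤ e) (F : Db k (MR M)) :
    (sliceProjIso k M h).hom.app F =
      (pullIso k (convSlice M h) (convProj M c) (convSlice_proj M h)).hom.app F ≫
        (pullTr k M e).hom.app F := by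
  have := dbMapIso_hom_app_eq_comp
    (H := TopCat.Sheaf.pushforward (ModuleCat.{u} k) (translation M e))
    (Adjunction.leftAdjointUniq
      ((TopCat.Sheaf.pullbackPushforwardAdjunction (ModuleCat.{u} k) (convProj M c)).comp
        (TopCat.Sheaf.pullbackPushforwardAdjunction (ModuleCat.{u} k) (convSlice M h)))
      ((translationEquiv k M e).toAdjunction.ofNatIsoRight
        (pushforwardComp k (convSlice_proj M h)).symm))
    (sheafPullIso (convSlice M h) (convProj M c) (convSlice_proj M h)) (sheafPullTr k M e)
    (fun G => by
      have := leftAdjointUniq_comp_eq (convSlice M h) (convProj M c) (convSlice_proj M h)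
        (translationEquiv k M e).toAdjunction (Iso.refl _) G
      exact this) F
  refine (congrArg (fun φ => (dbMapComp _ _).inv.app F ≫ φ) this).trans ?_
  exact (Category.assoc _ _ _).symm

end Slices

/-! ### Relative constant sheaves -/

section RelConst

variable {k : Type u} [CommRing k] {X Y Z : TopCat.{u}}

/-- The section `s` of `S` on `W` is the universal section on `W` that vanishes on `N`, so that
`S` is isomorphic to `k_{W \ N}`, the quotient of `k_W` by `k_N`. This universal property replaces
the explicit construction, so that it can be transported by excision and by inverse images. -/
structure IsRelConst {N W : Opens X} (h : N ≤ W) (S : Sh k X) (s : Sec S W) : Prop where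
  res_eq_zero : res S h s = 0
  exists_hom (G : Sh k X) (t : Sec G W) : res G h t = 0 → ∃ φ : S ⟶ G, secMap φ W s = t
  hom_ext {G : Sh k X} {φ ψ : S ⟶ G} : secMap φ W s = secMap ψ W s → φ = ψ

lemma isRelConst_constNonneg (φ : X → ℝ) (W : Opens X) :
    IsRelConst (negPart_le φ W) (constNonneg k φ W) (toSec (constNonnegProj k φ W)) where
  res_eq_zero := by
    exact (toSec_map _ _).symm.trans
      (congrArg toSec (cokernel.condition ((constOpen k).map (homOfLE (negPart_le φ W)))))
  exists_hom G t ht := by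
    obtain ⟨f, rfl⟩ := toSec_surjective W G t
    rw [← toSec_map] at ht
    exact ⟨cokernel.desc _ f (toSec_injective _ _ ht),
      (toSec_comp _ _).symm.trans (congrArg toSec (cokernel.π_desc _ _ _))⟩
  hom_ext {G α β} h := by
    rw [← toSec_comp, ← toSec_comp] at h
    exact (cancel_epi (constNonnegProj k φ W)).1 (toSec_injective _ _ h)

/-- Excision: a section on `W` that vanishes on `N ⊓ W` is extended to `N ⊔ W` by zero. -/
lemma IsRelConst.exists_sup {N' N W : Opens X} {h : N' ≤ W} {S : Sh k X} {s : Sec S W}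
    (hs : IsRelConst h S s) (hN : N ⊓ W ≤ N') (hN' : N' ≤ N) :
    ∃ t : Sec S (N ⊔ W), IsRelConst le_sup_left S t := by
  obtain ⟨t, ht₀, ht⟩ := exists_glue₂ (G := S) (U₁ := N) (U₂ := W) 0 s (by
    rw [map_zero, ← res_res S hN h, hs.res_eq_zero, map_zero])
  refine ⟨t, ht₀, fun G r hr => ?_, fun {G φ ψ} hφ => hs.hom_ext ?_⟩
  · obtain ⟨φ, hφ⟩ := hs.exists_hom G (res G le_sup_right r) (by
      rw [res_res, ← res_res G hN' le_sup_left, hr, map_zero])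
    refine ⟨φ, sec_eq_of_locally fun x hx => ?_⟩
    obtain hx | hx := hx
    · exact ⟨N, le_sup_left, hx, by rw [← secMap_res, ht₀, map_zero, hr]⟩
    · exact ⟨W, le_sup_right, hx, by rw [← secMap_res, ht, hφ]⟩
  · rw [← ht, secMap_res, secMap_res, hφ]

/-- The inverse image of `k_{W \ N}` is `k_{f⁻¹ W \ f⁻¹ N}`. -/
lemma IsRelConst.pull (f : Y ⟶ X) {N W : Opens X} {h : N ≤ W} {S : Sh k X} {s : Sec S W}
    (hs : IsRelConst h S s) :
    IsRelConst ((Opens.map f).monotone h)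
      ((TopCat.Sheaf.pullback (ModuleCat.{u} k) f).obj S) (pullSec f S s) where
  res_eq_zero := (res_pullSec f S h s).trans
    ((congrArg (pullSec f S) hs.res_eq_zero).trans (map_zero _))
  exists_hom G t ht := by
    let adj := TopCat.Sheaf.pullbackPushforwardAdjunction (ModuleCat.{u} k) f
    obtain ⟨φ, hφ⟩ := hs.exists_hom ((TopCat.Sheaf.pushforward (ModuleCat.{u} k) f).obj G) t ht
    refine ⟨(adj.homEquiv _ _).symm φ, ?_⟩
    have : adj.unit.app S ≫ (TopCat.Sheaf.pushforward (ModuleCat.{u} k) f).map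
        ((adj.homEquiv S G).symm φ) = φ :=
      (adj.homEquiv_unit _ _ _).symm.trans (Equiv.apply_symm_apply _ _)
    exact (congrArg (fun φ => secMap φ W s) this).trans hφ
  hom_ext {G φ ψ} hφ := by
    let adj := TopCat.Sheaf.pullbackPushforwardAdjunction (ModuleCat.{u} k) f
    apply (adj.homEquiv _ _).injective
    rw [adj.homEquiv_unit, adj.homEquiv_unit]
    exact hs.hom_ext hφ

/-- If `f` and `g` are such that `f⁻¹ O ≤ g⁻¹ O` for the two open sets that define `S`, then there
is a natural morphism from `f⁻¹ S` to `g⁻¹ S`. It becomes an isomorphism after inverse image by a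
map which equalizes `f` and `g`. -/
lemma IsRelConst.exists_pull_hom {f g : Y ⟶ X} {N W : Opens X} {h : N ≤ W} {S : Sh k X}
    {s : Sec S W} (hs : IsRelConst h S s) (hN : (Opens.map f).obj N ≤ (Opens.map g).obj N)
    (hW : (Opens.map f).obj W ≤ (Opens.map g).obj W) :
    ∃ ρ : (TopCat.Sheaf.pullback (ModuleCat.{u} k) f).obj S ⟶
        (TopCat.Sheaf.pullback (ModuleCat.{u} k) g).obj S,
      ∀ {Z : TopCat.{u}} (j : Z ⟶ Y), j ≫ f = j ≫ g →
        IsIso ((TopCat.Sheaf.pullback (ModuleCat.{u} k) j).map ρ) := by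
  obtain ⟨ρ, hρ⟩ := (hs.pull f).exists_hom _ (res _ hW (pullSec g S s)) (by
    rw [res_res, ← res_res _ hN ((Opens.map g).monotone h), (hs.pull g).res_eq_zero, map_zero])
  refine ⟨ρ, fun {Z} j hj => ?_⟩
  have key : (TopCat.Sheaf.pullback (ModuleCat.{u} k) j).map ρ ≫
      (sheafPullIso j g hj.symm).hom.app S = (sheafPullIso j f rfl).hom.app S := by
    refine ((hs.pull f).pull j).hom_ext ?_
    rw [secMap_comp]
    refine (congrArg (secMap _ _) ((secMap_map_pullSec j ρ _).trans
      ((congrArg (pullSec j _) hρ).trans (res_pullSec j _ hW _).symm))).trans ?_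
    rw [secMap_res]
    refine (congrArg (res _ _) (secMap_sheafPullIso j g hj.symm S s)).trans ?_
    rw [res_res]
    exact (secMap_sheafPullIso j f rfl S s).symm
  have : (TopCat.Sheaf.pullback (ModuleCat.{u} k) j).map ρ =
      (sheafPullIso j f rfl).hom.app S ≫ (sheafPullIso j g hj.symm).inv.app S := by
    rw [← key, Category.assoc, Iso.hom_inv_id_app]
    exact (Category.comp_id _).symm
  rw [this]
  infer_instance

end RelConst

section Single

variable {C₁ C₂ : Type (u + 1)} [Category.{u} C₁] [Category.{u} C₂] [Abelian C₁] [Abelian C₂]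
  [HasDerivedCategory.{u+1} C₁] [HasDerivedCategory.{u+1} C₂]

variable (C₁) in
/-- The complexes concentrated in degree `n`, in the bounded derived category. -/
def dbSingle (n : ℤ) : C₁ ⥤ DerivedCategory.Bounded C₁ :=
  DerivedCategory.TStructure.t.bounded.lift (DerivedCategory.singleFunctor C₁ n)
    fun _ => ⟨⟨n, inferInstance⟩, ⟨n, inferInstance⟩⟩

/-- The derived functor of an exact functor `L` is `L` on complexes concentrated in one degree. -/
def dbSingleMap (L : C₁ ⥤ C₂) [L.Additive] [PreservesFiniteLimits L] [PreservesFiniteColimits L]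
    (n : ℤ) : dbSingle C₁ n ⋙ dbMap L ≅ L ⋙ dbSingle C₂ n :=
  liftIso (L.mapDerivedCategorySingleFunctor n)

lemma isIso_dbMap_dbSingle (L : C₁ ⥤ C₂) [L.Additive] [PreservesFiniteLimits L]
    [PreservesFiniteColimits L] (n : ℤ) {A B : C₁} (φ : A ⟶ B) [IsIso (L.map φ)] :
    IsIso ((dbMap L).map ((dbSingle C₁ n).map φ)) :=
  (NatIso.isIso_map_iff (dbSingleMap L n) φ).2
    (inferInstanceAs (IsIso ((dbSingle C₂ n).map (L.map φ))))

end Single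

/-! ### The evaluation of the convolution on the first slice -/

section Descending

variable {k : Type u} [CommRing k] {M : Type u} [TopologicalSpace M] {X Y Z : TopCat.{u}}

/-- If `g` is obtained from `f` by moving down in the direction of `ℝ`, then there is a morphism
`f⁻¹ K ⟶ g⁻¹ K`, whose inverse image by a map that equalizes `f` and `g` is an isomorphism. -/
def IsDescending (K : Db k (MR M)) : Prop :=
  ∀ (Y : TopCat.{u}) (f g : Y ⟶ MR M), (∀ y, (f y).1 = (g y).1 ∧ (g y).2 ≤ (f y).2) →
    ∃ ρ : (pull k f).obj K ⟶ (pull k g).obj K,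
      ∀ {Z : TopCat.{u}} (j : Z ⟶ Y), j ≫ f = j ≫ g → IsIso ((pull k j).map ρ)

/-- The sheaf `k_{W \ N}` is descending if `N` and `W` are stable under moving down. -/
lemma IsRelConst.isDescending {N W : Opens (MR M)} {h : N ≤ W} {S : Sh k (MR M)} {s : Sec S W}
    (hs : IsRelConst h S s) (hN : ∀ x t t', (x, t) ∈ N → t' ≤ t → (x, t') ∈ N)
    (hW : ∀ x t t', (x, t) ∈ W → t' ≤ t → (x, t') ∈ W) (n : ℤ) :
    IsDescending ((dbSingle _ n).obj S) := by
  intro Y f g hfg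
  have key (O : Opens (MR M)) (hO : ∀ x t t', (x, t) ∈ O → t' ≤ t → (x, t') ∈ O) :
      (Opens.map f).obj O ≤ (Opens.map g).obj O := by
    intro y hy
    have := hO _ _ _ (show ((f y).1, (f y).2) ∈ O from hy) (hfg y).2
    rwa [(hfg y).1] at this
  obtain ⟨ρ, hρ⟩ := hs.exists_pull_hom (f := f) (g := g) (key N hN) (key W hW)
  refine ⟨(dbSingleMap _ n).hom.app S ≫ (dbSingle _ n).map ρ ≫ (dbSingleMap _ n).inv.app S,
    fun {Z} j hj => ?_⟩
  have := hρ j hj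
  have := isIso_dbMap_dbSingle (TopCat.Sheaf.pullback (ModuleCat.{u} k) j) n ρ
  rw [Functor.map_comp, Functor.map_comp]
  infer_instance

lemma pull_map_map (f : X ⟶ Y) (g : Y ⟶ Z) {h : X ⟶ Z} (w : f ≫ g = h) {A B : Db k Z}
    (φ : A ⟶ B) :
    (pull k f).map ((pull k g).map φ) = (pullIso k f g w).hom.app A ≫ (pull k h).map φ ≫
      (pullIso k f g w).inv.app B := by
  rw [← NatTrans.naturality_assoc, Iso.hom_inv_id_app]
  exact (Category.comp_id _).symm

lemma pull_map_eq_of_comp_eq_id (f : X ⟶ Y) (g : Y ⟶ X) (w : f ≫ g = 𝟙 X) {A B : Db k X}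
    (φ : A ⟶ B) :
    (pull k f).map ((pull k g).map φ) = ((pullIso k f g w).hom.app A ≫ (pullId k rfl).hom.app A) ≫
      φ ≫ (pullId k rfl).inv.app B ≫ (pullIso k f g w).inv.app B := by
  rw [pull_map_map f g w φ, Category.assoc, ← (NatIso.naturality_2 (pullId k rfl) φ)]
  simp

/-- A morphism `φ` is determined by `f⁻¹ g⁻¹ φ`, if `g ∘ f = id`. -/
lemma pull_map_pull_map_injective (f : X ⟶ Y) (g : Y ⟶ X) (w : f ≫ g = 𝟙 X) {A B : Db k X}
    {φ ψ : A ⟶ B} (h : (pull k f).map ((pull k g).map φ) = (pull k f).map ((pull k g).map ψ)) :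
    φ = ψ := by
  rw [pull_map_eq_of_comp_eq_id f g w, pull_map_eq_of_comp_eq_id f g w, cancel_epi,
    cancel_mono] at h
  exact h

lemma map_eq_of_map_comp_comp_eq {C D : Type*} [Category* C] [Category* D] (F : C ⥤ D)
    {W X Y Z : C} {a : W ⟶ X} {x y : X ⟶ Y} {b : Y ⟶ Z} [IsIso (F.map a)] [IsIso b]
    (h : F.map (a ≫ x ≫ b) = F.map (a ≫ y ≫ b)) : F.map x = F.map y := by
  rwa [Functor.map_comp, Functor.map_comp, Functor.map_comp, Functor.map_comp, cancel_epi,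
    cancel_mono] at h

variable (M) in
/-- The homotopy from `(x, t, u) ↦ (x, t, c)` to the identity of `(M × ℝ) × [c, ∞)`. -/
def convHomotopy (c : ℝ) : Cyl (MRc M c) ⟶ MRc M c :=
  TopCat.ofHom ⟨fun p => (p.1.1, ⟨c + p.2 * (p.1.2 - c), by
    have := p.2.2.1
    have : c ≤ p.1.2 := p.1.2.2
    rw [Set.mem_Ici]
    nlinarith⟩), by fun_prop⟩

/-- The inclusion of the slice `a` in the cylinder. -/
def cylSlice (Y : TopCat.{u}) (a : unitInterval) : Y ⟶ Cyl Y :=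
  TopCat.ofHom ⟨fun y => (y, a), by fun_prop⟩

/-- The morphisms from `s⁻¹ K` to `q⁻¹ F` are determined by their restrictions to the slice
`u = c`, by invariance of `q⁻¹ F` under homotopy. -/
lemma IsDescending.pull_convSlice_injective {K : Db k (MR M)} (hK : IsDescending K) (c : ℝ)
    (F : Db k (MR M)) {η η' : (pull k (convSum M c)).obj K ⟶ (pull k (convProj M c)).obj F}
    (h : (pull k (convSlice M le_rfl)).map η = (pull k (convSlice M le_rfl)).map η') :
    η = η' := by
  let Y : TopCat.{u} := MRc M c
  have : (pull k (cylProj Y)).Full := full_pull_cylProj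
  -- The morphisms `η` and `η'` are pulled back by `H` to the cylinder, and composed with `ρ` so
  -- that they become morphisms between objects coming from the base of the cylinder. Such
  -- morphisms are constant along the cylinder; they agree at `0` by hypothesis, hence at `1`,
  -- where `H` is the identity.
  let H := convHomotopy M c
  let r : Y ⟶ MR M := TopCat.ofHom ⟨fun p => (p.1.1, p.1.2 + c), by fun_prop⟩
  have hq : H ≫ convProj M c = cylProj Y ≫ convProj M c := rfl
  have h₀ : cylSlice Y 0 ≫ H = r ≫ convSlice M le_rfl := by
    refine TopCat.hom_ext (ContinuousMap.ext fun y => ?_)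
    exact Prod.ext (Prod.ext rfl (add_sub_cancel_right y.1.2 c).symm)
      (Subtype.ext (show c + 0 * (y.2.1 - c) = c by ring))
  have h₁ : cylSlice Y 1 ≫ H = 𝟙 Y := by
    refine TopCat.hom_ext (ContinuousMap.ext fun y => ?_)
    exact Prod.ext rfl (Subtype.ext (show c + 1 * (y.2.1 - c) = y.2.1 by ring))
  obtain ⟨ρ, hρ⟩ := hK _ (cylProj Y ≫ convSum M c) (H ≫ convSum M c) fun y => ⟨rfl, by
    have h₁ := y.2.2.2
    have h₂ : c ≤ y.1.2 := y.1.2.2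
    change y.1.1.2 + (c + y.2 * (y.1.2 - c)) ≤ y.1.1.2 + y.1.2
    nlinarith⟩
  let a := (pullIso k (cylProj Y) (convSum M c) rfl).hom.app K ≫ ρ ≫
    (pullIso k H (convSum M c) rfl).inv.app K
  let b := (pullIso k H (convProj M c) hq).hom.app F ≫
    (pullIso k (cylProj Y) (convProj M c) rfl).inv.app F
  obtain ⟨g, hg⟩ := (pull k (cylProj Y)).map_surjective (a ≫ (pull k H).map η ≫ b)
  obtain ⟨g', hg'⟩ := (pull k (cylProj Y)).map_surjective (a ≫ (pull k H).map η' ≫ b)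
  have e₀ : (pull k (cylSlice Y 0)).map ((pull k H).map η) =
      (pull k (cylSlice Y 0)).map ((pull k H).map η') := by
    have := congrArg (pull k r).map h
    rw [pull_map_map r _ rfl, pull_map_map r _ rfl, cancel_epi, cancel_mono] at this
    rw [pull_map_map _ _ h₀, pull_map_map _ _ h₀, this]
  have hgg : g = g' := by
    refine pull_map_pull_map_injective (cylSlice Y 0) (cylProj Y) rfl ?_
    rw [hg, hg']
    simp only [Functor.map_comp]
    rw [e₀]
  have hj : cylSlice Y 1 ≫ cylProj Y ≫ convSum M c = cylSlice Y 1 ≫ H ≫ convSum M c := by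
    rw [reassoc_of% h₁]
    rfl
  have := hρ (cylSlice Y 1) hj
  have e₁ := congrArg (pull k (cylSlice Y 1)).map (hg.symm.trans ((congrArg _ hgg).trans hg'))
  have : IsIso ((pull k (cylSlice Y 1)).map a) := by
    rw [Functor.map_comp, Functor.map_comp]
    infer_instance
  exact pull_map_pull_map_injective _ _ h₁ (map_eq_of_map_comp_comp_eq _ e₁)

/-- The morphisms between the restrictions of `s⁻¹ K` and `q⁻¹ F` to the slice `u = c` extend: the
retraction `(x, t, u) ↦ (x, t, c)` to this slice preserves `q` and moves down along `s`. -/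
lemma IsDescending.pull_convSlice_surjective {K : Db k (MR M)} (hK : IsDescending K) (c : ℝ)
    (F : Db k (MR M)) (b : (pull k (convSlice M le_rfl)).obj ((pull k (convSum M c)).obj K) ⟶
      (pull k (convSlice M le_rfl)).obj ((pull k (convProj M c)).obj F)) :
    ∃ η : (pull k (convSum M c)).obj K ⟶ (pull k (convProj M c)).obj F,
      (pull k (convSlice M le_rfl)).map η = b := by
  -- `r` is a retraction to the slice; `b` is pulled back by `r`, and `ρ` compares `s⁻¹ K` with the
  -- inverse image of its restriction.
  let i : MR M ⟶ MRc M c := convSlice M le_rfl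
  let r : MRc M c ⟶ MR M := TopCat.ofHom ⟨fun p => (p.1.1, p.1.2 + c), by fun_prop⟩
  have hr : r ≫ i ≫ convProj M c = convProj M c := by
    exact TopCat.hom_ext (ContinuousMap.ext fun y =>
      Prod.ext rfl (add_sub_cancel_right y.1.2 c))
  have hi : i ≫ r = 𝟙 _ := by
    exact TopCat.hom_ext (ContinuousMap.ext fun y => Prod.ext rfl (sub_add_cancel y.2 c))
  obtain ⟨ρ, hρ⟩ := hK _ (convSum M c) r fun y => ⟨rfl, add_le_add_right y.2.2 _⟩
  have := hρ i rfl
  let b₁ := (pullIso k i r hi).hom.app K ≫ (pullId k rfl).hom.app K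
  let b₂ := (pullId k rfl).inv.app ((pull k (i ≫ convProj M c)).obj F) ≫
    (pullIso k i r hi).inv.app _
  let b₃ := (pull k i).map ((pullIso k r (i ≫ convProj M c) hr).hom.app F)
  let b₀ := inv ((pull k i).map ρ ≫ b₁) ≫ b ≫ inv (b₂ ≫ b₃)
  refine ⟨ρ ≫ (pull k r).map b₀ ≫ (pullIso k r (i ≫ convProj M c) hr).hom.app F, ?_⟩
  change (pull k i).map _ = b
  rw [Functor.map_comp, Functor.map_comp, pull_map_eq_of_comp_eq_id i r hi]
  change (pull k i).map ρ ≫ (b₁ ≫ b₀ ≫ b₂) ≫ b₃ = b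
  simp [b₀]

/-- The evaluation on the first slice identifies the morphisms from `K` to `F ⋆ k_{M × [c, ∞)}`
with those to `T_{c*} F`. -/
lemma IsDescending.bijective_comp_convEval {K : Db k (MR M)} (hK : IsDescending K) {c : ℝ}
    {F P : Db k (MR M)} {ε : (pull k (convSum M c)).obj P ⟶ (pull k (convProj M c)).obj F}
    (hε : IsConv c F P ε) :
    Function.Bijective (fun a : K ⟶ P => a ≫ convEval le_rfl ε) := by
  have key (a : K ⟶ P) : a ≫ convEval le_rfl ε = (sliceSumIso k M le_rfl).inv.app K ≫
      (pull k (convSlice M le_rfl)).map ((pull k (convSum M c)).map a ≫ ε) ≫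
        (sliceProjIso k M le_rfl).hom.app F := by
    have := (sliceSumIso k M (le_refl c)).inv.naturality a
    rw [convEval, Functor.map_comp, Category.assoc]
    exact ((Category.assoc _ _ _).symm.trans (congrArg (CategoryStruct.comp · _) this)).trans
      (Category.assoc _ _ _)
  simp only [key]
  constructor
  · intro a a' h
    exact (hε K).1 (hK.pull_convSlice_injective c F ((cancel_mono _).1 ((cancel_epi _).1 h)))
  · intro b
    obtain ⟨η, hη⟩ := hK.pull_convSlice_surjective c F
      ((sliceSumIso k M le_rfl).hom.app K ≫ b ≫ (sliceProjIso k M le_rfl).inv.app F)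
    obtain ⟨a, rfl⟩ := (hε K).2 η
    refine ⟨a, ?_⟩
    simp only [hη]
    simp

end Descending

/-! ### Microsupport and vertical monotonicity -/

section Ugamma

variable {E : Type u} [NormedAddCommGroup E] [NormedSpace ℝ E]
variable {M : Type u} [TopologicalSpace M] [ChartedSpace E M]
  [IsManifold (modelWithCornersSelf ℝ E) ∞ M]

variable (E M) in
/-- The vector field `∂/∂t` on `M × ℝ` is continuous. -/
lemma continuous_vertical : Continuous fun x : M × ℝ =>
    (⟨x, (show E × ℝ from (0, 1))⟩ : TangentBundle (modelMR E) (M × ℝ)) := by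
  have h₁ : Continuous fun x : M × ℝ => Bundle.zeroSection E
      (TangentSpace (modelWithCornersSelf ℝ E) : M → Type _) x.1 :=
    (Bundle.contMDiff_zeroSection (n := 0) (IB := modelWithCornersSelf ℝ E) ℝ
      (TangentSpace (modelWithCornersSelf ℝ E) : M → Type _)).continuous.comp continuous_fst
  have h₂ : Continuous fun x : M × ℝ =>
      (⟨x.2, (1 : ℝ)⟩ : TangentBundle (modelWithCornersSelf ℝ ℝ) ℝ) := by
    have := (tangentBundleModelSpaceHomeomorph (modelWithCornersSelf ℝ ℝ)).symm.continuous.comp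
      ((continuous_snd (X := M) (Y := ℝ)).prodMk (continuous_const (y := (1 : ℝ))))
    exact this
  have h₃ := (contMDiff_equivTangentBundleProd_symm (n := 0) (I := modelWithCornersSelf ℝ E)
    (M := M) (I' := modelWithCornersSelf ℝ ℝ) (M' := ℝ)).continuous
  exact h₃.comp (h₁.prodMk h₂)

/-- The set `{τ > 0}` is open in the cotangent bundle. -/
lemma isOpen_Ugamma : IsOpen (Ugamma E M) := by
  have h := Continuous.clm_bundle_apply (𝕜 := ℝ) (F₁ := E × ℝ) (F₂ := ℝ)
    (E₁ := fun x : M × ℝ => TangentSpace (modelMR E) x) (E₂ := Bundle.Trivial (M × ℝ) ℝ)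
    (b := fun p : Cotangent (modelMR E) (M × ℝ) => p.1) (ϕ := fun p => p.2)
    (v := fun _ => (show E × ℝ from (0, 1))) continuous_id
    ((continuous_vertical E M).comp (FiberBundle.continuous_proj _ _))
  have h' := (Bundle.Trivial.homeomorphProd (M × ℝ) ℝ).continuous.comp h
  exact isOpen_lt continuous_const (continuous_snd.comp h')

variable {k : Type u} [CommRing k]

/-- The microsupport is contained in `{τ ≤ 0}` if and only if `(RΓ_{φ ≥ 0} F)_x = 0` for all `φ`
with positive derivative in the direction of `ℝ`, since `{τ > 0}` is open. -/
lemma NZ_iff (F : Db k (MR M)) : NZ k E M F ↔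
    ∀ (x : M × ℝ) (φ : M × ℝ → ℝ) (Ω : Opens (M × ℝ)), x ∈ Ω →
      ContMDiffOn (modelMR E) (modelWithCornersSelf ℝ ℝ) 1 φ Ω → φ x = 0 →
      (0 : ℝ) < mfderiv (modelMR E) (modelWithCornersSelf ℝ ℝ) φ x (show E × ℝ from (0, 1)) →
      StalkVanishes (X := MR M) F.obj φ Ω x := by
  constructor
  · intro hF x φ Ω hx hφ h0 hd
    by_contra hS
    let p : Cotangent (modelMR E) (M × ℝ) :=
      ⟨x, mfderiv (modelMR E) (modelWithCornersSelf ℝ ℝ) φ x⟩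
    refine Set.disjoint_left.1 (show Disjoint (microsupport (modelMR E) F.obj) (Ugamma E M) from hF)
      (show p ∈ _ from ?_) hd
    rintro ⟨U, -, hU, h⟩
    exact hS (h x φ Ω hx hφ h0 hU)
  · intro h
    refine Set.disjoint_left.2 fun p hp hpU => ?_
    apply hp
    refine ⟨Ugamma E M, isOpen_Ugamma, hpU, ?_⟩
    intro x φ Ω hx hφ h0 hd
    exact h x φ Ω hx hφ h0 hd

omit [IsManifold (modelWithCornersSelf ℝ E) ∞ M] in
/-- A function with positive derivative in the direction of `ℝ` is increasing in this direction on
a small box, and, if it vanishes at `x`, it is negative in the lower part of the box. -/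
lemma exists_box_monotone {φ : M × ℝ → ℝ} {Ω W : Opens (M × ℝ)} {x : M × ℝ} (hx : x ∈ W)
    (hW : W ≤ Ω) (hφ : ContMDiffOn (modelMR E) (modelWithCornersSelf ℝ ℝ) 1 φ Ω) (h0 : φ x = 0)
    (hd : (0 : ℝ) < mfderiv (modelMR E) (modelWithCornersSelf ℝ ℝ) φ x (show E × ℝ from (0, 1))) :
    ∃ (V : Opens M) (a a' b : ℝ), x.1 ∈ V ∧ a < a' ∧ a' < x.2 ∧ x.2 < b ∧
      ∀ y ∈ V, φ (y, a') < 0 ∧ ∀ t, a < t → t < b → (y, t) ∈ W ∧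
        ∀ s, a < s → s ≤ t → φ (y, s) ≤ φ (y, t) := by
  have hφx : ContMDiffAt (modelMR E) (modelWithCornersSelf ℝ ℝ) 1 φ x :=
    (hφ x (hW hx)).contMDiffAt (Ω.isOpen.mem_nhds (hW hx))
  let e := extChartAt (modelMR E) x
  let f : E × ℝ → ℝ := φ ∘ e.symm
  have hf : ContDiffAt ℝ 1 f (e x) := by
    have := (contMDiffAt_iff.1 hφx).2
    rw [ModelWithCorners.range_eq_univ, contDiffWithinAt_univ] at this
    exact this
  have hf' : mfderiv (modelMR E) (modelWithCornersSelf ℝ ℝ) φ x = fderiv ℝ f (e x) := by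
    rw [(hφx.mdifferentiableAt one_ne_zero).mfderiv, ModelWithCorners.range_eq_univ,
      fderivWithin_univ]
    rfl
  rw [hf'] at hd
  let D := fderiv ℝ f (e x)
  let δ : ℝ := D (0, 1)
  have hδ : 0 < δ := hd
  -- By strict differentiability, `∂φ/∂t ≥ δ/2` near `x` in the sense of difference quotients.
  have hs : HasStrictFDerivAt f D (e x) := hf.hasStrictFDerivAt one_ne_zero
  have hs' := hs.isLittleO.def (half_pos hδ)
  rw [nhds_prod_eq] at hs'
  obtain ⟨U, hU, hUs⟩ := (Filter.eventually_prod_self_iff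
    (r := fun z w => ‖f z - f w - D (z - w)‖ ≤ δ / 2 * ‖z - w‖)).1 hs'
  have hnhds : (e ⁻¹' U ∩ e.source) ∩ W ∈ nhds x :=
    Filter.inter_mem (Filter.inter_mem ((continuousAt_extChartAt x).preimage_mem_nhds hU)
      (extChartAt_source_mem_nhds x)) (W.isOpen.mem_nhds hx)
  obtain ⟨V₀, hV₀, I, hI, hVI⟩ := mem_nhds_prod_iff.1 hnhds
  obtain ⟨a, b, hab, hIab⟩ := mem_nhds_iff_exists_Ioo_subset.1 hI
  have hmem (y : M) (hy : y ∈ V₀) (t : ℝ) (ht : t ∈ Set.Ioo a b) :=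
    hVI (Set.mk_mem_prod hy (hIab ht))
  have hval (y : M) (hy : y ∈ V₀) (t : ℝ) (ht : t ∈ Set.Ioo a b) : f (e (y, t)) = φ (y, t) :=
    congrArg φ (e.left_inv (hmem y hy t ht).1.2)
  have hmono (y : M) (hy : y ∈ V₀) (t : ℝ) (ht : t ∈ Set.Ioo a b) (s : ℝ) (hs : s ∈ Set.Ioo a b)
      (hst : s ≤ t) : φ (y, s) + δ / 2 * (t - s) ≤ φ (y, t) := by
    have h := hUs _ (hmem y hy t ht).1.1 _ (hmem y hy s hs).1.1
    have hsub : e (y, t) - e (y, s) = (t - s) • ((0, 1) : E × ℝ) := by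
      simp [e, chartAt_self_eq]
    rw [hsub, hval y hy t ht, hval y hy s hs, map_smul, norm_smul, Prod.norm_mk, norm_zero,
      norm_one, Real.norm_eq_abs, Real.norm_eq_abs, abs_of_nonneg (sub_nonneg.2 hst)] at h
    have h₁ := (abs_le.1 h).1
    change -(δ / 2 * ((t - s) * max 0 1)) ≤ φ (y, t) - φ (y, s) - (t - s) * δ at h₁
    rw [max_eq_right zero_le_one] at h₁
    linarith
  -- The inequality gives `φ < 0` below `x`, at the height `a'`, and then at nearby points of `M` by
  -- continuity.
  obtain ⟨a', ha, ha'⟩ := exists_between hab.1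
  have hx₀ : x.1 ∈ V₀ := mem_of_mem_nhds hV₀
  have ha'b : a' ∈ Set.Ioo a b := ⟨ha, ha'.trans hab.2⟩
  have hneg : φ (x.1, a') < 0 := by
    have := hmono x.1 hx₀ x.2 hab a' ha'b ha'.le
    rw [show φ (x.1, x.2) = 0 from h0] at this
    nlinarith
  have hcont : ContinuousAt φ (x.1, a') :=
    (hφ.continuousOn (x.1, a') (hW (hmem x.1 hx₀ a' ha'b).2)).continuousAt
      (Ω.isOpen.mem_nhds (hW (hmem x.1 hx₀ a' ha'b).2))
  have hneg' : ∀ᶠ y in nhds x.1, φ (y, a') < 0 :=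
    (hcont.comp (f := fun y => (y, a'))
      (Continuous.prodMk_left a').continuousAt).eventually_lt_const hneg
  obtain ⟨V, hV, hVo, hxV⟩ := mem_nhds_iff.1 (Filter.inter_mem hV₀ hneg')
  refine ⟨⟨V, hVo⟩, a, a', b, hxV, ha, ha', hab.2, fun y hy => ⟨(hV hy).2, fun t hat htb => ?_⟩⟩
  refine ⟨(hmem y (hV hy).1 t ⟨hat, htb⟩).2, fun s has hst => ?_⟩
  have := hmono y (hV hy).1 t ⟨hat, htb⟩ s ⟨has, hst.trans_lt htb⟩ hst
  nlinarith

end Ugamma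

section Vanishing

/-- If `f` is injective on morphisms from `K⟦-1⟧`, then `f⟦1⟧` is injective on morphisms from `K`.
-/
lemma hom_eq_zero_of_comp_shift {D : Type*} [Category* D] [HasShift D ℤ] [Preadditive D]
    [∀ n : ℤ, (shiftFunctor D n).Additive] {K K' P F : D} (e : K'⟦(1 : ℤ)⟧ ≅ K) {f : P ⟶ F}
    (hf : ∀ γ : K' ⟶ P, γ ≫ f = 0 → γ = 0) (α : K ⟶ P⟦(1 : ℤ)⟧) (hα : α ≫ f⟦(1 : ℤ)⟧' = 0) :
    α = 0 := by
  obtain ⟨γ, hγ⟩ := (shiftFunctor D (1 : ℤ)).map_surjective (e.hom ≫ α)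
  have : γ = 0 := hf γ ((shiftFunctor D (1 : ℤ)).map_injective (by
    rw [Functor.map_comp, hγ, Category.assoc, hα, comp_zero, Functor.map_zero]))
  rw [← cancel_epi e.hom, ← hγ, this, Functor.map_zero, comp_zero]

/-- The shift of a complex concentrated in degree `n + 1` is concentrated in degree `n`. -/
def dbSingleShift {C : Type (u + 1)} [Category.{u} C] [Abelian C] [HasDerivedCategory.{u+1} C]
    (S : C) (n : ℤ) : ((dbSingle C (n + 1)).obj S)⟦(1 : ℤ)⟧ ≅ (dbSingle C n).obj S :=
  DerivedCategory.Bounded.ι.preimageIso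
    ((DerivedCategory.Bounded.ι.commShiftIso (1 : ℤ)).app _ ≪≫
      ((DerivedCategory.singleFunctors C).shiftIso 1 n (n + 1) (add_comm _ _)).app S)

variable {E : Type u} [NormedAddCommGroup E] [NormedSpace ℝ E]
variable {M : Type u} [TopologicalSpace M] [ChartedSpace E M]
  [IsManifold (modelWithCornersSelf ℝ E) ∞ M]
variable {k : Type u} [CommRing k]

lemma hom_eq_zero_of_dbSingle {C : Type (u + 1)} [Category.{u} C] [Abelian C]
    [HasDerivedCategory.{u+1} C] {S : C} {n : ℤ} {A : DerivedCategory.Bounded C}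
    (h : ∀ α : (dbSingle C n).obj S ⟶ A, α = 0)
    (β : (DerivedCategory.singleFunctor C n).obj S ⟶ A.obj) : β = 0 :=
  congrArg (fun α => α.hom) (h (ObjectProperty.homMk β))

omit [IsManifold (modelWithCornersSelf ℝ E) ∞ M] in
/-- If `φ` is increasing in the direction of `ℝ`, then `k_{φ ≥ 0}` is descending on a small box, by
excision. -/
lemma exists_isDescending_constNonneg {φ : M × ℝ → ℝ} {Ω W : Opens (MR M)} {x : M × ℝ} (hx : x ∈ W)
    (hW : W ≤ Ω) (hφ : ContMDiffOn (modelMR E) (modelWithCornersSelf ℝ ℝ) 1 φ (Ω : Set (M × ℝ)))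
    (h0 : φ x = 0)
    (hd : (0 : ℝ) < mfderiv (modelMR E) (modelWithCornersSelf ℝ ℝ) φ x
      (show E × ℝ from (0, 1))) :
    ∃ W' : Opens (MR M), W' ≤ W ∧ x ∈ W' ∧
      ∀ n, IsDescending ((dbSingle _ n).obj (constNonneg (X := MR M) k φ W')) := by
  obtain ⟨V, a, a', b, hxV, ha, hax, hxb, hV⟩ := exists_box_monotone hx hW hφ h0 hd
  let W' : Opens (MR M) := ⟨{p | p.1 ∈ V ∧ a < p.2 ∧ p.2 < b},
    (V.isOpen.preimage continuous_fst).inter ((isOpen_lt continuous_const continuous_snd).inter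
      (isOpen_lt continuous_snd continuous_const))⟩
  have hW' : W' ≤ W := fun p hp => ((hV p.1 hp.1).2 p.2 hp.2.1 hp.2.2).1
  have hneg (p : M × ℝ) : p ∈ negPart (X := MR M) φ W' ↔ p ∈ W' ∧ φ p < 0 := by
    refine ⟨fun hp => interior_subset (s := {p | p ∈ W' ∧ φ p < 0}) hp, fun hp => ?_⟩
    exact mem_interior_iff_mem_nhds.2 (Filter.inter_mem (W'.isOpen.mem_nhds hp.1)
      (((hφ.continuousOn p (hW (hW' hp.1))).continuousAt
        (Ω.isOpen.mem_nhds (hW (hW' hp.1)))).eventually_lt_const hp.2))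
  -- `N` is the set of the points below the negative part. By monotonicity it does not meet the
  -- rest of the box, so that excision replaces the pair of the box and its negative part by
  -- `N ⊔ W'` and `N`, which are stable under moving down: the part of `W'` at height at most `a'`
  -- lies in `N`.
  let N : Opens (MR M) := ⟨⋃ r : Set.Ici (0 : ℝ), {p | (p.1, p.2 + r) ∈ negPart (X := MR M) φ W'},
    isOpen_iUnion fun r => (negPart (X := MR M) φ W').isOpen.preimage (by fun_prop)⟩
  have hN (p : M × ℝ) : p ∈ N ↔ ∃ r : Set.Ici (0 : ℝ),
    (p.1, p.2 + r) ∈ negPart (X := MR M) φ W' := Set.mem_iUnion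
  obtain ⟨t, ht⟩ := (isRelConst_constNonneg (k := k) (X := MR M) φ W').exists_sup (N := N)
    (fun p hp => by
      obtain ⟨r, hr⟩ := (hN p).1 hp.1
      rw [hneg] at hr ⊢
      exact ⟨hp.2, (((hV p.1 hp.2.1).2 _ hr.1.2.1 hr.1.2.2).2 p.2 hp.2.2.1
        (le_add_of_nonneg_right r.2)).trans_lt hr.2⟩)
    (fun p hp => (hN p).2 ⟨⟨0, Set.mem_Ici.2 le_rfl⟩, by rwa [add_zero]⟩)
  have hNd : ∀ x t t', (x, t) ∈ N → t' ≤ t → (x, t') ∈ N := by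
    intro x t t' h htt
    obtain ⟨r, hr⟩ := (hN _).1 h
    refine (hN _).2 ⟨⟨r + (t - t'), add_nonneg r.2 (sub_nonneg.2 htt)⟩, ?_⟩
    rwa [show t' + (r + (t - t')) = t + r by ring]
  have hWd : ∀ x t t', (x, t) ∈ N ⊔ W' → t' ≤ t → (x, t') ∈ N ⊔ W' := by
    rintro x t t' (h | h) htt
    · exact Or.inl (hNd x t t' h htt)
    · by_cases hat : a < t'
      · exact Or.inr ⟨h.1, hat, htt.trans_lt h.2.2⟩
      · refine Or.inl (hNd x a' t' ((hN _).2 ⟨⟨0, Set.mem_Ici.2 le_rfl⟩, ?_⟩)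
          ((not_lt.1 hat).trans ha.le))
        rw [add_zero, hneg]
        exact ⟨⟨h.1, ha, hax.trans hxb⟩, (hV x h.1).1⟩
  exact ⟨W', hW', ⟨hxV, ha.trans hax, hxb⟩, ht.isDescending hNd hWd⟩

/-- An object that receives no morphism from descending objects has its microsupport in
`{τ ≤ 0}`. -/
lemma NZ_of_isDescending {C : Db k (MR M)}
    (hC : ∀ (S : Sh k (MR M)), (∀ n, IsDescending ((dbSingle _ n).obj S)) →
      ∀ (n : ℤ) (α : (dbSingle _ n).obj S ⟶ C), α = 0) : NZ k E M C := by
  rw [NZ_iff]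
  intro x φ Ω hx hφ h0 hd n W hW hxW α
  obtain ⟨W', hW', hx', h⟩ := exists_isDescending_constNonneg (k := k) hxW hW hφ h0 hd
  exact ⟨W', hW', hx', hom_eq_zero_of_dbSingle (hC _ h n) _⟩

variable (E) in
/-- The evaluation `F ⋆ k_{M × [c, ∞)} ⟶ T_{c*} F` is an isomorphism in `D^b(k^γ_M)`. -/
theorem isIso_convEval {c : ℝ} {F P : Db k (MR M)}
    {ε : (pull k (convSum M c)).obj P ⟶ (pull k (convProj M c)).obj F} (hε : IsConv c F P ε) :
    IsIso ((Qgamma k E M).map (convEval le_rfl ε)) := by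
  obtain ⟨C, g, h, hT⟩ := Pretriangulated.distinguished_cocone_triangle (convEval le_rfl ε)
  -- The cone receives no morphism from the descending objects.
  have hC : NZ k E M C := by
    refine NZ_of_isDescending fun S hS n α => ?_
    obtain ⟨β, hβ⟩ := Pretriangulated.Triangle.coyoneda_exact₃ _ hT α
      (hom_eq_zero_of_comp_shift (f := convEval le_rfl ε) (dbSingleShift S n)
        (fun γ hγ => ((hS (n + 1)).bijective_comp_convEval hε).1 (hγ.trans zero_comp.symm)) _ (by
          exact (Category.assoc _ _ _).trans ((congrArg (CategoryStruct.comp α)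
            (Pretriangulated.comp_distTriang_mor_zero₃₁ _ hT)).trans comp_zero)))
    obtain ⟨a, rfl⟩ := ((hS n).bijective_comp_convEval hε).2 β
    rw [hβ]
    exact (Category.assoc _ _ _).trans ((congrArg (CategoryStruct.comp a)
      (Pretriangulated.comp_distTriang_mor_zero₁₂ _ hT)).trans comp_zero)
  exact Localization.inverts _ (NZ k E M).trW _ (ObjectProperty.trW.mk _ hT hC)

end Vanishing

/-! ### Translations and microsupport -/

section Triangulated

open Pretriangulated

variable {C₁ C₂ : Type (u + 1)} [Category.{u} C₁] [Category.{u} C₂] [Abelian C₁] [Abelian C₂]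
  [HasDerivedCategory.{u+1} C₁] [HasDerivedCategory.{u+1} C₂]
  (L : C₁ ⥤ C₂) [L.Additive] [PreservesFiniteLimits L] [PreservesFiniteColimits L]

instance : (dbMap L).CommShift ℤ := by
  unfold dbMap; infer_instance

instance : (dbMap L).IsTriangulated := by
  unfold dbMap; infer_instance

end Triangulated

section RelConst

variable {k : Type u} [CommRing k] {X : TopCat.{u}}

lemma IsRelConst.congr {N N' W : Opens X} {h : N ≤ W} (h' : N' ≤ W) (hN : N' = N) {S : Sh k X}
    {s : Sec S W} (hs : IsRelConst h S s) : IsRelConst h' S s := by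
  subst hN
  exact hs

lemma IsRelConst.isIso {N W : Opens X} {h : N ≤ W} {S S' : Sh k X} {s : Sec S W} {s' : Sec S' W}
    (hs : IsRelConst h S s) (hs' : IsRelConst h S' s') {φ : S ⟶ S'} (hφ : secMap φ W s = s') :
    IsIso φ := by
  obtain ⟨ψ, hψ⟩ := hs'.exists_hom S s hs.res_eq_zero
  exact ⟨ψ, hs.hom_ext (by rw [secMap_comp, hφ, hψ]; rfl),
    hs'.hom_ext (by rw [secMap_comp, hψ, hφ]; rfl)⟩

lemma secMap_constNonnegMap (φ : X → ℝ) {W' W : Opens X} (h : W' ≤ W) :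
    secMap (constNonnegMap k φ h) W' (toSec (constNonnegProj k φ W')) =
      res _ h (toSec (constNonnegProj k φ W)) := by
  rw [← toSec_comp, constNonnegProj_map, toSec_map]

lemma comp_comp_eq_of_squares {C : Type*} [Category* C] {A A' B B' D D' Y : C} {a : A ⟶ A'}
    {b : A ⟶ B} {b' : A' ⟶ B'} {c : B ⟶ B'} {d : B ⟶ D} {d' : B' ⟶ D'} {f : D ⟶ D'} {g : D' ⟶ Y}
    (h : a ≫ b' = b ≫ c) (h' : c ≫ d' = d ≫ f) : a ≫ b' ≫ d' ≫ g = b ≫ d ≫ f ≫ g := by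
  rw [reassoc_of% h, reassoc_of% h']

lemma eq_zero_of_comp_isIso_comp {C : Type*} [Category* C] [Preadditive C] {A B D Y : C} {a : A ⟶ B}
    {b : B ⟶ D} {c : D ⟶ Y} [IsIso a] [IsIso b] (h : a ≫ b ≫ c = 0) : c = 0 := by
  rwa [← cancel_epi b, ← cancel_epi a, comp_zero, comp_zero]

/-- Transport of the vanishing of `(RΓ_{φ ≥ 0} F)_x` by a homeomorphism `T` of inverse `T'`. -/
lemma StalkVanishes.of_pull {T T' : X ⟶ X} (hT : T ≫ T' = 𝟙 X) (hT' : T' ≫ T = 𝟙 X) {F : Db k X}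
    {φ φ' : X → ℝ} {Ω : Opens X} {x : X}
    (hφ : ∀ W : Opens X, IsRelConst (negPart_le φ' ((Opens.map T').obj W))
      ((TopCat.Sheaf.pullback (ModuleCat.{u} k) T').obj (constNonneg k φ W))
      (pullSec T' _ (toSec (constNonnegProj k φ W))))
    (h : StalkVanishes F.obj φ' ((Opens.map T').obj Ω) (T x)) :
    StalkVanishes ((SheafTorsion.pull k T).obj F).obj φ Ω x := by
  have hx (y : X) : T' (T y) = y := congrArg (fun f => f y) hT
  have hx' (y : X) : T (T' y) = y := congrArg (fun f => f y) hT'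
  intro n W hW hxW α
  -- The isomorphisms `e W` identify the inverse image of `k_{W ∩ {φ ≥ 0}}` with the analogous sheaf
  -- for `φ'`.
  choose e he using fun W => (isRelConst_constNonneg (k := k) φ' ((Opens.map T').obj W)).exists_hom
    _ _ (hφ W).res_eq_zero
  have he' (W) : IsIso (e W) := (isRelConst_constNonneg φ' _).isIso (hφ W) (he W)
  have hnat {W' W : Opens X} (hW' : W' ≤ W) : e W' ≫
      (TopCat.Sheaf.pullback (ModuleCat.{u} k) T').map (constNonnegMap k φ hW') =
        constNonnegMap k φ' ((Opens.map T').monotone hW') ≫ e W := by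
    refine (isRelConst_constNonneg φ' _).hom_ext ?_
    rw [secMap_comp, secMap_comp, secMap_constNonnegMap, secMap_res, he, he, secMap_map_pullSec,
      secMap_constNonnegMap, res_pullSec]
  let α' : (dbSingle _ n).obj (constNonneg k φ W) ⟶ (SheafTorsion.pull k T).obj F :=
    ObjectProperty.homMk α
  let i := (pullIso k T' T hT').hom.app F ≫ (pullId k rfl).hom.app F
  -- `β` is `α`, transported by `T'`.
  let β : (dbSingle _ n).obj (constNonneg k φ' ((Opens.map T').obj W)) ⟶ F :=
    (dbSingle _ n).map (e W) ≫ (dbSingleMap _ n).inv.app _ ≫ (SheafTorsion.pull k T').map α' ≫ i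
  have hβ (W' : Opens X) (hW' : W' ≤ W) :
      (dbSingle _ n).map (constNonnegMap k φ' ((Opens.map T').monotone hW')) ≫ β =
        (dbSingle _ n).map (e W') ≫ (dbSingleMap _ n).inv.app _ ≫ (SheafTorsion.pull k T').map
          ((dbSingle _ n).map (constNonnegMap k φ hW') ≫ α') ≫ i := by
    have h₁ := congrArg (dbSingle _ n).map (hnat hW')
    have h₂ := (dbSingleMap (TopCat.Sheaf.pullback (ModuleCat.{u} k) T') n).inv.naturality
      (constNonnegMap k φ hW')
    rw [Functor.map_comp, Functor.map_comp] at h₁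
    rw [Functor.map_comp, Category.assoc]
    exact comp_comp_eq_of_squares h₁.symm h₂
  obtain ⟨W', hW', hxW', h0⟩ := h n ((Opens.map T').obj W) ((Opens.map T').monotone hW)
    (by change T' (T x) ∈ W; rwa [hx]) β.hom
  have hle : (Opens.map T).obj W' ≤ W := fun y hy => by
    have := hW' hy
    change T' (T y) ∈ W at this
    rwa [hx] at this
  have hle' : (Opens.map T').obj ((Opens.map T).obj W') ≤ W' := fun y hy => by
    change T (T' y) ∈ W' at hy
    rwa [hx'] at hy
  refine ⟨(Opens.map T).obj W', hle, hxW', ?_⟩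
  have h0' : (dbSingle _ n).map (constNonnegMap k φ' hW') ≫ β = 0 := ObjectProperty.hom_ext _ h0
  have h1 : (dbSingle _ n).map (constNonnegMap k φ' ((Opens.map T').monotone hle)) ≫ β = 0 := by
    rw [constNonnegMap_comp k φ' hle' hW', Functor.map_comp, Category.assoc, h0', comp_zero]
  have h2 := (hβ _ hle).symm.trans h1
  have h3 := pull_map_pull_map_injective T T' hT (congrArg (SheafTorsion.pull k T).map
    ((cancel_mono i).1 ((eq_zero_of_comp_isIso_comp h2).trans (zero_comp.symm.trans
      (congrArg (· ≫ i) (Functor.map_zero (SheafTorsion.pull k T') _ _).symm)))))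
  exact congrArg (fun α => α.hom) h3

end RelConst

section Translation

variable {E : Type u} [NormedAddCommGroup E] [NormedSpace ℝ E]
variable {M : Type u} [TopologicalSpace M] [ChartedSpace E M]

/-- The value of `τ` at `dφ` is the partial derivative of `φ` with respect to `t`. -/
lemma mfderiv_vertical {φ : M × ℝ → ℝ} {x : M × ℝ}
    (hφ : MDifferentiableAt (modelMR E) (modelWithCornersSelf ℝ ℝ) φ x) :
    mfderiv (modelMR E) (modelWithCornersSelf ℝ ℝ) φ x (show E × ℝ from (0, 1)) =
      deriv (fun t => φ (x.1, t)) x.2 := by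
  have h := mfderiv_comp (I := modelWithCornersSelf ℝ ℝ) (I' := modelMR E)
    (I'' := modelWithCornersSelf ℝ ℝ) x.2 (g := φ) (f := fun t => (x.1, t)) hφ
    ((contMDiff_const.prodMk contMDiff_id (n := 1)).mdifferentiable one_ne_zero x.2)
  rw [mfderiv_prod_right, mfderiv_eq_fderiv] at h
  have := congrArg (fun L : ℝ →L[ℝ] ℝ => L 1) h
  exact this.symm

lemma contMDiff_translation (c : ℝ) :
    ContMDiff (modelMR E) (modelMR E) 1 (fun p : M × ℝ => (p.1, p.2 + c)) :=
  contMDiff_fst.prodMk (((contDiff_id.add contDiff_const).contMDiff (n := 1)).comp contMDiff_snd)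

variable {k : Type u} [CommRing k]

omit [ChartedSpace E M] in
lemma negPart_translation (φ : M × ℝ → ℝ) (W : Opens (MR M)) (c : ℝ) :
    negPart (X := MR M) (fun p => φ (p.1, p.2 + c)) ((Opens.map (translation M c)).obj W) =
      (Opens.map (translation M c)).obj (negPart (X := MR M) φ W) := by
  let h : M × ℝ ≃ₜ M × ℝ := (Homeomorph.refl M).prodCongr (Homeomorph.addRight c)
  exact Opens.ext (h.preimage_interior {p | p ∈ W ∧ φ p < 0}).symm

omit [ChartedSpace E M] in
/-- The inverse image of `k_{φ ≥ 0}` by a translation. -/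
lemma isRelConst_pull_translation (φ : M × ℝ → ℝ) (W : Opens (MR M)) (c : ℝ) :
    IsRelConst (negPart_le (X := MR M) (fun p => φ (p.1, p.2 + c))
        ((Opens.map (translation M c)).obj W))
      ((TopCat.Sheaf.pullback (ModuleCat.{u} k) (translation M c)).obj
        (constNonneg (X := MR M) k φ W))
      (pullSec (translation M c) _ (toSec (constNonnegProj (X := MR M) k φ W))) := by
  have h := (isRelConst_constNonneg (k := k) (X := MR M) φ W).pull (translation M c)
  exact h.congr _ (negPart_translation φ W c)

variable [IsManifold (modelWithCornersSelf ℝ E) ∞ M]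

/-- The condition `SS(F) ⊆ {τ ≤ 0}` is invariant under translations. -/
lemma NZ_pull_translation (c : ℝ) {F : Db k (MR M)} (hF : NZ k E M F) :
    NZ k E M ((pull k (translation M c)).obj F) := by
  rw [NZ_iff] at hF ⊢
  intro x φ Ω hx hφ h0 hd
  let T := translation M c
  let T' := translation M (-c)
  have hT : T ≫ T' = 𝟙 _ := by rw [translation_comp, add_neg_cancel, translation_zero]
  have hT' : T' ≫ T = 𝟙 _ := by rw [translation_comp, neg_add_cancel, translation_zero]
  have hx' : (x.1, x.2 + c + -c) = x := Prod.ext rfl (add_neg_cancel_right _ _)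
  have hφ' : ContMDiffOn (modelMR E) (modelWithCornersSelf ℝ ℝ) 1
      (fun p : M × ℝ => φ (p.1, p.2 + -c)) ((Opens.map T').obj Ω : Opens (MR M)) :=
    hφ.comp (contMDiff_translation (-c)).contMDiffOn fun p hp => hp
  have hxΩ : (x.1, x.2 + c) ∈ (Opens.map T').obj Ω := by
    change (x.1, x.2 + c + -c) ∈ Ω
    rwa [hx']
  have hd' : (0 : ℝ) < mfderiv (modelMR E) (modelWithCornersSelf ℝ ℝ)
      (fun p : M × ℝ => φ (p.1, p.2 + -c)) (x.1, x.2 + c) (show E × ℝ from (0, 1)) := by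
    rw [mfderiv_vertical (((hφ x hx).contMDiffAt (Ω.isOpen.mem_nhds hx)).mdifferentiableAt
      one_ne_zero)] at hd
    rw [mfderiv_vertical (((hφ' _ hxΩ).contMDiffAt
      (((Opens.map T').obj Ω).isOpen.mem_nhds hxΩ)).mdifferentiableAt one_ne_zero)]
    have := deriv_comp_add_const (fun t => φ (x.1, t)) (-c) (x.2 + c)
    rw [add_neg_cancel_right] at this
    exact hd.trans_eq this.symm
  have hF' := hF (x.1, x.2 + c) _ _ hxΩ hφ' ((congrArg φ hx').trans h0) hd'
  exact StalkVanishes.of_pull (X := MR M) hT hT' (fun W => isRelConst_pull_translation φ W (-c)) hF'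

end Translation

/-! ### Restriction of morphisms between inverse images -/

section Restrict

variable {k : Type u} [CommRing k] {A A' B B' Y Y' Y'' : TopCat.{u}}

/-- The restriction along `j` of a morphism `s⁻¹ P ⟶ q⁻¹ F`. -/
def restrict (j : Y' ⟶ Y) {s : Y ⟶ A} {q : Y ⟶ B} {s' : Y' ⟶ A} {q' : Y' ⟶ B} (hs : j ≫ s = s')
    (hq : j ≫ q = q') {P : Db k A} {F : Db k B} (ε : (pull k s).obj P ⟶ (pull k q).obj F) :
    (pull k s').obj P ⟶ (pull k q').obj F :=
  (pullIso k j s hs).inv.app P ≫ (pull k j).map ε ≫ (pullIso k j q hq).hom.app F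

variable {s : Y ⟶ A} {q : Y ⟶ B} {P : Db k A} {F : Db k B}

lemma pullIso_hom_restrict (j : Y' ⟶ Y) {s' : Y' ⟶ A} {q' : Y' ⟶ B} (hs : j ≫ s = s')
    (hq : j ≫ q = q') (ε : (pull k s).obj P ⟶ (pull k q).obj F) :
    (pullIso k j s hs).hom.app P ≫ restrict j hs hq ε =
      (pull k j).map ε ≫ (pullIso k j q hq).hom.app F :=
  Iso.hom_inv_id_app_assoc _ _ _

lemma comp_comp_eq_of_triangles {C : Type*} [Category* C] {X₁ X₂ X₃ X₄ X₅ X₆ X₇ : C} {a : X₁ ⟶ X₂}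
    {b : X₂ ⟶ X₃} {c : X₁ ⟶ X₄} {d : X₄ ⟶ X₃} {e : X₁ ⟶ X₅} {f : X₄ ⟶ X₆} {g : X₅ ⟶ X₆}
    {r : X₃ ⟶ X₇} {t : X₆ ⟶ X₇} (h₁ : a ≫ b = c ≫ d) (h₂ : e ≫ g = c ≫ f) (h₃ : d ≫ r = f ≫ t) :
    e ≫ g ≫ t = a ≫ b ≫ r := by
  rw [reassoc_of% h₁, h₃, reassoc_of% h₂]

lemma restrict_restrict (j' : Y'' ⟶ Y') (j : Y' ⟶ Y) {l : Y'' ⟶ Y} (hl : j' ≫ j = l)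
    {s' : Y' ⟶ A} {q' : Y' ⟶ B} (hs : j ≫ s = s') (hq : j ≫ q = q') {s'' : Y'' ⟶ A}
    {q'' : Y'' ⟶ B} (hs' : j' ≫ s' = s'') (hq' : j' ≫ q' = q'') (hs'' : l ≫ s = s'')
    (hq'' : l ≫ q = q'') (ε : (pull k s).obj P ⟶ (pull k q).obj F) :
    restrict j' hs' hq' (restrict j hs hq ε) = restrict l hs'' hq'' ε := by
  rw [← cancel_epi ((pullIso k j' s' hs').hom.app P), pullIso_hom_restrict,
    ← cancel_epi ((pull k j').map ((pullIso k j s hs).hom.app P)), ← Functor.map_comp_assoc,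
    pullIso_hom_restrict, Functor.map_comp, Category.assoc,
    pullIso_assoc F j' j q hl hq hq' hq'']
  have h₁ := pullIso_assoc P j' j s hl hs hs' hs''
  have h₂ := (pullIso k j' j hl).hom.naturality ε
  have h₃ := pullIso_hom_restrict l hs'' hq'' ε
  exact comp_comp_eq_of_triangles h₁ h₂ h₃

lemma restrict_comp (j : Y' ⟶ Y) {s' : Y' ⟶ A} {q' : Y' ⟶ B} (hs : j ≫ s = s')
    (hq : j ≫ q = q') (ε : (pull k s).obj P ⟶ (pull k q).obj F) {F' : Db k B} (f : F ⟶ F') :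
    restrict j hs hq (ε ≫ (pull k q).map f) = restrict j hs hq ε ≫ (pull k q').map f := by
  have h := (pullIso k j q hq).hom.naturality f
  rw [restrict, Functor.map_comp, Category.assoc]
  refine (whisker_eq _ (whisker_eq _ h)).trans ?_
  simp [restrict]

lemma restrict_map_comp (j : Y' ⟶ Y) {s' : Y' ⟶ A} {q' : Y' ⟶ B} (hs : j ≫ s = s')
    (hq : j ≫ q = q') (ε : (pull k s).obj P ⟶ (pull k q).obj F) {P' : Db k A} (a : P' ⟶ P) :
    restrict j hs hq ((pull k s).map a ≫ ε) = (pull k s').map a ≫ restrict j hs hq ε := by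
  have h := (pullIso k j s hs).inv.naturality a
  rw [restrict, Functor.map_comp, Category.assoc]
  refine ((Category.assoc _ _ _).symm.trans (eq_whisker h.symm _)).trans ?_
  simp [restrict]

/-- A morphism `s⁻¹ P ⟶ q⁻¹ F` induces a morphism from `P` to the restriction of `q⁻¹ F` to a
section `i` of `s`. -/
def evalMap (i : A ⟶ Y) {q' : A ⟶ B} (hs : i ≫ s = 𝟙 A) (hq : i ≫ q = q')
    (ε : (pull k s).obj P ⟶ (pull k q).obj F) : P ⟶ (pull k q').obj F :=
  (pullId k rfl).inv.app P ≫ restrict i hs hq ε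

section Eval

variable (i : A ⟶ Y) {q' : A ⟶ B} (hs : i ≫ s = 𝟙 A) (hq : i ≫ q = q')
  (ε : (pull k s).obj P ⟶ (pull k q).obj F)

lemma evalMap_comp {F' : Db k B} (f : F ⟶ F') :
    evalMap i hs hq (ε ≫ (pull k q).map f) = evalMap i hs hq ε ≫ (pull k q').map f := by
  rw [evalMap, restrict_comp, evalMap, Category.assoc]

lemma evalMap_map_comp {P' : Db k A} (a : P' ⟶ P) :
    evalMap i hs hq ((pull k s).map a ≫ ε) = a ≫ evalMap i hs hq ε := by
  have h := (pullId k (rfl : 𝟙 A = 𝟙 A)).inv.naturality a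
  rw [evalMap, restrict_map_comp, evalMap]
  refine (Category.assoc _ _ _).symm.trans ((eq_whisker h.symm _).trans ?_)
  exact Category.assoc _ _ _

lemma evalMap_restrict (j : Y' ⟶ Y) {s' : Y' ⟶ A} {r : Y' ⟶ B} (hs' : j ≫ s = s')
    (hr : j ≫ q = r) (i' : A ⟶ Y') (hi : i' ≫ j = i) (hi' : i' ≫ s' = 𝟙 A) (hq' : i' ≫ r = q') :
    evalMap i' hi' hq' (restrict j hs' hr ε) = evalMap i hs hq ε := by
  rw [evalMap, restrict_restrict i' j hi hs' hr hi' hq' hs hq, evalMap]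

/-- Compatibility of the evaluation with a further inverse image of `F`. -/
lemma evalMap_pullIso (i : A ⟶ Y) {q' : A ⟶ B} (hs : i ≫ s = 𝟙 A) (hq : i ≫ q = q') {r : B ⟶ B'}
    {F : Db k B'} (ε : (pull k s).obj P ⟶ (pull k q).obj ((pull k r).obj F)) {qr : Y ⟶ B'}
    {qr' : A ⟶ B'} (h : q ≫ r = qr) (h' : q' ≫ r = qr') (h'' : i ≫ qr = qr') :
    evalMap i hs h'' (ε ≫ (pullIso k q r h).hom.app F) =
      evalMap i hs hq ε ≫ (pullIso k q' r h').hom.app F := by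
  have := pullIso_assoc F i q r hq h h'' h'
  rw [evalMap, restrict, Functor.map_comp, Category.assoc, this]
  simp [evalMap, restrict]

lemma inv_comp_eq_of_comp_eq {C : Type*} [Category* C] {X₁ X₂ X₃ X₄ X₆ : C} {u : X₁ ⟶ X₂}
    {u' : X₂ ⟶ X₁} (hu : u' ≫ u = 𝟙 _) {a : X₃ ⟶ X₁} [Epi a] {b : X₃ ⟶ X₄} {c : X₄ ⟶ X₂}
    {x : X₁ ⟶ X₆} {y : X₂ ⟶ X₆} (h₁ : b ≫ c = a ≫ u) (h₂ : a ≫ x = b ≫ c ≫ y) : u' ≫ x = y := by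
  rw [reassoc_of% h₁, cancel_epi] at h₂
  rw [h₂, reassoc_of% hu]

/-- Compatibility of the evaluation with the inverse image of `P`. -/
lemma evalMap_pullIso_comp (i : A ⟶ Y) {q' : A ⟶ B} (hs : i ≫ s = 𝟙 A) (hq : i ≫ q = q')
    {r : A ⟶ A'} {P : Db k A'} {s' : Y ⟶ A'} (hs' : s ≫ r = s') (hi : i ≫ s' = r)
    (ε : (pull k s').obj P ⟶ (pull k q).obj F) :
    evalMap i hs hq ((pullIso k s r hs').hom.app P ≫ ε) = restrict i hi hq ε := by
  have h₁ := pullIso_assoc P i s r hs hs' hi (Category.id_comp r)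
  have h₂ := pullIso_id_app P (rfl : 𝟙 A = 𝟙 A) r (Category.id_comp r)
  have h₃ := pullIso_hom_restrict i hi hq ε
  have h₄ := pullIso_hom_restrict i hs hq ((pullIso k s r hs').hom.app P ≫ ε)
  rw [h₂] at h₁
  rw [Functor.map_comp, Category.assoc, ← h₃] at h₄
  exact inv_comp_eq_of_comp_eq ((pullId k rfl).inv_hom_id_app _) h₁ h₄

/-- Compatibility of the evaluation with the inverse image by `r`. -/
lemma pull_map_evalMap (i : A ⟶ Y) {q' : A ⟶ B} (hs : i ≫ s = 𝟙 A) (hq : i ≫ q = q') (r : A' ⟶ A)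
    (ε : (pull k s).obj P ⟶ (pull k q).obj F) {l : A' ⟶ Y} {l' : A' ⟶ B} (hl : r ≫ i = l)
    (hl' : l ≫ s = r) (hlq : l ≫ q = l') (h : r ≫ q' = l') :
    (pull k r).map (evalMap i hs hq ε) ≫ (pullIso k r q' h).hom.app F = restrict l hl' hlq ε := by
  have h₁ := restrict_restrict r i hl hs hq (Category.comp_id r) h hl' hlq ε
  have h₂ := pullIso_map_id P r (rfl : 𝟙 A = 𝟙 A) (Category.comp_id r)
  rw [← h₁, evalMap, Functor.map_comp, Category.assoc,
    ← pullIso_hom_restrict r (Category.comp_id r), ← h₂, ← Functor.map_comp_assoc,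
    Iso.inv_hom_id_app]
  exact (eq_whisker (CategoryTheory.Functor.map_id _ _) _).trans (Category.id_comp _)

end Eval

lemma convEval_eq_evalMap {M : Type u} [TopologicalSpace M] {c e : ℝ} (h : c ≤ e)
    {F P : Db k (MR M)} (ε : (pull k (convSum M c)).obj P ⟶ (pull k (convProj M c)).obj F) :
    convEval h ε = evalMap (convSlice M h) (convSlice_sum M h) (convSlice_proj M h) ε ≫
      (pullTr k M e).hom.app F := by
  have h₁ : (sliceSumIso k M h).inv.app P = (pullId k rfl).inv.app P ≫
      (pullIso k (convSlice M h) (convSum M c) (convSlice_sum M h)).inv.app P := by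
    rw [← cancel_epi ((sliceSumIso k M h).hom.app P), Iso.hom_inv_id_app, sliceSumIso_hom_app]
    simp
  rw [convEval, h₁, sliceProjIso_hom_app]
  simp [evalMap, restrict]

end Restrict

/-! ### The morphisms between translates -/

section Tau

variable {k : Type u} [CommRing k]

section Eval

variable (k) (M : Type u) [TopologicalSpace M]

/-- The translation functor `T_{c*}`, in the form of the inverse image by the translation by
`-c`. -/
abbrev transl (c : ℝ) : Db k (MR M) ⥤ Db k (MR M) := pull k (translation M (-c))

lemma translation_neg_comp {c d e : ℝ} (h : c + d = e) :
    translation M (-c) ≫ translation M (-d) = translation M (-e) := by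
  rw [translation_comp, ← h, neg_add]

/-- `T_{c*} T_{d*} = T_{(c + d)*}`. -/
def translAdd {c d e : ℝ} (h : c + d = e) : transl k M d ⋙ transl k M c ≅ transl k M e :=
  pullIso k _ _ (translation_neg_comp M h)

lemma translation_neg_zero : translation M (-0) = 𝟙 _ := by rw [neg_zero, translation_zero]

/-- `T_{0*} = id`. -/
def translZero : transl k M 0 ≅ 𝟭 _ := pullId k (translation_neg_zero M)

variable {M}

lemma translAdd_zero_left (c : ℝ) (F : Db k (MR M)) :
    (translAdd k M (zero_add c)).hom.app F = (translZero k M).hom.app ((transl k M c).obj F) :=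
  pullIso_id_app F _ _ _

lemma translAdd_zero_right (c : ℝ) (F : Db k (MR M)) :
    (translAdd k M (add_zero c)).hom.app F = (transl k M c).map ((translZero k M).hom.app F) :=
  (pullIso_map_id F _ _ _).symm

variable {k}

/-- The evaluation `F ⋆ k_{M × [c, ∞)} ⟶ T_{e*} F`, in terms of inverse images by translations. -/
def translEval {c e : ℝ} (h : c ≤ e) {F P : Db k (MR M)}
    (ε : (pull k (convSum M c)).obj P ⟶ (pull k (convProj M c)).obj F) :
    P ⟶ (transl k M e).obj F :=
  evalMap (convSlice M h) (convSlice_sum M h) (convSlice_proj M h) ε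

lemma convEval_eq {c e : ℝ} (h : c ≤ e) {F P : Db k (MR M)}
    (ε : (pull k (convSum M c)).obj P ⟶ (pull k (convProj M c)).obj F) :
    convEval h ε = translEval h ε ≫ (pullTr k M e).hom.app F :=
  convEval_eq_evalMap h ε

/-- The evaluations on the slices of `[c, ∞)` are obtained by restriction from `[b, ∞)` to
`[c, ∞)`. -/
lemma exists_translEval_eq {b c : ℝ} (h : b ≤ c) {F P : Db k (MR M)}
    (ε : (pull k (convSum M b)).obj P ⟶ (pull k (convProj M b)).obj F) :
    ∃ η : (pull k (convSum M c)).obj P ⟶ (pull k (convProj M c)).obj F,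
      ∀ (e : ℝ) (h' : c ≤ e), translEval h' η = translEval (h.trans h') ε := by
  let κ : MRc M c ⟶ MRc M b := TopCat.ofHom ⟨fun p => (p.1, ⟨p.2, h.trans p.2.2⟩), by fun_prop⟩
  have hs : κ ≫ convSum M b = convSum M c := rfl
  have hq : κ ≫ convProj M b = convProj M c := rfl
  refine ⟨restrict κ hs hq ε, fun e h' => ?_⟩
  have hκ : convSlice M h' ≫ κ = convSlice M (h.trans h') := rfl
  exact evalMap_restrict _ _ _ ε κ hs hq _ hκ _ _

/-- The half-line `[a, ∞)` for `T_{c*} F` is the half-line `[a + c, ∞)` for `F`: the sums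
`t + u` agree under `(t, u) ↦ (t + c, u - c)`. -/
lemma exists_translEval_translAdd {a a' c : ℝ} (ha : a + c = a') {F P : Db k (MR M)}
    (ε : (pull k (convSum M a)).obj P ⟶ (pull k (convProj M a)).obj ((transl k M c).obj F)) :
    ∃ η : (pull k (convSum M a')).obj P ⟶ (pull k (convProj M a')).obj F,
      ∀ (d d' : ℝ) (hd : d + c = d') (h : a ≤ d) (h' : a' ≤ d'),
        translEval h' η = translEval h ε ≫ (translAdd k M hd).hom.app F := by
  let κ : MRc M a' ⟶ MRc M a := TopCat.ofHom ⟨fun p => ((p.1.1, p.1.2 + c), ⟨p.2 - c, by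
    have : a' ≤ p.2 := p.2.2
    rw [Set.mem_Ici]
    linarith⟩), by fun_prop⟩
  have hs : κ ≫ convSum M a = convSum M a' :=
    TopCat.hom_ext (ContinuousMap.ext fun p => Prod.ext rfl
      (show p.1.2 + c + (p.2 - c) = p.1.2 + p.2 by ring))
  have hq : κ ≫ convProj M a ≫ translation M (-c) = convProj M a' :=
    TopCat.hom_ext (ContinuousMap.ext fun p => Prod.ext rfl (add_neg_cancel_right p.1.2 c))
  refine ⟨restrict κ hs hq (ε ≫ (pullIso k _ _ rfl).hom.app F), fun d d' hd h h' => ?_⟩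
  have hκ : convSlice M h' ≫ κ = convSlice M h :=
    TopCat.hom_ext (ContinuousMap.ext fun p => Prod.ext
      (Prod.ext rfl (show p.2 - d' + c = p.2 - d by rw [← hd]; ring))
      (Subtype.ext (show d' - c = d by rw [← hd]; ring)))
  have hd' := translation_neg_comp M hd
  have hq' : convSlice M h ≫ convProj M a ≫ translation M (-c) = translation M (-d') := by
    rw [← hd', ← convSlice_proj M h, Category.assoc]
  exact (evalMap_restrict _ (convSlice_sum M h) hq' _ κ hs hq _ hκ _ _).trans
    (evalMap_pullIso _ _ _ ε rfl hd' hq')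

/-- The translate of the evaluations for the half-line `[a, ∞)` gives those for `[c + a, ∞)`, by
the map `(t, u) ↦ (t, u - c)`. -/
lemma exists_translEval_map {a a' c : ℝ} (ha : c + a = a') {F P : Db k (MR M)}
    (ε : (pull k (convSum M a)).obj P ⟶ (pull k (convProj M a)).obj F) :
    ∃ η : (pull k (convSum M a')).obj ((transl k M c).obj P) ⟶ (pull k (convProj M a')).obj F,
      ∀ (d d' : ℝ) (hd : c + d = d') (h : a ≤ d) (h' : a' ≤ d'),
        translEval h' η = (transl k M c).map (translEval h ε) ≫ (translAdd k M hd).hom.app F := by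
  -- `κ` lies over the translation by `-c` for the sums, and over the identity for the projections.
  let κ : MRc M a' ⟶ MRc M a := TopCat.ofHom ⟨fun p => (p.1, ⟨p.2 - c, by
    have : a' ≤ p.2 := p.2.2
    rw [Set.mem_Ici]
    linarith⟩), by fun_prop⟩
  have hs : κ ≫ convSum M a = convSum M a' ≫ translation M (-c) :=
    TopCat.hom_ext (ContinuousMap.ext fun p => Prod.ext rfl
      (show p.1.2 + (p.2 - c) = p.1.2 + p.2 + -c by ring))
  have hq : κ ≫ convProj M a = convProj M a' := rfl
  refine ⟨(pullIso k (convSum M a') (translation M (-c)) rfl).hom.app P ≫ restrict κ hs hq ε,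
    fun d d' hd h h' => ?_⟩
  have hκ : convSlice M h' ≫ κ = translation M (-c) ≫ convSlice M h :=
    TopCat.hom_ext (ContinuousMap.ext fun p => Prod.ext
      (Prod.ext rfl (show p.2 - d' = p.2 + -c - d by rw [← hd]; ring))
      (Subtype.ext (show d' - c = d by rw [← hd]; ring)))
  have hd' := translation_neg_comp M hd
  have h₁ : convSlice M h' ≫ convSum M a' ≫ translation M (-c) = translation M (-c) := by
    rw [← Category.assoc, convSlice_sum, Category.id_comp]
  have h₂ : (translation M (-c) ≫ convSlice M h) ≫ convSum M a = translation M (-c) := by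
    rw [Category.assoc, convSlice_sum, Category.comp_id]
  have h₃ : (translation M (-c) ≫ convSlice M h) ≫ convProj M a = translation M (-d') := by
    rw [Category.assoc, convSlice_proj, hd']
  refine (evalMap_pullIso_comp _ _ _ _ h₁ _).trans
    ((restrict_restrict _ κ hκ hs hq h₁ (convSlice_proj M h') h₂ h₃ ε).trans ?_)
  exact (pull_map_evalMap _ _ _ (translation M (-c)) ε rfl h₂ h₃ hd').symm

end Eval

variable {E : Type u} [NormedAddCommGroup E] [NormedSpace ℝ E] [FiniteDimensional ℝ E]
variable {M : Type u} [TopologicalSpace M] [T2Space M] [SecondCountableTopology M]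
  [ChartedSpace E M] [IsManifold (modelWithCornersSelf ℝ E) ∞ M]

variable (E) in
lemma nonempty_convData (c : ℝ) (F : Db k (MR M)) : Nonempty (ConvData E c F) := by
  obtain ⟨P, ε, h⟩ := exists_isConv E c F
  exact ⟨⟨P, ε, h, isIso_convEval E h⟩⟩

variable (E) in
/-- `τ_{c,d}(F)` is characterized by its compatibility with the evaluations. -/
lemma convEval_comp_tau {c d : ℝ} (h : c ≤ d) {F H : Db k (MR M)}
    (η : (pull k (convSum M c)).obj H ⟶ (pull k (convProj M c)).obj F) :
    (Qgamma k E M).map (convEval le_rfl η) ≫ tau E h F = (Qgamma k E M).map (convEval h η) := by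
  have hF := nonempty_convData (k := k) E c F
  rw [tau, dif_pos hF]
  -- By the universal property of the convolution, every `η` is induced by a morphism to the chosen
  -- convolution, for which the formula holds by definition.
  obtain ⟨a, rfl⟩ := (hF.some.isConv H).2 η
  have key {e : ℝ} (h : c ≤ e) : convEval h ((pull k (convSum M c)).map a ≫ hF.some.counit) =
      a ≫ convEval h hF.some.counit := by
    rw [convEval_eq, convEval_eq, translEval, evalMap_map_comp, Category.assoc]
    rfl
  simp only [key, Functor.map_comp, Category.assoc]
  have := hF.some.isIso
  rw [IsIso.hom_inv_id_assoc]

variable (E) in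
/-- The morphism `τ_{c,d}(F)` in terms of the functors `transl`. -/
def translTau {c d : ℝ} (h : c ≤ d) (F : Db k (MR M)) :
    (Qgamma k E M).obj ((transl k M c).obj F) ⟶ (Qgamma k E M).obj ((transl k M d).obj F) :=
  (Qgamma k E M).map ((pullTr k M c).hom.app F) ≫ tau E h F ≫
    (Qgamma k E M).map ((pullTr k M d).inv.app F)

variable (E) in
/-- The characterization of `convEval_comp_tau` for the functors `transl`. -/
lemma translEval_comp_translTau {c d : ℝ} (h : c ≤ d) {F H : Db k (MR M)}
    (η : (pull k (convSum M c)).obj H ⟶ (pull k (convProj M c)).obj F) :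
    (Qgamma k E M).map (translEval le_rfl η) ≫ translTau E h F =
      (Qgamma k E M).map (translEval h η) := by
  have := convEval_comp_tau E h η
  rw [convEval_eq, convEval_eq, Functor.map_comp, Functor.map_comp, Category.assoc] at this
  rw [translTau, reassoc_of% this, ← Functor.map_comp, Iso.hom_inv_id_app,
    CategoryTheory.Functor.map_id, Category.comp_id]

variable (E) in
lemma exists_isIso_translEval (c : ℝ) (F : Db k (MR M)) :
    ∃ (P : Db k (MR M)) (ε : (pull k (convSum M c)).obj P ⟶ (pull k (convProj M c)).obj F),
      IsIso ((Qgamma k E M).map (translEval le_rfl ε)) := by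
  obtain ⟨D⟩ := nonempty_convData (k := k) E c F
  refine ⟨D.obj, D.counit, ?_⟩
  have := D.isIso
  rw [convEval_eq, Functor.map_comp] at this
  exact IsIso.of_isIso_comp_right _ ((Qgamma k E M).map ((pullTr k M c).hom.app F))

lemma tau_self (c : ℝ) (F : Db k (MR M)) : tau E (le_refl c) F = 𝟙 _ := by
  have hF := nonempty_convData (k := k) E c F
  have := hF.some.isIso
  rw [tau, dif_pos hF, IsIso.inv_hom_id]

/-- The morphisms are compatible with the evaluations of `F ⋆ k_{M × [b, ∞)}` on the slices
`b`, `c` and `d`, and the evaluation on the slice `b` is an isomorphism. -/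
lemma translTau_comp {b c d : ℝ} (h : b ≤ c) (h' : c ≤ d) (F : Db k (MR M)) :
    translTau E h F ≫ translTau E h' F = translTau E (h.trans h') F := by
  obtain ⟨P, ε, _⟩ := exists_isIso_translEval (k := k) E b F
  obtain ⟨η, hη⟩ := exists_translEval_eq h ε
  rw [← cancel_epi ((Qgamma k E M).map (translEval le_rfl ε)), ← Category.assoc,
    translEval_comp_translTau, translEval_comp_translTau, ← hη c le_rfl, ← hη d h',
    translEval_comp_translTau]

lemma tau_comp {b c d : ℝ} (h : b ≤ c) (h' : c ≤ d) (F : Db k (MR M)) :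
    tau E h F ≫ tau E h' F = tau E (h.trans h') F := by
  have := translTau_comp (E := E) h h' F
  simp only [translTau, Category.assoc] at this
  rw [← Functor.map_comp_assoc, Iso.inv_hom_id_app, CategoryTheory.Functor.map_id,
    Category.id_comp] at this
  rw [← cancel_epi ((Qgamma k E M).map ((pullTr k M b).hom.app F)),
    ← cancel_mono ((Qgamma k E M).map ((pullTr k M d).inv.app F))]
  simpa using this

lemma translTau_naturality {c d : ℝ} (h : c ≤ d) {F G : Db k (MR M)} (f : F ⟶ G) :
    (Qgamma k E M).map ((transl k M c).map f) ≫ translTau E h G =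
      translTau E h F ≫ (Qgamma k E M).map ((transl k M d).map f) := by
  obtain ⟨P, ε, _⟩ := exists_isIso_translEval (k := k) E c F
  have key {e : ℝ} (h : c ≤ e) : translEval h (ε ≫ (pull k (convProj M c)).map f) =
    translEval h ε ≫ (transl k M e).map f := evalMap_comp _ _ _ _ _
  rw [← cancel_epi ((Qgamma k E M).map (translEval le_rfl ε)), ← Category.assoc,
    ← Functor.map_comp, ← key, translEval_comp_translTau, key, ← Category.assoc,
    translEval_comp_translTau, Functor.map_comp]

/-- `τ_{a,d}(T_{c*} F) = τ_{a+c,d+c}(F)`. -/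
lemma translTau_transl {a d c a' d' : ℝ} (ha : a + c = a') (hd : d + c = d') (h : a ≤ d)
    (h' : a' ≤ d') (F : Db k (MR M)) :
    translTau E h ((transl k M c).obj F) ≫ (Qgamma k E M).map ((translAdd k M hd).hom.app F) =
      (Qgamma k E M).map ((translAdd k M ha).hom.app F) ≫ translTau E h' F := by
  obtain ⟨P, ε, _⟩ := exists_isIso_translEval (k := k) E a ((transl k M c).obj F)
  obtain ⟨η, hη⟩ := exists_translEval_translAdd ha ε
  rw [← cancel_epi ((Qgamma k E M).map (translEval le_rfl ε)), ← Category.assoc,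
    translEval_comp_translTau, ← Functor.map_comp, ← hη d d' hd h h', ← Category.assoc,
    ← Functor.map_comp, ← hη a a' ha le_rfl le_rfl, translEval_comp_translTau]

lemma comp_assoc_of_eq {C : Type*} [Category* C] {X₁ X₂ X₃ X₄ X₅ X₆ : C} {x : X₁ ⟶ X₂} {a : X₂ ⟶ X₃}
    {b : X₃ ⟶ X₄} {y : X₁ ⟶ X₅} {z : X₅ ⟶ X₄} (h : x ≫ a ≫ b = y ≫ z) (t : X₄ ⟶ X₆) :
    x ≫ a ≫ b ≫ t = y ≫ z ≫ t := by
  rw [reassoc_of% h]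

/-- `T_{c*} τ_{a,d}(F) = τ_{c+a,c+d}(F)`, for a functor `T` on the quotient induced by `T_{c*}`. -/
lemma map_translTau {a d c a' d' : ℝ} (ha : c + a = a') (hd : c + d = d') (h : a ≤ d)
    (h' : a' ≤ d') (T : Dgamma k E M ⥤ Dgamma k E M)
    (e : Qgamma k E M ⋙ T ≅ transl k M c ⋙ Qgamma k E M) (F : Db k (MR M)) :
    T.map (translTau E h F) ≫ e.hom.app _ ≫
        (Qgamma k E M).map ((translAdd k M hd).hom.app F) =
      e.hom.app _ ≫ (Qgamma k E M).map ((translAdd k M ha).hom.app F) ≫ translTau E h' F := by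
  obtain ⟨P, ε, _⟩ := exists_isIso_translEval (k := k) E a F
  obtain ⟨η, hη⟩ := exists_translEval_map ha ε
  have key {b b' : ℝ} (hb : c + b = b') (h : a ≤ b) (h' : a' ≤ b') :
      T.map ((Qgamma k E M).map (translEval h ε)) ≫ e.hom.app _ ≫
        (Qgamma k E M).map ((translAdd k M hb).hom.app F) =
      e.hom.app P ≫ (Qgamma k E M).map (translEval h' η) := by
    have := e.hom.naturality (translEval h ε)
    rw [hη b b' hb h h', Functor.map_comp]
    exact (Category.assoc _ _ _).symm.trans ((eq_whisker this _).trans (Category.assoc _ _ _))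
  rw [← cancel_epi (T.map ((Qgamma k E M).map (translEval le_rfl ε))), ← Functor.map_comp_assoc,
    translEval_comp_translTau, key hd h h']
  exact (whisker_eq _ (translEval_comp_translTau E h' η).symm).trans
    (comp_assoc_of_eq (key ha le_rfl le_rfl) _).symm

end Tau

/-! ### The shift -/

section Shift

variable {k : Type u} [CommRing k] {A B Y Y' : TopCat.{u}}

/-- The shift of a morphism from `s⁻¹ P` to `q⁻¹ F`. -/
def shiftPull (n : ℤ) {s : Y ⟶ A} {q : Y ⟶ B} {P : Db k A} {F : Db k B}
    (ε : (pull k s).obj P ⟶ (pull k q).obj F) :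
    (pull k s).obj (P⟦n⟧) ⟶ (pull k q).obj (F⟦n⟧) :=
  ((pull k s).commShiftIso n).hom.app P ≫ ε⟦n⟧' ≫ ((pull k q).commShiftIso n).inv.app F

/-- An isomorphism of `h⁻¹ (X⟦n⟧)` with `(h⁻¹ X)⟦n⟧` that comes from `h⁻¹ = j⁻¹ g⁻¹`. -/
def pullShiftIso (j : Y' ⟶ Y) (g : Y ⟶ A) {h : Y' ⟶ A} (w : j ≫ g = h) (n : ℤ) (X : Db k A) :
    (pull k h).obj (X⟦n⟧) ≅ ((pull k h).obj X)⟦n⟧ :=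
  (pullIso k j g w).symm.app (X⟦n⟧) ≪≫ (pull k j).mapIso (((pull k g).commShiftIso n).app X) ≪≫
    ((pull k j).commShiftIso n).app ((pull k g).obj X) ≪≫
      (shiftFunctor _ n).mapIso ((pullIso k j g w).app X)

lemma comp_comp_comp_comp_eq {C : Type*} [Category* C] {X₀ X₁ X₂ X₃ X₄ Y₀ Y₁ Y₂ Y₃ Y₄ : C}
    {f₀ : X₀ ⟶ Y₀} {f₁ : X₁ ⟶ Y₁} {f₂ : X₂ ⟶ Y₂} {f₃ : X₃ ⟶ Y₃} {f₄ : X₄ ⟶ Y₄}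
    {a : X₀ ⟶ X₁} {a' : Y₀ ⟶ Y₁} {b : X₁ ⟶ X₂} {b' : Y₁ ⟶ Y₂} {c : X₂ ⟶ X₃} {c' : Y₂ ⟶ Y₃}
    {d : X₃ ⟶ X₄} {d' : Y₃ ⟶ Y₄} (h₁ : f₀ ≫ a' = a ≫ f₁) (h₂ : f₁ ≫ b' = b ≫ f₂)
    (h₃ : f₂ ≫ c' = c ≫ f₃) (h₄ : f₃ ≫ d' = d ≫ f₄) :
    f₀ ≫ a' ≫ b' ≫ c' ≫ d' = (a ≫ b ≫ c ≫ d) ≫ f₄ := by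
  rw [reassoc_of% h₁, reassoc_of% h₂, reassoc_of% h₃, h₄]
  simp only [Category.assoc]

lemma pullShiftIso_naturality (j : Y' ⟶ Y) (g : Y ⟶ A) {h : Y' ⟶ A} (w : j ≫ g = h) (n : ℤ)
    {X X' : Db k A} (f : X ⟶ X') :
    (pull k h).map (f⟦n⟧') ≫ (pullShiftIso j g w n X').hom =
      (pullShiftIso j g w n X).hom ≫ ((pull k h).map f)⟦n⟧' := by
  have h₂ := congrArg (pull k j).map (((pull k g).commShiftIso n).hom.naturality f)
  have h₄ := congrArg (shiftFunctor _ n).map ((pullIso k j g w).hom.naturality f)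
  simp only [Functor.map_comp] at h₂ h₄
  exact comp_comp_comp_comp_eq ((pullIso k j g w).inv.naturality (f⟦n⟧')) h₂
    (((pull k j).commShiftIso n).hom.naturality ((pull k g).map f)) h₄

lemma comp_comp_eq_of_isIso {C : Type*} [Category* C] {X₁ X₂ X₃ X₄ Y₁ Y₂ Y₃ Y₄ Z₁ Z₂ : C}
    {a : X₁ ⟶ X₂} {b : X₂ ≅ X₃} {c : X₃ ≅ X₄} {d : X₄ ⟶ Z₁}
    {a' : Y₂ ⟶ Y₁} {b' : Y₂ ≅ Y₃} {c' : Y₃ ≅ Y₄} {d' : Y₄ ≅ Z₂}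
    {f : X₃ ⟶ Y₃} {φ : X₄ ⟶ Y₄} {ψ : Z₁ ⟶ Z₂} (h : f ≫ c'.hom = c.hom ≫ φ)
    (h' : φ ≫ d'.hom = d ≫ ψ) :
    a ≫ (b.hom ≫ f ≫ b'.inv) ≫ a' =
      (a ≫ b.hom ≫ c.hom ≫ d) ≫ ψ ≫ d'.inv ≫ c'.inv ≫ b'.inv ≫ a' := by
  simp only [Category.assoc]
  rw [← reassoc_of% h', d'.hom_inv_id_assoc, ← reassoc_of% h, c'.hom_inv_id_assoc]

/-- Restriction commutes with the shift, up to isomorphisms that depend only on the maps. -/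
lemma restrict_shiftPull (j : Y' ⟶ Y) {s : Y ⟶ A} {q : Y ⟶ B} {s' : Y' ⟶ A} {q' : Y' ⟶ B}
    (hs : j ≫ s = s') (hq : j ≫ q = q') {P : Db k A} {F : Db k B} (n : ℤ)
    (ε : (pull k s).obj P ⟶ (pull k q).obj F) :
    restrict j hs hq (shiftPull n ε) = (pullShiftIso j s hs n P).hom ≫ (restrict j hs hq ε)⟦n⟧' ≫
      (pullShiftIso j q hq n F).inv := by
  have h₄ : ((pull k j).map ε)⟦n⟧' ≫ ((pullIso k j q hq).hom.app F)⟦n⟧' =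
      ((pullIso k j s hs).hom.app P)⟦n⟧' ≫ (restrict j hs hq ε)⟦n⟧' := by
    rw [← Functor.map_comp, ← Functor.map_comp, restrict, Iso.hom_inv_id_app_assoc]
  rw [restrict, shiftPull, Functor.map_comp, Functor.map_comp]
  refine (comp_comp_eq_of_isIso (b := (pull k j).mapIso (((pull k s).commShiftIso n).app P))
    (b' := (pull k j).mapIso (((pull k q).commShiftIso n).app F))
    (c := ((pull k j).commShiftIso n).app _) (c' := ((pull k j).commShiftIso n).app _)
    (d' := (shiftFunctor _ n).mapIso ((pullIso k j q hq).app F))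
    (((pull k j).commShiftIso n).hom.naturality ε) h₄).trans ?_
  refine whisker_eq _ (whisker_eq _ ?_)
  simp [pullShiftIso]

/-- The isomorphism of `X⟦n⟧` with itself that comes from `id = i⁻¹ s⁻¹`. -/
def sectionShiftIso (i : A ⟶ Y) {s : Y ⟶ A} (hs : i ≫ s = 𝟙 A) (n : ℤ) (X : Db k A) :
    X⟦n⟧ ≅ X⟦n⟧ :=
  (pullId k rfl).symm.app (X⟦n⟧) ≪≫ pullShiftIso i s hs n X ≪≫
    (shiftFunctor _ n).mapIso ((pullId k rfl).app X)

lemma comp_comp_comp_eq {C : Type*} [Category* C] {X₀ X₁ X₂ X₃ Y₀ Y₁ Y₂ Y₃ : C}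
    {f₀ : X₀ ⟶ Y₀} {f₁ : X₁ ⟶ Y₁} {f₂ : X₂ ⟶ Y₂} {f₃ : X₃ ⟶ Y₃}
    {a : X₀ ⟶ X₁} {a' : Y₀ ⟶ Y₁} {b : X₁ ⟶ X₂} {b' : Y₁ ⟶ Y₂} {c : X₂ ⟶ X₃} {c' : Y₂ ⟶ Y₃}
    (h₁ : f₀ ≫ a' = a ≫ f₁) (h₂ : f₁ ≫ b' = b ≫ f₂) (h₃ : f₂ ≫ c' = c ≫ f₃) :
    f₀ ≫ a' ≫ b' ≫ c' = (a ≫ b ≫ c) ≫ f₃ := by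
  rw [reassoc_of% h₁, reassoc_of% h₂, h₃]
  simp only [Category.assoc]

lemma sectionShiftIso_naturality (i : A ⟶ Y) {s : Y ⟶ A} (hs : i ≫ s = 𝟙 A) (n : ℤ)
    {X X' : Db k A} (f : X ⟶ X') :
    f⟦n⟧' ≫ (sectionShiftIso i hs n X').hom = (sectionShiftIso i hs n X).hom ≫ f⟦n⟧' := by
  have h₃ := congrArg (shiftFunctor _ n).map ((pullId k (X := A) rfl).hom.naturality f)
  simp only [Functor.map_comp] at h₃
  exact comp_comp_comp_eq ((pullId k rfl).inv.naturality (f⟦n⟧'))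
    (pullShiftIso_naturality i s hs n f) h₃

/-- The evaluation along a section `i` of `s` commutes with the shift, up to an isomorphism that
does not depend on the morphism evaluated. -/
lemma exists_evalMap_shiftPull (i : A ⟶ Y) {s : Y ⟶ A} {q : Y ⟶ B} {q' : A ⟶ B}
    (hs : i ≫ s = 𝟙 A) (hq : i ≫ q = q') (n : ℤ) (F : Db k B) :
    ∃ e : ((pull k q').obj F)⟦n⟧ ≅ (pull k q').obj (F⟦n⟧), ∀ (P : Db k A)
      (ε : (pull k s).obj P ⟶ (pull k q).obj F),
      evalMap i hs hq (shiftPull n ε) = (evalMap i hs hq ε)⟦n⟧' ≫ e.hom := by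
  refine ⟨sectionShiftIso i hs n _ ≪≫ (pullShiftIso i q hq n F).symm, fun P ε => ?_⟩
  have h : restrict i hs hq ε = (pullId k rfl).hom.app P ≫ evalMap i hs hq ε := by
    exact ((pullId k rfl).hom_inv_id_app_assoc P _).symm
  have h' := sectionShiftIso_naturality i hs n (evalMap i hs hq ε)
  rw [evalMap, restrict_shiftPull, h, Functor.map_comp, Iso.trans_hom, reassoc_of% h']
  simp [sectionShiftIso]

end Shift

section TauShift

variable {k : Type u} [CommRing k] {E : Type u} [NormedAddCommGroup E] [NormedSpace ℝ E]
  [FiniteDimensional ℝ E] {M : Type u} [TopologicalSpace M] [T2Space M]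
  [SecondCountableTopology M] [ChartedSpace E M] [IsManifold (modelWithCornersSelf ℝ E) ∞ M]

variable (E) in
/-- The morphism `τ_{0,d}(F)`, from `F` itself. -/
def translTauZero (d : ℝ≥0) (F : Db k (MR M)) :
    (Qgamma k E M).obj F ⟶ (Qgamma k E M).obj ((transl k M d).obj F) :=
  (Qgamma k E M).map ((translZero k M).inv.app F) ≫ translTau E d.coe_nonneg F

lemma comp_comp_eq_comp_of_eq {C : Type*} [Category* C] {X₁ X₂ X₃ X₄ X₅ : C} {x : X₁ ⟶ X₂}
    {a : X₂ ⟶ X₃} {y : X₁ ⟶ X₅} {z : X₅ ⟶ X₃} (h : x ≫ a = y ≫ z) (t : X₃ ⟶ X₄) :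
    x ≫ a ≫ t = y ≫ z ≫ t := by
  rw [reassoc_of% h]

lemma translTauZero_naturality (d : ℝ≥0) {F G : Db k (MR M)} (f : F ⟶ G) :
    (Qgamma k E M).map f ≫ translTauZero E d G =
      translTauZero E d F ≫ (Qgamma k E M).map ((transl k M d).map f) := by
  have h := congrArg (Qgamma k E M).map ((translZero k M).inv.naturality f)
  rw [Functor.map_comp, Functor.map_comp] at h
  rw [translTauZero, translTauZero, Category.assoc, ← translTau_naturality]
  exact comp_comp_eq_comp_of_eq h _

lemma map_translEval_comp_translTauZero (d : ℝ≥0) {F H : Db k (MR M)}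
    (η : (pull k (convSum M 0)).obj H ⟶ (pull k (convProj M 0)).obj F) :
    (Qgamma k E M).map (translEval le_rfl η ≫ (translZero k M).hom.app F) ≫ translTauZero E d F =
      (Qgamma k E M).map (translEval d.coe_nonneg η) := by
  rw [← translEval_comp_translTau, translTauZero, ← Functor.map_comp_assoc, Category.assoc,
    Iso.hom_inv_id_app, Category.comp_id]

/-- If `t` is determined by `Q g ≫ t = Q v`, then its shift is determined by the shifts of `g` and
`v`. -/
lemma commShiftIso_comp_shift_comp {C D : Type*} [Category* C] [Category* D] [HasShift C ℤ]
    [HasShift D ℤ] (Q : C ⥤ D) [Q.CommShift ℤ] (n : ℤ) {H F T T' : C} (g : H ⟶ F) (v : H ⟶ T)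
    [IsIso (Q.map g)] (t : Q.obj F ⟶ Q.obj T) (ht : Q.map g ≫ t = Q.map v)
    (t' : Q.obj (F⟦n⟧) ⟶ Q.obj T') (f : T⟦n⟧ ⟶ T')
    (ht' : Q.map (g⟦n⟧') ≫ t' = Q.map (v⟦n⟧' ≫ f)) :
    (Q.commShiftIso n).hom.app F ≫ t⟦n⟧' ≫ (Q.commShiftIso n).inv.app T ≫ Q.map f = t' := by
  have hg : (Q.commShiftIso n).hom.app H ≫ (Q.map g)⟦n⟧' =
      Q.map (g⟦n⟧') ≫ (Q.commShiftIso n).hom.app F := (Q.commShiftIso_hom_naturality g n).symm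
  have : IsIso (Q.map (g⟦n⟧')) := by
    have h : Q.map (g⟦n⟧') = (Q.commShiftIso n).hom.app H ≫ (Q.map g)⟦n⟧' ≫
      (Q.commShiftIso n).inv.app F := by rw [reassoc_of% hg, Iso.hom_inv_id_app]; simp
    rw [h]
    infer_instance
  rw [← cancel_epi (Q.map (g⟦n⟧')), ht', ← reassoc_of% hg, ← Functor.map_comp_assoc, ht,
    Functor.map_comp, ← reassoc_of% (Q.commShiftIso_hom_naturality v n)]
  simp

variable (E) in
/-- `τ_{0,d}` commutes with the shift, up to an isomorphism of the target. -/
lemma exists_translTauZero_shift (d : ℝ≥0) (n : ℤ) (F : Db k (MR M)) :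
    ∃ e : ((Qgamma k E M).obj ((transl k M d).obj F))⟦n⟧ ≅
        (Qgamma k E M).obj ((transl k M d).obj (F⟦n⟧)),
      ((Qgamma k E M).commShiftIso n).hom.app F ≫ (translTauZero E d F)⟦n⟧' ≫ e.hom =
        translTauZero E d (F⟦n⟧) := by
  obtain ⟨P, ε, _⟩ := exists_isIso_translEval (k := k) E 0 F
  obtain ⟨e₀, he₀⟩ := exists_evalMap_shiftPull (convSlice M (le_refl 0)) (convSlice_sum M _)
    (convSlice_proj M _) n F
  obtain ⟨e₁, he₁⟩ := exists_evalMap_shiftPull (convSlice M (c := 0) (e := d) d.coe_nonneg)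
    (convSlice_sum M _) (convSlice_proj M _) n F
  -- The comparison of the shift with the evaluation at `0` is an automorphism of `F⟦n⟧`, which is
  -- moved to the target of `τ` by naturality.
  let α : F⟦n⟧ ≅ F⟦n⟧ := (shiftFunctor _ n).mapIso ((translZero k M).symm.app F) ≪≫ e₀ ≪≫
    (translZero k M).app (F⟦n⟧)
  have hα : (translEval le_rfl ε ≫ (translZero k M).hom.app F)⟦n⟧' ≫ α.hom =
      translEval le_rfl (shiftPull n ε) ≫ (translZero k M).hom.app (F⟦n⟧) := by
    refine Eq.trans ?_ (eq_whisker (he₀ P ε).symm _)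
    simp only [α, Functor.map_comp, Iso.trans_hom, Category.assoc]
    refine whisker_eq _ ?_
    refine (Category.assoc _ _ _).symm.trans ((eq_whisker ?_ _).trans (Category.id_comp _))
    exact (((shiftFunctor (Db k (MR M)) n).mapIso ((translZero k M).app F)).hom_inv_id)
  have : IsIso ((Qgamma k E M).map (translEval le_rfl ε ≫ (translZero k M).hom.app F)) := by
    rw [Functor.map_comp]
    infer_instance
  refine ⟨((Qgamma k E M).commShiftIso n).symm.app _ ≪≫
    (Qgamma k E M).mapIso (e₁ ≪≫ (transl k M d).mapIso α.symm), ?_⟩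
  refine commShiftIso_comp_shift_comp (Qgamma k E M) n _ _ _
    (map_translEval_comp_translTauZero d ε) _ _ ?_
  rw [← cancel_mono ((Qgamma k E M).map ((transl k M d).map α.hom)), Category.assoc,
    ← translTauZero_naturality, ← Functor.map_comp_assoc, hα, map_translEval_comp_translTauZero,
    ← Functor.map_comp, Category.assoc]
  refine congrArg (Qgamma k E M).map ((he₁ P ε).trans (whisker_eq _ ?_))
  simp [← Functor.map_comp]

end TauShift

/-! ### The translation functors on the quotient category -/

section Quotient

variable (k : Type u) [CommRing k] (E : Type u) [NormedAddCommGroup E] [NormedSpace ℝ E]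
  (M : Type u) [TopologicalSpace M] [ChartedSpace E M]
  [IsManifold (modelWithCornersSelf ℝ E) ∞ M]

/-- Translations preserve the morphisms that are inverted in `D^b(k^γ_M)`. -/
lemma transl_isInvertedBy (c : ℝ) :
    (NZ k E M).trW.IsInvertedBy (transl k M c ⋙ Qgamma k E M) := by
  rintro X Y f ⟨Z, g, h, hT, hZ⟩
  refine Localization.inverts (Qgamma k E M) (NZ k E M).trW _ ?_
  exact ⟨_, _, _, (transl k M c).map_distinguished _ hT, NZ_pull_translation (-c) hZ⟩

/-- The translation functor `T_{c*}` on `D^b(k^γ_M)`. -/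
def translGamma (c : ℝ) : Dgamma k E M ⥤ Dgamma k E M :=
  Localization.lift (transl k M c ⋙ Qgamma k E M) (transl_isInvertedBy k E M c) (Qgamma k E M)

instance (c : ℝ) : Localization.Lifting (Qgamma k E M) (NZ k E M).trW
    (transl k M c ⋙ Qgamma k E M) (translGamma k E M c) :=
  inferInstanceAs (Localization.Lifting (Qgamma k E M) (NZ k E M).trW _
    (Localization.lift (transl k M c ⋙ Qgamma k E M) (transl_isInvertedBy k E M c)
      (Qgamma k E M)))

/-- The functor `translGamma` is induced by `transl`. -/
def translGammaIso (c : ℝ) : Qgamma k E M ⋙ translGamma k E M c ≅ transl k M c ⋙ Qgamma k E M :=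
  Localization.Lifting.iso (Qgamma k E M) (NZ k E M).trW _ _

instance (c : ℝ) : (translGamma k E M c).CommShift ℤ :=
  Functor.commShiftOfLocalization (Qgamma k E M) (NZ k E M).trW ℤ
    (transl k M c ⋙ Qgamma k E M) (translGamma k E M c)

instance (c : ℝ) : NatTrans.CommShift (translGammaIso k E M c).hom ℤ :=
  NatTrans.commShift_iso_hom_of_localization (Qgamma k E M) (NZ k E M).trW ℤ
    (transl k M c ⋙ Qgamma k E M) (translGamma k E M c)

instance (c : ℝ) : (translGamma k E M c).IsTriangulated := by
  have := Localization.essSurj_mapArrow (Qgamma k E M) (NZ k E M).trW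
  exact Functor.isTriangulated_of_precomp_iso (translGammaIso k E M c)

variable {k M} [FiniteDimensional ℝ E] [T2Space M] [SecondCountableTopology M]

/-- The morphism `τ_{0,c}` as a morphism of functors on `D^b(k^γ_M)`. -/
def tauGamma (c : ℝ≥0) : 𝟭 (Dgamma k E M) ⟶ translGamma k E M c :=
  Localization.liftNatTrans (Qgamma k E M) (NZ k E M).trW (Qgamma k E M)
    (transl k M c ⋙ Qgamma k E M) _ _
    { app F := translTauZero E c F
      naturality _ _ f := translTauZero_naturality c f }

/-- On objects of `D^b(k_{M × ℝ})`, the morphism `tauGamma` is `translTauZero`. -/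
lemma tauGamma_app (c : ℝ≥0) (F : Db k (MR M)) :
    (tauGamma E c).app ((Qgamma k E M).obj F) ≫ (translGammaIso k E M c).hom.app F =
      translTauZero E c F := by
  rw [tauGamma, Localization.liftNatTrans_app, translGammaIso]
  simp

/-- The isomorphism `T_{c*} T_{d*} F = T_{e*} F` in `D^b(k^γ_M)`, for `e = c + d`. -/
def translGammaAdd {c d e : ℝ} (h : c + d = e) (F : Db k (MR M)) :
    (translGamma k E M c).obj ((translGamma k E M d).obj ((Qgamma k E M).obj F)) ≅
      (Qgamma k E M).obj ((transl k M e).obj F) :=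
  (translGamma k E M c).mapIso ((translGammaIso k E M d).app F) ≪≫
    (translGammaIso k E M c).app _ ≪≫ (Qgamma k E M).mapIso ((translAdd k M h).app F)

variable {E}

lemma comp_comp_comp_eq_of_map_eq {C : Type*} [Category* C] {X₀ X₁ X₂ X₃ X₄ Y₀ Y₁ Y₂ : C}
    {t : X₀ ⟶ X₁} {a : X₁ ⟶ X₂} {b : X₂ ⟶ X₃} {w : X₃ ⟶ X₄} {z : X₀ ⟶ Y₀} {v : Y₀ ⟶ X₂}
    {b' : Y₀ ⟶ Y₁} {y : Y₁ ⟶ Y₂} {r : Y₂ ⟶ X₄} {b'' : X₀ ⟶ Y₂} {z' : Y₂ ⟶ Y₁}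
    (h₁ : t ≫ a = z ≫ v) (h₂ : v ≫ b ≫ w = b' ≫ y ≫ r) (h₃ : z ≫ b' = b'' ≫ z')
    (h₄ : z' ≫ y = 𝟙 _) : t ≫ a ≫ b ≫ w = b'' ≫ r := by
  rw [reassoc_of% h₁, h₂, reassoc_of% h₃, reassoc_of% h₄]

lemma comp_comp_comp_eq_of_obj_eq {C : Type*} [Category* C] {X₀ X₁ X₂ X₃ X₄ Y₁ Y₂ : C}
    {t : X₀ ⟶ X₁} {a : X₁ ⟶ X₂} {b : X₂ ⟶ X₃} {w : X₃ ⟶ X₄} {e : X₀ ⟶ Y₁} {t' : Y₁ ⟶ X₂}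
    {z : Y₁ ⟶ Y₂} {v : Y₂ ⟶ X₃} {y : Y₂ ⟶ Y₁} {r : Y₁ ⟶ X₄}
    (h₁ : t ≫ a = e ≫ t') (h₂ : t' ≫ b = z ≫ v) (h₃ : v ≫ w = y ≫ r)
    (h₄ : z ≫ y = 𝟙 _) : t ≫ a ≫ b ≫ w = e ≫ r := by
  rw [reassoc_of% h₁, reassoc_of% h₂, h₃, reassoc_of% h₄]

/-- `T_{c*} τ_{0,d}(F) = τ_{c,c+d}(F)`, in `D^b(k^γ_M)`. -/
lemma map_tauGamma_comp (c d : ℝ≥0) {e : ℝ} (h : (c : ℝ) + d = e) (hc : (c : ℝ) ≤ e)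
    (F : Db k (MR M)) :
    (translGamma k E M c).map ((tauGamma E d).app ((Qgamma k E M).obj F)) ≫
        (translGammaAdd E h F).hom =
      (translGammaIso k E M c).hom.app F ≫ translTau E hc F := by
  have h₁ := map_translTau (add_zero (c : ℝ)) h d.coe_nonneg hc _ (translGammaIso k E M c) F
  have h₂ := congrArg (translGamma k E M c).map (tauGamma_app E d F)
  have h₃ := (translGammaIso k E M c).hom.naturality ((translZero k M).inv.app F)
  rw [translTauZero, Functor.map_comp, Functor.map_comp] at h₂
  exact comp_comp_comp_eq_of_map_eq h₂ h₁ h₃ (by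
    rw [translAdd_zero_right]
    exact ((transl k M c ⋙ Qgamma k E M).mapIso ((translZero k M).app F)).inv_hom_id)

/-- `τ_{0,d}(T_{c*} F) = τ_{c,d+c}(F)`, in `D^b(k^γ_M)`. -/
lemma tauGamma_obj_comp (c d : ℝ≥0) {e : ℝ} (h : (d : ℝ) + c = e) (hc : (c : ℝ) ≤ e)
    (F : Db k (MR M)) :
    (tauGamma E d).app ((translGamma k E M c).obj ((Qgamma k E M).obj F)) ≫
        (translGammaAdd E h F).hom =
      (translGammaIso k E M c).hom.app F ≫ translTau E hc F := by
  have h₁ := translTau_transl (E := E) (zero_add (c : ℝ)) h d.coe_nonneg hc F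
  have h₂ := (tauGamma E d).naturality ((translGammaIso k E M c).hom.app F)
  have h₃ := tauGamma_app E d ((transl k M c).obj F)
  exact comp_comp_comp_eq_of_obj_eq h₂.symm h₃ h₁ (by
    rw [translAdd_zero_left]
    exact ((Qgamma k E M).mapIso ((translZero k M).app _)).inv_hom_id)

lemma translTauZero_comp (c : ℝ≥0) {e : ℝ≥0} (hc : (c : ℝ) ≤ e) (F : Db k (MR M)) :
    translTauZero E c F ≫ translTau E hc F = translTauZero E e F := by
  rw [translTauZero, translTauZero, Category.assoc, translTau_comp]

omit [FiniteDimensional ℝ E] [T2Space M] [SecondCountableTopology M] in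
lemma Qgamma_obj_surjective : Function.Surjective (Qgamma k E M).obj :=
  (Localization.Construction.objEquiv _).surjective

lemma eq_comp_trans_hom {D : Type*} [Category* D] {A B₁ B₂ B₃ : D} {x : A ⟶ B₂} {y : A ⟶ B₁}
    {e₁ : B₁ ≅ B₃} {e₂ : B₂ ≅ B₃} (h : x ≫ e₂.hom = y ≫ e₁.hom) :
    x = y ≫ (e₁ ≪≫ e₂.symm).hom := by
  rw [← cancel_mono e₂.hom, h]
  simp

lemma eq_comp_trans_hom_of_square {D : Type*} [Category* D] {A₁ A₂ B₁ B₂ B₃ B₄ B₅ : D}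
    {s : A₁ ≅ A₂} {t : A₂ ⟶ B₁} {t' : A₁ ⟶ B₂} {b : B₂ ≅ B₁} {b' : B₂ ≅ B₃} {v : A₂ ⟶ B₄}
    {e : B₄ ≅ B₃} {v' : A₂ ⟶ B₅} {a : B₅ ≅ B₄} (h : s.hom ≫ t = t' ≫ b.hom)
    (h' : s.hom ≫ v ≫ e.hom = t' ≫ b'.hom) (h'' : v' ≫ a.hom = v) :
    t = v' ≫ (a ≪≫ e ≪≫ b'.symm ≪≫ b).hom := by
  rw [← cancel_epi s.hom, h, Iso.trans_hom, reassoc_of% h'', Iso.trans_hom, reassoc_of% h']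
  simp

variable (k E M)

/-- The persistence structure on `D^b(k^γ_M)` given by the translations. -/
def persistenceGamma : Persistence (Dgamma k E M) where
  T c := translGamma k E M c
  commShift c := inferInstance
  isTriangulated c := inferInstance
  τ c X := (tauGamma E c).app X
  τ_naturality c _ _ f := (tauGamma E c).naturality f
  τ_shift c n X := by
    obtain ⟨F, rfl⟩ := Qgamma_obj_surjective X
    obtain ⟨e, he⟩ := exists_translTauZero_shift E c n F
    have h := (tauGamma E c).naturality (((Qgamma k E M).commShiftIso n).hom.app F)
    have h' := (congrArg (shiftFunctor (Dgamma k E M) n).map (tauGamma_app E c F))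
    rw [Functor.map_comp] at h'
    refine ⟨(shiftFunctor (Dgamma k E M) n).mapIso ((translGammaIso k E M c).app F) ≪≫ e ≪≫
      ((translGammaIso k E M c).app _).symm ≪≫
      (translGamma k E M c).mapIso (((Qgamma k E M).commShiftIso n).app F), ?_⟩
    exact eq_comp_trans_hom_of_square (s := ((Qgamma k E M).commShiftIso n).app F)
      h (he.trans (tauGamma_app E c (F⟦n⟧)).symm) h'
  τ_add c d X := by
    obtain ⟨F, rfl⟩ := Qgamma_obj_surjective X
    have hc : (c : ℝ) ≤ (c + d : ℝ≥0) := NNReal.coe_le_coe.2 le_self_add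
    refine ⟨translGammaAdd E (NNReal.coe_add c d).symm F ≪≫
      ((translGammaIso k E M (c + d : ℝ≥0)).app F).symm, ?_⟩
    have h := map_tauGamma_comp (E := E) c d (NNReal.coe_add c d).symm hc F
    have h' := translTauZero_comp (E := E) c hc F
    rw [← tauGamma_app, ← tauGamma_app, Category.assoc, ← h] at h'
    exact (eq_comp_trans_hom (h'.symm.trans (Category.assoc _ _ _).symm)).trans
      (Category.assoc _ _ _)
  τ_obj c d X := by
    obtain ⟨F, rfl⟩ := Qgamma_obj_surjective X
    have hc : (c : ℝ) ≤ (c + d : ℝ≥0) := NNReal.coe_le_coe.2 le_self_add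
    exact ⟨_, eq_comp_trans_hom ((tauGamma_obj_comp c d
      ((add_comm _ _).trans (NNReal.coe_add c d).symm) hc F).trans
        (map_tauGamma_comp c d (NNReal.coe_add c d).symm hc F).symm)⟩
  τ_obj_self c X := by
    obtain ⟨F, rfl⟩ := Qgamma_obj_surjective X
    have hc : (c : ℝ) ≤ c + c := le_add_of_nonneg_left c.coe_nonneg
    exact (cancel_mono (translGammaAdd E rfl F).hom).1
      ((tauGamma_obj_comp c c rfl hc F).trans (map_tauGamma_comp c c rfl hc F).symm)

end Quotient

/-! ### The quotient by the torsion objects -/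

section Transport

variable {D : Type*} [Category* D] [HasZeroObject D] [HasShift D ℤ] [Preadditive D]
  [∀ n : ℤ, (shiftFunctor D n).Additive] [Pretriangulated D] [IsTriangulated D]
  (S : Persistence D) {P : ObjectProperty D} [P.IsTriangulated]

/-- The variant of `Persistence.exists_comp_map_τ_eq_zero` for a property that is only
propositionally equal to `S.torsion`, so that the quotient category is the one defined from `P`. -/
lemma Persistence.exists_comp_map_τ_eq_zero' (hP : P = S.torsion) {F G : D} (c : ℝ≥0)
    (v : F ⟶ (S.T c).obj G) (hv : P.trW.Q.map v = 0) : ∃ d, v ≫ (S.T c).map (S.τ d G) = 0 := by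
  subst hP
  exact S.exists_comp_map_τ_eq_zero c v hv

omit [P.IsTriangulated] in
/-- The variant of `Persistence.exists_map_eq_comp_map_τ` for a property that is only
propositionally equal to `S.torsion`. -/
lemma Persistence.exists_map_eq_comp_map_τ' (hP : P = S.torsion) {F G : D}
    (f : P.trW.Q.obj F ⟶ P.trW.Q.obj G) :
    ∃ (c : ℝ≥0) (v : F ⟶ (S.T c).obj G), f ≫ P.trW.Q.map (S.τ c G) = P.trW.Q.map v := by
  subst hP
  exact S.exists_map_eq_comp_map_τ f

end Transport

section Torsion

variable {k : Type u} [CommRing k] {E : Type u} [NormedAddCommGroup E] [NormedSpace ℝ E]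
  [FiniteDimensional ℝ E] {M : Type u} [TopologicalSpace M] [T2Space M]
  [SecondCountableTopology M] [ChartedSpace E M] [IsManifold (modelWithCornersSelf ℝ E) ∞ M]

/-- The comparison of the two identifications of `T_{0*}` with the identity. -/
def trZeroAut (F : Db k (MR M)) : F ≅ F :=
  (translZero k M).symm.app F ≪≫ (pullTr k M 0).app F ≪≫ (trZero k M).app F

variable (E) in
/-- The isomorphism of `T_{c*} F`, computed in the quotient, with the image of `T_{c*} F`. -/
def translGammaTr (c : ℝ) (F : Db k (MR M)) :
    (translGamma k E M c).obj ((Qgamma k E M).obj F) ≅ (Qgamma k E M).obj ((Tr k M c).obj F) :=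
  (translGammaIso k E M c).app F ≪≫ (Qgamma k E M).mapIso ((pullTr k M c).app F)

lemma comp_eq_comp_of_comp_inv_eq {C : Type*} [Category* C] {X₁ X₂ X₃ X₄ X₅ X₆ X₇ : C}
    {x : X₁ ⟶ X₂} {e : X₂ ⟶ X₃} {a : X₁ ⟶ X₄} {b : X₄ ⟶ X₅} {t : X₅ ⟶ X₆} {i : X₃ ≅ X₆}
    {r : X₁ ⟶ X₇} {z : X₇ ⟶ X₅} (h : x ≫ e = a ≫ b ≫ t ≫ i.inv) (h' : a ≫ b = r ≫ z) :
    r ≫ z ≫ t = x ≫ e ≫ i.hom := by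
  rw [reassoc_of% h, reassoc_of% h', i.inv_hom_id]
  simp

/-- `τ_{0,c}(F)` is, up to isomorphisms of the source and of the target, the value at `F` of the
morphism of functors `tauGamma`. -/
lemma tauZero_eq (c : ℝ≥0) (F : Db k (MR M)) :
    tauZero E c F = ((Qgamma k E M).mapIso (trZeroAut F)).inv ≫
      (tauGamma E c).app ((Qgamma k E M).obj F) ≫ (translGammaTr E c F).hom := by
  have h := tauGamma_app E c F
  rw [translTauZero, translTau] at h
  have hα : (Qgamma k E M).map ((translZero k M).inv.app F) ≫
      (Qgamma k E M).map ((pullTr k M 0).hom.app F) =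
      ((Qgamma k E M).mapIso (trZeroAut F)).hom ≫ (Qgamma k E M).map ((trZero k M).inv.app F) := by
    rw [← Functor.map_comp]
    refine Eq.trans ?_ ((Qgamma k E M).map_comp _ _)
    simp [trZeroAut]
  rw [tauZero, ← cancel_epi ((Qgamma k E M).mapIso (trZeroAut F)).hom, Iso.hom_inv_id_assoc]
  exact comp_eq_comp_of_comp_inv_eq (i := (Qgamma k E M).mapIso ((pullTr k M c).app F)) h hα

lemma comp_eq_zero_iff_of_eq {C : Type*} [Category* C] [Preadditive C] {X₀ X₁ X₂ X₃ X₄ X₅ X₆ : C}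
    {s : X₁ ⟶ X₂} {e : X₂ ≅ X₃} {a : X₁ ⟶ X₄} {b : X₄ ⟶ X₅} {t : X₅ ⟶ X₆} {i : X₃ ≅ X₆}
    (h : s ≫ e.hom = a ≫ b ≫ t ≫ i.inv) (v : X₀ ⟶ X₁) :
    v ≫ s = 0 ↔ v ≫ (a ≫ b) ≫ t = 0 := by
  rw [← Preadditive.IsIso.comp_right_eq_zero _ e.hom, Category.assoc, h,
    ← Preadditive.IsIso.comp_right_eq_zero (v ≫ (a ≫ b) ≫ t) i.inv]
  simp only [Category.assoc]

lemma map_tauGamma_eq_zero_iff (c d : ℝ≥0) {F G : Db k (MR M)}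
    (v : (Qgamma k E M).obj F ⟶ (translGamma k E M c).obj ((Qgamma k E M).obj G)) :
    v ≫ (translGamma k E M c).map ((tauGamma E d).app ((Qgamma k E M).obj G)) = 0 ↔
      v ≫ (translGammaTr E c G).hom ≫ tau E (NNReal.coe_le_coe.2 (le_self_add (a := c) (b := d))) G
        = 0 := by
  have h := map_tauGamma_comp (E := E) c d (NNReal.coe_add c d).symm
    (NNReal.coe_le_coe.2 (le_self_add (a := c) (b := d))) G
  rw [translTau] at h
  exact comp_eq_zero_iff_of_eq (e := translGammaAdd E (NNReal.coe_add c d).symm G)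
    (i := (Qgamma k E M).mapIso ((pullTr k M (c + d : ℝ≥0)).app G)) h v

variable (k E M) in
/-- The torsion objects are those of the persistence structure. -/
lemma Ntor_eq : Ntor k E M = (persistenceGamma k E M).torsion := by
  have key (c : ℝ≥0) (F : Db k (MR M)) :
      tauZero E c F = 0 ↔ (tauGamma E c).app ((Qgamma k E M).obj F) = 0 := by
    rw [tauZero_eq]
    refine ⟨fun h => ?_, fun h => by rw [h, zero_comp, comp_zero]⟩
    rwa [Preadditive.IsIso.comp_left_eq_zero, Preadditive.IsIso.comp_right_eq_zero] at h
  ext X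
  constructor
  · rintro ⟨F, ⟨e⟩, c, hc⟩
    exact (persistenceGamma k E M).torsion.prop_of_iso e ⟨c, (key c F).1 hc⟩
  · rintro ⟨c, hc⟩
    obtain ⟨F, rfl⟩ := Qgamma_obj_surjective X
    exact ⟨F, ⟨Iso.refl _⟩, c, (key c F).2 hc⟩

instance : (Ntor k E M).IsTriangulated := by
  rw [Ntor_eq]
  infer_instance

lemma isIso_Qtor_map_tauGamma (c : ℝ≥0) (X : Dgamma k E M) :
    IsIso ((Qtor k E M).map ((tauGamma E c).app X)) := by
  have h := (persistenceGamma k E M).torsion_trW_τ c X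
  rw [← Ntor_eq] at h
  exact Localization.inverts _ _ _ h

instance isIso_Qtor_map_tauZero (c : ℝ≥0) (F : Db k (MR M)) :
    IsIso ((Qtor k E M).map (tauZero E c F)) := by
  have := isIso_Qtor_map_tauGamma c ((Qgamma k E M).obj F)
  rw [tauZero_eq, Functor.map_comp, Functor.map_comp]
  infer_instance

lemma tauZero_comp {c d : ℝ≥0} (h : c ≤ d) (F : Db k (MR M)) :
    tauZero E c F ≫ tau E (NNReal.coe_le_coe.2 h) F = tauZero E d F := by
  exact (Category.assoc _ _ _).trans
    (whisker_eq _ (tau_comp c.coe_nonneg (NNReal.coe_le_coe.2 h) F))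

/-- The kernel of the morphism from the colimit is zero. -/
lemma exists_comp_tau_eq_zero {F G : Db k (MR M)} (c : ℝ≥0) (v : HomTr E F G c)
    (hv : (Qtor k E M).map v = 0) :
    ∃ (d : ℝ≥0) (h : c ≤ d), homTrMap E F G c d h v = 0 := by
  have : ∃ d, (v ≫ (translGammaTr E c G).inv) ≫
      (translGamma k E M c).map ((tauGamma E d).app ((Qgamma k E M).obj G)) = 0 := by
    refine (persistenceGamma k E M).exists_comp_map_τ_eq_zero' (Ntor_eq k E M) c _ ?_
    exact (Functor.map_comp _ _ _).trans ((eq_whisker hv _).trans zero_comp)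
  obtain ⟨d, hd⟩ := this
  rw [map_tauGamma_eq_zero_iff, Category.assoc, Iso.inv_hom_id_assoc] at hd
  exact ⟨c + d, le_self_add, hd⟩

/-- The morphism from the colimit is surjective. -/
lemma exists_comp_tauZero_eq {F G : Db k (MR M)}
    (f : (Qtor k E M).obj ((Qgamma k E M).obj F) ⟶ (Qtor k E M).obj ((Qgamma k E M).obj G)) :
    ∃ (c : ℝ≥0) (v : HomTr E F G c),
      f ≫ (Qtor k E M).map (tauZero E c G) = (Qtor k E M).map v := by
  obtain ⟨c, w, hw⟩ := (persistenceGamma k E M).exists_map_eq_comp_map_τ' (Ntor_eq k E M)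
    (f ≫ (Qtor k E M).map ((Qgamma k E M).mapIso (trZeroAut G)).inv)
  refine ⟨c, w ≫ (translGammaTr E c G).hom, ?_⟩
  have h := eq_whisker hw ((Qtor k E M).map (translGammaTr E c G).hom)
  rw [tauZero_eq, Functor.map_comp, Functor.map_comp]
  refine Eq.trans ?_ (h.trans ((Qtor k E M).map_comp w _).symm)
  exact ((Category.assoc _ _ _).trans (Category.assoc _ _ _)).symm

variable (E)

/-- The morphism from the colimit of the `Hom(F, T_{c*} G)` to the morphisms of the quotient. -/
def colimHomTrMap (F G : Db k (MR M)) : ColimHomTr E F G →ₗ[k]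
    ((Qtor k E M).obj ((Qgamma k E M).obj F) ⟶ (Qtor k E M).obj ((Qgamma k E M).obj G)) :=
  Module.DirectLimit.lift k ℝ≥0 (HomTr E F G) (homTrMap E F G)
    (fun c => Linear.rightComp k _ (inv ((Qtor k E M).map (tauZero E c G))) ∘ₗ
      (Qtor k E M).mapLinearMap k) (by
    intro c d h v
    have h' := congrArg (Qtor k E M).map (tauZero_comp h G)
    rw [Functor.map_comp] at h'
    change (Qtor k E M).map (v ≫ tau E (NNReal.coe_le_coe.2 h) G) ≫ _ = (Qtor k E M).map v ≫ _
    rw [Functor.map_comp, Category.assoc]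
    refine whisker_eq _ ?_
    rw [IsIso.comp_inv_eq, ← h', IsIso.inv_hom_id_assoc])

variable {E}

/-- The class of `v` is sent to `τ_{0,c}(G)⁻¹ ∘ v`. -/
lemma colimHomTrMap_of (F G : Db k (MR M)) (c : ℝ≥0) (v : HomTr E F G c) :
    colimHomTrMap E F G (Module.DirectLimit.of k ℝ≥0 (HomTr E F G) (homTrMap E F G) c v) ≫
      (Qtor k E M).map (tauZero E c G) = (Qtor k E M).map v := by
  rw [colimHomTrMap, Module.DirectLimit.lift_of]
  change ((Qtor k E M).map v ≫ inv ((Qtor k E M).map (tauZero E c G))) ≫ _ = _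
  rw [Category.assoc, IsIso.inv_hom_id, Category.comp_id]

lemma colimHomTrMap_bijective (F G : Db k (MR M)) :
    Function.Bijective (colimHomTrMap E F G) := by
  constructor
  · rw [injective_iff_map_eq_zero]
    intro x hx
    obtain ⟨c, v, rfl⟩ := Module.DirectLimit.exists_of x
    have h := colimHomTrMap_of F G c v
    rw [hx, zero_comp] at h
    obtain ⟨d, hd, h0⟩ := exists_comp_tau_eq_zero c v h.symm
    rw [← Module.DirectLimit.of_f (hij := hd), h0, map_zero]
  · intro f
    obtain ⟨c, v, hv⟩ := exists_comp_tauZero_eq f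
    refine ⟨Module.DirectLimit.of k ℝ≥0 (HomTr E F G) (homTrMap E F G) c v, ?_⟩
    rw [← cancel_mono ((Qtor k E M).map (tauZero E c G)), colimHomTrMap_of, hv]

end Torsion

end SheafTorsion

end

theorem mainTheorem9 {k : Type u} [CommRing k]
    {E : Type u} [NormedAddCommGroup E] [NormedSpace ℝ E] [FiniteDimensional ℝ E]
    {M : Type u} [TopologicalSpace M] [T2Space M] [SecondCountableTopology M] [ChartedSpace E M]
    [IsManifold (modelWithCornersSelf ℝ E) ∞ M] (F G : Db k (MR M)) :
    (∀ (c : ℝ) (H : Db k (MR M)), Nonempty (ConvData E c H)) ∧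
    (∀ (c : ℝ) (H : Db k (MR M)), tau E (le_refl c) H = 𝟙 _) ∧
    (∀ (b c d : ℝ) (h : b ≤ c) (h' : c ≤ d) (H : Db k (MR M)),
      tau E h H ≫ tau E h' H = tau E (h.trans h') H) ∧
    ∃ _ : (Ntor k E M).IsTriangulated,
      (∀ (c : ℝ≥0) (H : Db k (MR M)), IsIso ((Qtor k E M).map (tauZero E c H))) ∧
      ∃ Φ : ColimHomTr E F G ≃ₗ[k]
          ((Qtor k E M).obj ((Qgamma k E M).obj F) ⟶ (Qtor k E M).obj ((Qgamma k E M).obj G)),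
        ∀ (c : ℝ≥0) (v : HomTr E F G c),
          Φ (Module.DirectLimit.of k ℝ≥0 (HomTr E F G) (homTrMap E F G) c v) ≫
            (Qtor k E M).map (tauZero E c G) = (Qtor k E M).map v := by
  refine ⟨fun c H => nonempty_convData E c H, fun c H => tau_self c H,
    fun b c d h h' H => tau_comp h h' H, inferInstance, fun c H => isIso_Qtor_map_tauZero c H,
    LinearEquiv.ofBijective (colimHomTrMap E F G) (colimHomTrMap_bijective F G), fun c v => ?_⟩
  exact colimHomTrMap_of F G c v
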